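/- **Theorem.** Index $\mathbb{R}^{\binom{6}{3}}$ by the $3$-subsets $I$ of $[6]=\{1,\dots,6\}$, and write $p_I(A)$ for the maximal minor of a $3\times 6$ matrix $A$ on the columns in $I$, in increasing order. A sign vector $\chi\in\{\pm1\}^{\binom{6}{3}}$ is a *uniform realizable chirotope* if $\chi_I=\operatorname{sign} p_I(A)$ for all $I$, for some real $3\times 6$ matrix $A$. Two of them are *isomorphic* if they are related by a relabeling $\chi_I\mapsto\chi_{\sigma(I)}$, $\sigma\in S_6$ (where $\chi$ is extended to ordered triples as an alternating function, so that $\chi_{\sigma(I)}=\chi(\sigma i_1,\sigma i_2,\sigma i_3)$ for $I=\{i_1<i_2<i_3\}$), and a reorientation $\chi_I\mapsto\bigl(\prod_{i\in I}t_i\bigr)\chi_I$, $t\in\{\pm1\}^6$. For a real polynomial $g$ in the variables $p_I$, let $g^\chi_+$ and $g^\chi_-$ be the sums of its terms whose value at $\chi$ is positive, respectively negative, and let $\operatorname{Trop}^\chi V(g)$ be the set of $x\in\mathbb{R}^{\binom{6}{3}}$ with $\operatorname{Trop}(g^\chi_+)(x)=\operatorname{Trop}(g^\chi_-)(x)$,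 where $\operatorname{Trop}(h)(x)$ is the minimum of $m\cdot x$ over the exponent vectors $m$ of $h$ (and is $\infty$ for $h=0$). The chirotropical Dressian $\mathrm{Dr}^\chi(3,6)$ is the intersection of the sets $\operatorname{Trop}^\chi V(g)$ over all three-term Plücker relations $g=p_{\ell ab}p_{\ell cd}-p_{\ell ac}p_{\ell bd}+p_{\ell ad}p_{\ell bc}$ with $a<b<c<d$ and $\ell\notin\{a,b,c,d\}$. The chirotropical Grassmannian $\operatorname{Trop}^\chi \mathrm{G}(3,6)$ is the intersection of the sets $\operatorname{Trop}^\chi V(g)$ over all $g$ in the Plücker ideal $I_{3,6}\subset\mathbb{Z}[p_I]$, that is, over all integer polynomial relations between the maximal minors of a generic $3\times6$ matrix. Give $\mathrm{Dr}^\chi(3,6)$ the cones that are the closures of the classes of points of $\mathrm{Dr}^\chi(3,6)$ at which, in each three-term Plücker relation, the minimum is attained at the same monomials. Let $L_{3,6}$ be the space of all vectors $\bigl(\sum_{i\in I}x_i\bigr)_I$ with $x\in\mathbb{R}^6$. Every uniform realizable chirotope $\chi\in\{\pm1\}^{\binom{6}{3}}$ is isomorphic to exactly one of the following four sign vectors,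 each of which is a uniform realizable chirotope. Moreover $\mathrm{Dr}^\chi(3,6)=\operatorname{Trop}^\chi \mathrm{G}(3,6)$; the cones above form a polyhedral fan with support $\mathrm{Dr}^\chi(3,6)$, in which every cone has lineality space $L_{3,6}$; and modulo $L_{3,6}$ this fan is pure of dimension $4$. Its f-vector, which counts the cones of dimension $1,2,3,4$ modulo $L_{3,6}$, depends only on the isomorphism class of $\chi$: | # | $3$-subsets $I$ with negative entry in the representative | f-vector | |---|---|---| | 1 | $146,\ 156,\ 256$ | $(15,60,90,45)$ | | 2 | $356,\ 456$ | $(15,60,89,44)$ | | 3 | $456$ | $(14,55,82,41)$ | | 4 | none | $(16,66,98,48)$ | -/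

import Mathlib

namespace Chirotropical

/-! ### Plücker coordinates, chirotopes and their isomorphisms -/

/-- The `k`-element subsets of an `n`-element ground set. -/
abbrev KSubset (k n : ℕ) : Type := {I : Finset (Fin n) // I.card = k}

/-- The Plücker coordinate `p_I` of the row space of a `k × n` matrix: the maximal minor on the
columns in `I`, taken in increasing order. -/
def pluckerCoord {R : Type*} [CommRing R] {k n : ℕ} (A : Matrix (Fin k) (Fin n) R)
    (I : KSubset k n) : R :=
  (A.submatrix id (I.1.orderEmbOfFin I.2)).det

/-- Sign vectors indexed by the `k`-subsets of an `n`-element set. -/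
abbrev SignVector (k n : ℕ) : Type := KSubset k n → ℤˣ

/-- A sign vector is a (uniform) realizable chirotope if it is the vector of signs of the Plücker
coordinates of a real `k × n` matrix. Since the entries are `1` or `-1`, no Plücker coordinate of
such a matrix vanishes. -/
def IsRealizable {k n : ℕ} (χ : SignVector k n) : Prop :=
  ∃ A : Matrix (Fin k) (Fin n) ℝ, ∀ I : KSubset k n,
    ((SignType.sign (pluckerCoord A I) : SignType) : ℤ) = (χ I : ℤ)

/-- The sign of the permutation which sorts `σ i₁, …, σ iₖ`, where `i₁ < ⋯ < iₖ` are the elements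
of `I`: one factor `-1` for each inversion of `σ` on `I`. -/
def sortSign {n : ℕ} (σ : Equiv.Perm (Fin n)) (I : Finset (Fin n)) : ℤˣ :=
  ∏ p ∈ (I ×ˢ I).filter (fun p => p.1 < p.2), if σ p.1 < σ p.2 then 1 else -1

/-- Relabeling of the ground set: `χ_I` becomes `χ_{σ(I)}`, where, as always for chirotopes,
`χ` is extended to ordered `k`-tuples as an alternating function, so that
`χ_{σ(I)} = χ(σ i₁, …, σ iₖ)` for `I = {i₁ < ⋯ < iₖ}`. -/
def relabel {k n : ℕ} (σ : Equiv.Perm (Fin n)) (χ : SignVector k n) : SignVector k n :=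
  fun I => sortSign σ I.1 * χ ⟨I.1.map σ.toEmbedding, (Finset.card_map _).trans I.2⟩

/-- Reorientation by a torus element with entries `1` and `-1`. -/
def reorient {k n : ℕ} (t : Fin n → ℤˣ) (χ : SignVector k n) : SignVector k n :=
  fun I => (∏ i ∈ I.1, t i) * χ I

/-- Two chirotopes are isomorphic if they are related by a relabeling and a reorientation. -/
def Isomorphic {k n : ℕ} (χ χ' : SignVector k n) : Prop :=
  ∃ (σ : Equiv.Perm (Fin n)) (t : Fin n → ℤˣ), χ' = reorient t (relabel σ χ)

/-! ### Chirotropical hypersurfaces, Dressian and Grassmannian -/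

noncomputable section

/-- The value `m · x` of the exponent vector `m` at the weight `x`. -/
def weight {ι : Type*} (x : ι → ℝ) (m : ι →₀ ℕ) : ℝ :=
  m.sum fun i e => (e : ℝ) * x i

/-- The value at `χ` of the term of `g` with exponent vector `m`. -/
def termValue {ι : Type*} (χ : ι → ℤˣ) (g : MvPolynomial ι ℝ) (m : ι →₀ ℕ) : ℝ :=
  g.coeff m * m.prod fun i e => (((χ i : ℤ) : ℝ)) ^ e

open Classical in
/-- The exponent vectors of `g_+^χ`, the terms of `g` that are positive at `χ`. -/
def posSupport {ι : Type*} (χ : ι → ℤˣ) (g : MvPolynomial ι ℝ) : Finset (ι →₀ ℕ) :=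
  g.support.filter fun m => 0 < termValue χ g m

open Classical in
/-- The exponent vectors of `g_-^χ`, the terms of `g` that are negative at `χ`. -/
def negSupport {ι : Type*} (χ : ι → ℤˣ) (g : MvPolynomial ι ℝ) : Finset (ι →₀ ℕ) :=
  g.support.filter fun m => termValue χ g m < 0

/-- The tropical polynomial with support `s` at `x`; the empty minimum is `∞`. -/
def tropMin {ι : Type*} (s : Finset (ι →₀ ℕ)) (x : ι → ℝ) : WithTop ℝ :=
  s.inf fun m => ((weight x m : ℝ) : WithTop ℝ)

/-- The chirotropical hypersurface `Trop^χ V(g)`. -/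
def chiHypersurface {ι : Type*} (χ : ι → ℤˣ) (g : MvPolynomial ι ℝ) : Set (ι → ℝ) :=
  {x | tropMin (posSupport χ g) x = tropMin (negSupport χ g) x}

/-- The three-term Plücker relations
`p_{Lab} p_{Lcd} - p_{Lac} p_{Lbd} + p_{Lad} p_{Lbc}` with `a < b < c < d` outside of `L`. -/
def threeTermRelations (k n : ℕ) : Set (MvPolynomial (KSubset k n) ℤ) :=
  {g | ∃ (L : Finset (Fin n)) (a b c d : Fin n) (Lab Lcd Lac Lbd Lad Lbc : KSubset k n),
    (a < b ∧ b < c ∧ c < d) ∧ (a ∉ L ∧ b ∉ L ∧ c ∉ L ∧ d ∉ L) ∧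
    Lab.1 = insert a (insert b L) ∧ Lcd.1 = insert c (insert d L) ∧
    Lac.1 = insert a (insert c L) ∧ Lbd.1 = insert b (insert d L) ∧
    Lad.1 = insert a (insert d L) ∧ Lbc.1 = insert b (insert c L) ∧
    g = MvPolynomial.X Lab * MvPolynomial.X Lcd - MvPolynomial.X Lac * MvPolynomial.X Lbd
      + MvPolynomial.X Lad * MvPolynomial.X Lbc}

/-- The chirotropical Dressian `Dr^χ(k,n)`. -/
def chiDressian {k n : ℕ} (χ : SignVector k n) : Set (KSubset k n → ℝ) :=
  ⋂ g ∈ threeTermRelations k n, chiHypersurface χ (g.map (Int.castRingHom ℝ))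

/-- The Plücker ideal: all integer polynomial relations between the maximal minors of a generic
`k × n` matrix. -/
def pluckerIdeal (k n : ℕ) : Ideal (MvPolynomial (KSubset k n) ℤ) :=
  RingHom.ker (MvPolynomial.aeval (R := ℤ) fun I : KSubset k n =>
    pluckerCoord (Matrix.mvPolynomialX (Fin k) (Fin n) ℤ) I)

/-- The chirotropical Grassmannian `Trop^χ G(k,n)`. -/
def chiGrassmannian {k n : ℕ} (χ : SignVector k n) : Set (KSubset k n → ℝ) :=
  ⋂ g ∈ pluckerIdeal k n, chiHypersurface χ (g.map (Int.castRingHom ℝ))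

/-! ### The fan structure -/

/-- The lineality space `L_{k,n}`: the vectors `π_I = ∑_{i ∈ I} x_i` with `x ∈ ℝⁿ`. -/
def lineality (k n : ℕ) : Submodule ℝ (KSubset k n → ℝ) :=
  LinearMap.range (LinearMap.pi fun I : KSubset k n =>
    ∑ i ∈ I.1, (LinearMap.proj i : (Fin n → ℝ) →ₗ[ℝ] ℝ))

/-- The set of monomials of `g` at which the minimum in `Trop(g)(x)` is attained. -/
def minMonomials {ι : Type*} (g : MvPolynomial ι ℤ) (x : ι → ℝ) : Set (ι →₀ ℕ) :=
  {m | m ∈ g.support ∧ ∀ m' ∈ g.support, weight x m ≤ weight x m'}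

theorem weight_add {ι : Type*} (x y : ι → ℝ) (m : ι →₀ ℕ) :
    weight (x + y) m = weight x m + weight y m := by
  simp [weight, Finsupp.sum, mul_add, Finset.sum_add_distrib]

theorem weight_smul {ι : Type*} (c : ℝ) (x : ι → ℝ) (m : ι →₀ ℕ) :
    weight (c • x) m = c * weight x m := by
  simp [weight, Finsupp.sum, Finset.mul_sum, mul_left_comm]

/-- The closed cone of the Dressian that has `w` in its relative interior: the vectors `x` such
that, in each three-term Plücker relation, the minimum at `x` is attained by (at least) all the
monomials that attain it at `w`. -/
def dressianCone {k n : ℕ} (w : KSubset k n → ℝ) : PointedCone ℝ (KSubset k n → ℝ) where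
  carrier := {x | ∀ g ∈ threeTermRelations k n, minMonomials g w ⊆ minMonomials g x}
  zero_mem' := by
    intro g _ m hm
    exact ⟨hm.1, fun m' _ => by simp [weight, Finsupp.sum]⟩
  add_mem' := by
    intro x y hx hy g hg m hm
    refine ⟨hm.1, fun m' hm' => ?_⟩
    rw [weight_add, weight_add]
    exact add_le_add ((hx g hg hm).2 m' hm') ((hy g hg hm).2 m' hm')
  smul_mem' := by
    intro c x hx g hg m hm
    refine ⟨hm.1, fun m' hm' => ?_⟩
    change weight ((c : ℝ) • x) m ≤ weight ((c : ℝ) • x) m'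
    rw [weight_smul, weight_smul]
    exact mul_le_mul_of_nonneg_left ((hx g hg hm).2 m' hm') c.2

/-- The cones of the chirotropical Dressian: the relative interiors are the classes of points of
`Dr^χ(k,n)` that attain the minimum at the same monomials in each three-term Plücker relation. -/
def chiFan {k n : ℕ} (χ : SignVector k n) : Set (PointedCone ℝ (KSubset k n → ℝ)) :=
  dressianCone '' chiDressian χ

/-- Polyhedral fans: finite non-empty collections of polyhedral cones, closed under taking faces,
in which any two cones meet in a common face. -/
structure IsPolyhedralFan {V : Type*} [AddCommGroup V] [Module ℝ V]
    (F : Set (PointedCone ℝ V)) : Prop where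
  nonempty : F.Nonempty
  finite : F.Finite
  polyhedral : ∀ C ∈ F, ∃ s : Finset (Module.Dual ℝ V), ∀ x, x ∈ C ↔ ∀ f ∈ s, 0 ≤ f x
  face_mem : ∀ C ∈ F, ∀ D : PointedCone ℝ V, D.IsFaceOf C → D ∈ F
  inter_isFaceOf : ∀ C ∈ F, ∀ D ∈ F, (C ⊓ D).IsFaceOf C

/-- The dimension of the cone `C` modulo a linear subspace `L`, that is, the dimension of the span
of the image of `C` in the quotient by `L`. -/
def dimMod {V : Type*} [AddCommGroup V] [Module ℝ V] (L : Submodule ℝ V)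
    (C : PointedCone ℝ V) : ℕ :=
  Module.finrank ℝ ((Submodule.span ℝ (C : Set V)).map L.mkQ)

/-- A fan is pure of dimension `d` modulo `L` if all its maximal cones have that dimension. -/
def IsPureOfDim {V : Type*} [AddCommGroup V] [Module ℝ V] (L : Submodule ℝ V)
    (F : Set (PointedCone ℝ V)) (d : ℕ) : Prop :=
  ∀ C, Maximal (· ∈ F) C → dimMod L C = d

/-- The number of cones of dimension `d` modulo `L`. -/
def numCones {V : Type*} [AddCommGroup V] [Module ℝ V] (L : Submodule ℝ V)
    (F : Set (PointedCone ℝ V)) (d : ℕ) : ℕ :=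
  {C | C ∈ F ∧ dimMod L C = d}.ncard

end

/-! ### The four representatives -/

/-- The sign vector whose negative entries are those indexed by `N`. -/
def ofNegatives {k n : ℕ} (N : Finset (Finset (Fin n))) : SignVector k n :=
  fun I => if I.1 ∈ N then -1 else 1

/-- The four representatives, with ground set `{0, …, 5}` in place of `{1, …, 6}`: the negative
entries are `146, 156, 256`, then `356, 456`, then `456`, then none. -/
def representative : Fin 4 → SignVector 3 6 :=
  ![ofNegatives {{0, 3, 5}, {0, 4, 5}, {1, 4, 5}},
    ofNegatives {{2, 4, 5}, {3, 4, 5}},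
    ofNegatives {{3, 4, 5}},
    ofNegatives ∅]

/-- The corresponding numbers of cones of dimension `1, 2, 3, 4`. -/
def fVectors : Fin 4 → Fin 4 → ℕ :=
  ![![15, 60, 90, 45],
    ![15, 60, 89, 44],
    ![14, 55, 82, 41],
    ![16, 66, 98, 48]]

end Chirotropical

open Chirotropical

/-! The sign condition on three-term relations does most of the work. A realizable sign vector
satisfies `IsChirotope`: no three-term relation has all its terms of one sign. So exactly one term
is `Odd`, and the tropical condition says that its weight is the minimum of the two other weights.
With signs extended alternatingly, this description is symmetric under relabeling, and a
reorientation multiplies the three terms by a common sign. Hence Dressian, cones and lifts are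
transported along isomorphisms (`isModel_of_eq`), and only the four representatives need
computation. The fan axioms and the lineality space are formal, because a cone is given by an
inclusion of patterns of minimal monomials (`isPolyhedralFan_chiFan`, `lineal_dressianCone`).

Combinatorics of the fan: each of the thirty relations has two slacks, the excesses of the two other
weights over that of the odd monomial. Both are nonnegative and one vanishes. The set of positive
slacks of a point, its support, determines its cone. Linear identities between slacks restrict the
supports, and `enumerate` lists all candidates; conversely each candidate is a union of supports of
rays, and the sum of these rays realizes it (`exists_tropical`). So the list is exact. It is graded
by the number of rays, capped at four. A strict inclusion of supports raises the dimension
(`dimMod_lt_dimMod`), the layers are linked, and the top layer has dimension at most four; this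
forces dimension = rank (`dimMod_eq`), which yields purity and the f-vector.

Dressian and Grassmannian: one inclusion holds because the three-term relations lie in the Plücker
ideal. Conversely, a point belongs to the Grassmannian if its coordinates are the leading exponents,
as t decreases to 0, of the signed minors of real matrices (`Liftable.mem_chiGrassmannian`). A
program of `Step`s prescribes ten minors and derives the ten others from three-term relations. Sums
of positive functions do not cancel, and differences are used only where the exponents differ
strictly. Read linearly, the same program bounds the span of a cone by ten dimensions, six of them
lineality. Each support of the top layer admits a program, and every other point is a limit of
points that lift.

Classification: a reorientation makes six chosen entries positive. The sign vectors of this normal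
form that obey the three-term sign conditions are enumerated, and relabelings lower their codes
until a representative is reached (`exists_isomorphic`). The representatives are not isomorphic
because their f-vectors differ. -/

namespace Chirotropical

/-! ### Subsets of the ground set coded by binary digits -/

/-- The `3`-subset of `{0, …, 5}` whose elements are the positions of the binary digits `1`
of `n`. -/
def decode (n : ℕ) : KSubset 3 6 :=
  if h : (Finset.univ.filter fun i : Fin 6 => n.testBit i).card = 3 then ⟨_, h⟩
  else ⟨{0, 1, 2}, by decide⟩

/-- The code of the set `{i, j, k}`. -/
def code3 (i j k : Fin 6) : ℕ := 2 ^ (i : ℕ) + 2 ^ (j : ℕ) + 2 ^ (k : ℕ)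

/-- The `3`-subset `{i, j, k}`, if `i, j, k` are distinct. -/
def tr (i j k : Fin 6) : KSubset 3 6 := decode (code3 i j k)

/-- A code is a symmetric sum, so `tr` is symmetric without any distinctness hypothesis; repeated
entries only produce the default value of `decode`. -/
theorem tr_swap_left (i j k : Fin 6) : tr j i k = tr i j k := by
  unfold tr code3; congr 1; ring

theorem tr_swap_right (i j k : Fin 6) : tr i k j = tr i j k := by
  unfold tr code3; congr 1; ring

theorem tr_val : ∀ i j k : Fin 6, i ≠ j → i ≠ k → j ≠ k → (tr i j k).1 = {i, j, k} := by
  decide +kernel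

theorem exists_eq_tr (I : KSubset 3 6) : ∃ i j k, i < j ∧ j < k ∧ I = tr i j k := by
  have key : ∀ I : Finset (Fin 6), I.card = 3 → ∃ i j k, i < j ∧ j < k ∧ I = (tr i j k).1 := by
    decide +kernel
  obtain ⟨i, j, k, hij, hjk, h⟩ := key I.1 I.2
  exact ⟨i, j, k, hij, hjk, Subtype.ext h⟩

/-- The elements `l, a, b, c, d` are pairwise distinct. -/
def Distinct5 (l a b c d : Fin 6) : Prop :=
  (l ≠ a ∧ l ≠ b ∧ l ≠ c ∧ l ≠ d) ∧ a ≠ b ∧ a ≠ c ∧ a ≠ d ∧ b ≠ c ∧ b ≠ d ∧ c ≠ d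

instance (l a b c d : Fin 6) : Decidable (Distinct5 l a b c d) := by
  unfold Distinct5; infer_instance

/-- A property of four distinct elements that is stable under adjacent transpositions has to be
checked for increasing sequences only. -/
theorem forall_distinct_of_sorted {l : Fin 6} {P : Fin 6 → Fin 6 → Fin 6 → Fin 6 → Prop}
    (h₁ : ∀ a b c d, Distinct5 l a b c d → P a b c d → P b a c d)
    (h₂ : ∀ a b c d, Distinct5 l a b c d → P a b c d → P a c b d)
    (h₃ : ∀ a b c d, Distinct5 l a b c d → P a b c d → P a b d c)
    (h : ∀ a b c d, Distinct5 l a b c d → a < b → b < c → c < d → P a b c d) :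
    ∀ a b c d, Distinct5 l a b c d → P a b c d := by
  -- This is the sorting network with five comparators on four entries, run backwards: each claim
  -- removes one comparison from the hypotheses of the preceding one.
  have s₁ : ∀ a b c d, Distinct5 l a b c d → a < b → c < d → a < c → b < d → P a b c d := by
    intro a b c d hd hab hcd hac hbd
    have hd' := hd
    obtain ⟨⟨_, _, _, _⟩, _, _, _, hbc, _, _⟩ := hd'
    rcases lt_or_gt_of_ne hbc with hbc | hbc
    · exact h a b c d hd hab hbc hcd
    · have hd' : Distinct5 l a c b d := by unfold Distinct5 at *; tauto
      exact h₂ _ _ _ _ hd' (h a c b d hd' hac hbc hbd)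
  have s₂ : ∀ a b c d, Distinct5 l a b c d → a < b → c < d → a < c → P a b c d := by
    intro a b c d hd hab hcd hac
    rcases lt_or_gt_of_ne hd.2.2.2.2.2.1 with hbd | hbd
    · exact s₁ a b c d hd hab hcd hac hbd
    · have d1 : Distinct5 l a d c b := by unfold Distinct5 at *; tauto
      have d2 : Distinct5 l a c d b := by unfold Distinct5 at *; tauto
      have d3 : Distinct5 l a c b d := by unfold Distinct5 at *; tauto
      exact h₂ _ _ _ _ d3 (h₃ _ _ _ _ d2 (h₂ _ _ _ _ d1
        (s₁ a d c b d1 (hac.trans hcd) (hcd.trans hbd) hac hbd)))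
  have s₃ : ∀ a b c d, Distinct5 l a b c d → a < b → c < d → P a b c d := by
    intro a b c d hd hab hcd
    rcases lt_or_gt_of_ne hd.2.2.1 with hac | hac
    · exact s₂ a b c d hd hab hcd hac
    · have d1 : Distinct5 l c d a b := by unfold Distinct5 at *; tauto
      have d2 : Distinct5 l c a d b := by unfold Distinct5 at *; tauto
      have d3 : Distinct5 l a c d b := by unfold Distinct5 at *; tauto
      have d4 : Distinct5 l a c b d := by unfold Distinct5 at *; tauto
      exact h₂ _ _ _ _ d4 (h₃ _ _ _ _ d3 (h₁ _ _ _ _ d2 (h₂ _ _ _ _ d1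
        (s₂ c d a b d1 hcd hab hac))))
  have s₄ : ∀ a b c d, Distinct5 l a b c d → a < b → P a b c d := by
    intro a b c d hd hab
    rcases lt_or_gt_of_ne hd.2.2.2.2.2.2 with hcd | hcd
    · exact s₃ a b c d hd hab hcd
    · have d1 : Distinct5 l a b d c := by unfold Distinct5 at *; tauto
      exact h₃ _ _ _ _ d1 (s₃ a b d c d1 hab hcd)
  intro a b c d hd
  rcases lt_or_gt_of_ne hd.2.1 with hab | hab
  · exact s₄ a b c d hd hab
  · have d1 : Distinct5 l b a c d := by unfold Distinct5 at *; tauto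
    exact h₁ _ _ _ _ d1 (s₄ b a c d d1 hab)

theorem Distinct5.swap₂ {l a b c d : Fin 6} (h : Distinct5 l a b c d) : Distinct5 l a c b d := by
  unfold Distinct5 at *; tauto

theorem Distinct5.swap₃ {l a b c d : Fin 6} (h : Distinct5 l a b c d) : Distinct5 l a b d c := by
  unfold Distinct5 at *; tauto

theorem Distinct5.map {l a b c d : Fin 6} (σ : Equiv.Perm (Fin 6)) (h : Distinct5 l a b c d) :
    Distinct5 (σ l) (σ a) (σ b) (σ c) (σ d) := by
  unfold Distinct5 at *; simpa using h

/-! ### The three-term Plücker relations -/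

/-- The exponent vector of `p_{lab} p_{lcd}`. -/
noncomputable def expo (l a b c d : Fin 6) : KSubset 3 6 →₀ ℕ :=
  Finsupp.single (tr l a b) 1 + Finsupp.single (tr l c d) 1

/-- The three-term Plücker relation for `l` and `a, b, c, d`. -/
noncomputable def threeTerm (l a b c d : Fin 6) : MvPolynomial (KSubset 3 6) ℤ :=
  MvPolynomial.X (tr l a b) * MvPolynomial.X (tr l c d)
    - MvPolynomial.X (tr l a c) * MvPolynomial.X (tr l b d)
    + MvPolynomial.X (tr l a d) * MvPolynomial.X (tr l b c)

theorem mem_threeTermRelations_iff {g : MvPolynomial (KSubset 3 6) ℤ} :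
    g ∈ threeTermRelations 3 6 ↔ ∃ l a b c d, Distinct5 l a b c d ∧ a < b ∧ b < c ∧ c < d ∧
      g = threeTerm l a b c d := by
  constructor
  · rintro ⟨L, a, b, c, d, Lab, Lcd, Lac, Lbd, Lad, Lbc, ⟨hab, hbc, hcd⟩, ⟨ha, hb, hc, hd⟩,
      h1, h2, h3, h4, h5, h6, rfl⟩
    -- `Lab` has three elements and `a`, `b` lie outside `L`, so `L` is a singleton.
    have hL : L.card = 1 := by
      have h := Lab.2
      rw [h1, Finset.card_insert_of_notMem, Finset.card_insert_of_notMem hb] at h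
      · omega
      · simp [hab.ne, ha]
    obtain ⟨l, rfl⟩ := Finset.card_eq_one.1 hL
    simp only [Finset.mem_singleton] at ha hb hc hd
    have hD : Distinct5 l a b c d := by
      unfold Distinct5
      refine ⟨⟨Ne.symm ha, Ne.symm hb, Ne.symm hc, Ne.symm hd⟩, ?_⟩
      refine ⟨hab.ne, (hab.trans hbc).ne, (hab.trans (hbc.trans hcd)).ne, hbc.ne,
        (hbc.trans hcd).ne, hcd.ne⟩
    have key : ∀ (I : KSubset 3 6) (i j : Fin 6), l ≠ i → l ≠ j → i ≠ j →
        I.1 = insert i (insert j {l}) → I = tr l i j := by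
      intro I i j hi hj hij h
      apply Subtype.ext
      rw [h, tr_val l i j hi hj hij]
      ext z; simp; tauto
    obtain ⟨⟨la, lb, lc, ld⟩, nab, nac, nad, nbc, nbd, ncd⟩ := id hD
    refine ⟨l, a, b, c, d, hD, hab, hbc, hcd, ?_⟩
    rw [threeTerm, key Lab a b la lb nab h1, key Lcd c d lc ld ncd h2, key Lac a c la lc nac h3,
      key Lbd b d lb ld nbd h4, key Lad a d la ld nad h5, key Lbc b c lb lc nbc h6]
  · rintro ⟨l, a, b, c, d, hD, hab, hbc, hcd, rfl⟩
    obtain ⟨⟨la, lb, lc, ld⟩, nab, nac, nad, nbc, nbd, ncd⟩ := hD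
    have key : ∀ (i j : Fin 6), l ≠ i → l ≠ j → i ≠ j →
        (tr l i j).1 = insert i (insert j {l}) := by
      intro i j hi hj hij
      rw [tr_val l i j hi hj hij]
      ext z; simp; tauto
    refine ⟨{l}, a, b, c, d, tr l a b, tr l c d, tr l a c, tr l b d, tr l a d, tr l b c,
      ⟨hab, hbc, hcd⟩, ?_, key _ _ la lb nab, key _ _ lc ld ncd, key _ _ la lc nac,
      key _ _ lb ld nbd, key _ _ la ld nad, key _ _ lb lc nbc, rfl⟩
    simp [la.symm, lb.symm, lc.symm, ld.symm]

theorem threeTerm_eq (l a b c d : Fin 6) : threeTerm l a b c d =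
    MvPolynomial.monomial (expo l a b c d) 1 - MvPolynomial.monomial (expo l a c b d) 1
      + MvPolynomial.monomial (expo l a d b c) 1 := by
  simp [threeTerm, expo, MvPolynomial.X, MvPolynomial.monomial_mul]

/-- The three monomials of a relation are pairwise distinct, so nothing cancels and the coefficients
can be read off. -/
theorem expo_ne {l a b c d : Fin 6} (h : Distinct5 l a b c d) :
    expo l a b c d ≠ expo l a c b d := by
  obtain ⟨⟨la, lb, lc, ld⟩, nab, nac, nad, nbc, nbd, ncd⟩ := h
  have h1 : tr l a c ≠ tr l a b := by
    intro h
    have h := congrArg Subtype.val h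
    rw [tr_val l a c la lc nac, tr_val l a b la lb nab] at h
    have : c ∈ ({l, a, b} : Finset (Fin 6)) := h ▸ (by simp)
    simp only [Finset.mem_insert, Finset.mem_singleton] at this
    tauto
  have h2 : tr l b d ≠ tr l a b := by
    intro h
    have h := congrArg Subtype.val h
    rw [tr_val l b d lb ld nbd, tr_val l a b la lb nab] at h
    have : d ∈ ({l, a, b} : Finset (Fin 6)) := h ▸ (by simp)
    simp only [Finset.mem_insert, Finset.mem_singleton] at this
    tauto
  intro h
  have := DFunLike.congr_fun h (tr l a b)
  simp [expo, Finsupp.single_apply, h1, h2] at this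

theorem expo_swap (l a b c d : Fin 6) : expo l a b d c = expo l a b c d := by
  simp [expo, tr_swap_right]

theorem expo_ne' {l a b c d : Fin 6} (h : Distinct5 l a b c d) :
    expo l a b c d ≠ expo l a d b c := by
  have := expo_ne h.swap₃
  rwa [expo_swap] at this

theorem expo_ne'' {l a b c d : Fin 6} (h : Distinct5 l a b c d) :
    expo l a c b d ≠ expo l a d b c := by
  have := expo_ne h.swap₂.swap₃
  rwa [expo_swap l a c b d, expo_swap l a d b c] at this

theorem weight_expo (x : KSubset 3 6 → ℝ) (l a b c d : Fin 6) :
    weight x (expo l a b c d) = x (tr l a b) + x (tr l c d) := by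
  unfold weight expo
  rw [Finsupp.sum_add_index'] <;> simp [add_mul]

theorem coeff_threeTerm {l a b c d : Fin 6} (h : Distinct5 l a b c d) :
    (threeTerm l a b c d).coeff (expo l a b c d) = 1 ∧
    (threeTerm l a b c d).coeff (expo l a c b d) = -1 ∧
    (threeTerm l a b c d).coeff (expo l a d b c) = 1 := by
  rw [threeTerm_eq]
  have h1 := expo_ne h
  have h2 := expo_ne' h
  have h3 := expo_ne'' h
  simp [MvPolynomial.coeff_monomial, h1, h2, h3, h1.symm, h2.symm, h3.symm]

theorem support_threeTerm {l a b c d : Fin 6} (h : Distinct5 l a b c d) :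
    (threeTerm l a b c d).support = {expo l a b c d, expo l a c b d, expo l a d b c} := by
  obtain ⟨h0, h1, h2⟩ := coeff_threeTerm h
  ext m
  rw [MvPolynomial.mem_support_iff]
  simp only [Finset.mem_insert, Finset.mem_singleton]
  constructor
  · intro hm
    by_contra hne
    push Not at hne
    apply hm
    rw [threeTerm_eq]
    simp [MvPolynomial.coeff_monomial, hne.1.symm, hne.2.1.symm, hne.2.2.symm]
  · rintro (rfl | rfl | rfl) <;> simp [h0, h1, h2]

/-! ### Minimal monomials of the three-term relations -/

/-- At the weight `x`, the monomial `p_{lab} p_{lcd}` is minimal among the three monomials of its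
Plücker relation. -/
def Dominates (x : KSubset 3 6 → ℝ) (l a b c d : Fin 6) : Prop :=
  x (tr l a b) + x (tr l c d) ≤ x (tr l a c) + x (tr l b d) ∧
  x (tr l a b) + x (tr l c d) ≤ x (tr l a d) + x (tr l b c)

/-- Only the splitting ab|cd matters, so a single predicate serves all three monomials of a
relation. -/
theorem dominates_swap_left (a b c d : Fin 6) {x : KSubset 3 6 → ℝ} {l : Fin 6} :
    Dominates x l b a c d ↔ Dominates x l a b c d := by
  simp only [Dominates, tr_swap_right l a b, add_comm (x (tr l b c)), add_comm (x (tr l b d))]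
  exact and_comm

theorem dominates_swap_right {x : KSubset 3 6 → ℝ} {l a b c d : Fin 6} :
    Dominates x l a b d c ↔ Dominates x l a b c d := by
  simp only [Dominates, tr_swap_right l c d]
  exact and_comm

theorem dominates_swap_pairs (a b c d : Fin 6) {x : KSubset 3 6 → ℝ} {l : Fin 6} :
    Dominates x l c d a b ↔ Dominates x l a b c d := by
  simp only [Dominates, tr_swap_right l a c, tr_swap_right l b d, tr_swap_right l a d,
    tr_swap_right l b c, add_comm (x (tr l c d)), add_comm (x (tr l b c))]

theorem expo_mem_minMonomials {x : KSubset 3 6 → ℝ} {l a b c d : Fin 6}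
    (h : Distinct5 l a b c d) :
    (expo l a b c d ∈ minMonomials (threeTerm l a b c d) x ↔ Dominates x l a b c d) ∧
    (expo l a c b d ∈ minMonomials (threeTerm l a b c d) x ↔ Dominates x l a c b d) ∧
    (expo l a d b c ∈ minMonomials (threeTerm l a b c d) x ↔ Dominates x l a d b c) := by
  simp only [minMonomials, Set.mem_ofPred_eq, support_threeTerm h, Finset.mem_insert,
    Finset.mem_singleton, forall_eq_or_imp, forall_eq, weight_expo, Dominates,
    tr_swap_right l b c, tr_swap_right l b d, tr_swap_right l c d]
  refine ⟨?_, ?_, ?_⟩ <;> simp [and_comm]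

theorem mem_dressianCone_iff {w x : KSubset 3 6 → ℝ} :
    x ∈ dressianCone w ↔
      ∀ l a b c d, Distinct5 l a b c d → Dominates w l a b c d → Dominates x l a b c d := by
  change (∀ g ∈ threeTermRelations 3 6, minMonomials g w ⊆ minMonomials g x) ↔ _
  constructor
  · intro h l
    -- The three splittings are treated together because adjacent transpositions permute them.
    suffices H : ∀ a b c d, Distinct5 l a b c d →
        ((Dominates w l a b c d → Dominates x l a b c d) ∧
        (Dominates w l a c b d → Dominates x l a c b d) ∧
        (Dominates w l a d b c → Dominates x l a d b c)) from
      fun a b c d hd => (H a b c d hd).1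
    apply forall_distinct_of_sorted
    · rintro a b c d hd ⟨h0, h1, h2⟩
      refine ⟨?_, ?_, ?_⟩
      · simpa only [dominates_swap_left a b c d] using h0
      · simpa only [dominates_swap_pairs a d b c] using h2
      · simpa only [dominates_swap_pairs a c b d] using h1
    · rintro a b c d hd ⟨h0, h1, h2⟩
      exact ⟨h1, h0, by simpa only [dominates_swap_right] using h2⟩
    · rintro a b c d hd ⟨h0, h1, h2⟩
      exact ⟨by simpa only [dominates_swap_right] using h0, h2, h1⟩
    · intro a b c d hd hab hbc hcd
      have hg := h _ (mem_threeTermRelations_iff.2 ⟨l, a, b, c, d, hd, hab, hbc, hcd, rfl⟩)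
      have Ew := expo_mem_minMonomials (x := w) hd
      have Ex := expo_mem_minMonomials (x := x) hd
      exact ⟨fun k => Ex.1.1 (hg (Ew.1.2 k)), fun k => Ex.2.1.1 (hg (Ew.2.1.2 k)),
        fun k => Ex.2.2.1 (hg (Ew.2.2.2 k))⟩
  · intro h g hg
    obtain ⟨l, a, b, c, d, hd, hab, hbc, hcd, rfl⟩ := mem_threeTermRelations_iff.1 hg
    have Ew := expo_mem_minMonomials (x := w) hd
    have Ex := expo_mem_minMonomials (x := x) hd
    intro m hm
    have hm' := hm.1
    rw [support_threeTerm hd] at hm'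
    simp only [Finset.mem_insert, Finset.mem_singleton] at hm'
    rcases hm' with rfl | rfl | rfl
    · exact Ex.1.2 (h _ _ _ _ _ hd (Ew.1.1 hm))
    · exact Ex.2.1.2 (h _ _ _ _ _ hd.swap₂ (Ew.2.1.1 hm))
    · exact Ex.2.2.2 (h _ _ _ _ _ hd.swap₃.swap₂ (Ew.2.2.1 hm))

end Chirotropical

namespace Chirotropical

/-! ### Alternating extensions -/

/-- The sign of the permutation which sorts `i, j, k`. -/
def sgn3 (i j k : Fin 6) : ℤˣ :=
  (if i < j then 1 else -1) * (if i < k then 1 else -1) * (if j < k then 1 else -1)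

theorem sgn3_swap_left {i j : Fin 6} (h : i ≠ j) (k : Fin 6) : sgn3 j i k = -sgn3 i j k := by
  unfold sgn3
  rcases lt_or_gt_of_ne h with h | h <;> simp only [h, h.not_gt, if_true, if_false] <;>
    split_ifs <;> simp

theorem sgn3_swap_right (i : Fin 6) {j k : Fin 6} (h : j ≠ k) : sgn3 i k j = -sgn3 i j k := by
  unfold sgn3
  rcases lt_or_gt_of_ne h with h | h <;> simp only [h, h.not_gt, if_true, if_false] <;>
    split_ifs <;> simp

theorem sgn3_of_lt {i j k : Fin 6} (h₁ : i < j) (h₂ : j < k) : sgn3 i j k = 1 := by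
  simp [sgn3, h₁, h₂, h₁.trans h₂]

theorem forall_distinct3_of_sorted {P : Fin 6 → Fin 6 → Fin 6 → Prop}
    (h₁ : ∀ i j k, i ≠ j → P i j k → P j i k) (h₂ : ∀ i j k, j ≠ k → P i j k → P i k j)
    (h : ∀ i j k, i < j → j < k → P i j k) {i j k : Fin 6} (hij : i ≠ j) (hik : i ≠ k)
    (hjk : j ≠ k) : P i j k := by
  have s₁ : ∀ i j k, i < j → i ≠ k → j ≠ k → P i j k := by
    intro i j k hij hik hjk
    rcases lt_or_gt_of_ne hjk with hjk | hjk
    · exact h _ _ _ hij hjk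
    · rcases lt_or_gt_of_ne hik with hik | hik
      · exact h₂ _ _ _ hjk.ne (h _ _ _ hik hjk)
      · exact h₂ _ _ _ hjk.ne (h₁ _ _ _ hik.ne (h _ _ _ hik hij))
  rcases lt_or_gt_of_ne hij with hij | hij
  · exact s₁ _ _ _ hij hik hjk
  · exact h₁ _ _ _ hij.ne (s₁ _ _ _ hij hjk hik)

/-- The extension of a sign vector to an alternating function. -/
def alt (χ : SignVector 3 6) (i j k : Fin 6) : ℤˣ := sgn3 i j k * χ (tr i j k)

theorem alt_swap_left (χ : SignVector 3 6) {i j : Fin 6} (h : i ≠ j) (k : Fin 6) :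
    alt χ j i k = -alt χ i j k := by
  rw [alt, alt, sgn3_swap_left h, tr_swap_left, neg_mul]

theorem alt_swap_right (χ : SignVector 3 6) (i : Fin 6) {j k : Fin 6} (h : j ≠ k) :
    alt χ i k j = -alt χ i j k := by
  rw [alt, alt, sgn3_swap_right i h, tr_swap_right, neg_mul]

/-- The determinant of the columns `i, j, k`. -/
def colDet {R : Type*} [CommRing R] {n : ℕ} (A : Matrix (Fin 3) (Fin n) R) (i j k : Fin n) : R :=
  (A.submatrix id ![i, j, k]).det

theorem colDet_eq {R : Type*} [CommRing R] {n : ℕ} (A : Matrix (Fin 3) (Fin n) R)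
    (i j k : Fin n) : colDet A i j k =
      A 0 i * A 1 j * A 2 k - A 0 i * A 1 k * A 2 j - A 0 j * A 1 i * A 2 k
        + A 0 j * A 1 k * A 2 i + A 0 k * A 1 i * A 2 j - A 0 k * A 1 j * A 2 i := by
  simp [colDet, Matrix.det_fin_three]

theorem colDet_swap_left {R : Type*} [CommRing R] {n : ℕ} (A : Matrix (Fin 3) (Fin n) R)
    (i j k : Fin n) : colDet A j i k = -colDet A i j k := by
  simp only [colDet_eq]; ring

theorem colDet_swap_right {R : Type*} [CommRing R] {n : ℕ} (A : Matrix (Fin 3) (Fin n) R)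
    (i j k : Fin n) : colDet A i k j = -colDet A i j k := by
  simp only [colDet_eq]; ring

theorem colDet_plucker {R : Type*} [CommRing R] {n : ℕ} (A : Matrix (Fin 3) (Fin n) R)
    (l a b c d : Fin n) : colDet A l a b * colDet A l c d - colDet A l a c * colDet A l b d
      + colDet A l a d * colDet A l b c = 0 := by
  simp only [colDet_eq]; ring

theorem pluckerCoord_tr_of_lt {R : Type*} [CommRing R] (A : Matrix (Fin 3) (Fin 6) R)
    {i j k : Fin 6} (h₁ : i < j) (h₂ : j < k) : pluckerCoord A (tr i j k) = colDet A i j k := by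
  have hv := tr_val i j k h₁.ne (h₁.trans h₂).ne h₂.ne
  have : ![i, j, k] = (tr i j k).1.orderEmbOfFin (tr i j k).2 := by
    apply Finset.orderEmbOfFin_unique
    · intro x
      rw [hv]
      fin_cases x <;> simp
    · rw [Fin.strictMono_iff_lt_succ]
      intro x
      fin_cases x
      · exact h₁
      · exact h₂
  rw [pluckerCoord, colDet, ← this]

theorem colDet_eq_sgn3_mul {R : Type*} [CommRing R] (A : Matrix (Fin 3) (Fin 6) R)
    {i j k : Fin 6} (hij : i ≠ j) (hik : i ≠ k) (hjk : j ≠ k) :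
    colDet A i j k = ((sgn3 i j k : ℤ) : R) * pluckerCoord A (tr i j k) := by
  refine forall_distinct3_of_sorted
    (P := fun i j k => colDet A i j k = ((sgn3 i j k : ℤ) : R) * pluckerCoord A (tr i j k))
    ?_ ?_ ?_ hij hik hjk
  · intro i j k h H
    rw [colDet_swap_left, H, tr_swap_left, sgn3_swap_left h]; simp
  · intro i j k h H
    rw [colDet_swap_right, H, tr_swap_right, sgn3_swap_right i h]; simp
  · intro i j k h₁ h₂
    rw [sgn3_of_lt h₁ h₂, pluckerCoord_tr_of_lt A h₁ h₂]; simp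

theorem sortSign_of_lt (σ : Equiv.Perm (Fin 6)) {i j k : Fin 6} (h₁ : i < j) (h₂ : j < k) :
    sortSign σ (tr i j k).1 = sgn3 (σ i) (σ j) (σ k) := by
  have hv := tr_val i j k h₁.ne (h₁.trans h₂).ne h₂.ne
  have hf : ((tr i j k).1 ×ˢ (tr i j k).1).filter (fun p => p.1 < p.2)
      = {(i, j), (i, k), (j, k)} := by
    rw [hv]
    ext ⟨a, b⟩
    simp only [Finset.mem_filter, Finset.mem_product, Finset.mem_insert, Finset.mem_singleton,
      Prod.mk.injEq]
    constructor
    · rintro ⟨⟨ha, hb⟩, hab⟩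
      rcases ha with rfl | rfl | rfl <;> rcases hb with rfl | rfl | rfl <;>
        first
          | exact absurd hab (lt_irrefl _)
          | exact absurd hab (h₁.not_gt)
          | exact absurd hab (h₂.not_gt)
          | exact absurd hab ((h₁.trans h₂).not_gt)
          | simp
    · rintro (⟨rfl, rfl⟩ | ⟨rfl, rfl⟩ | ⟨rfl, rfl⟩) <;> simp [h₁, h₂, h₁.trans h₂]
  rw [sortSign, hf, Finset.prod_insert, Finset.prod_insert, Finset.prod_singleton, sgn3, mul_assoc]
  · simp [h₁.ne]
  · simp [h₂.ne, h₁.ne]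

theorem map_tr (σ : Equiv.Perm (Fin 6)) {i j k : Fin 6} (hij : i ≠ j) (hik : i ≠ k)
    (hjk : j ≠ k) : (tr i j k).1.map σ.toEmbedding = (tr (σ i) (σ j) (σ k)).1 := by
  rw [tr_val i j k hij hik hjk,
    tr_val _ _ _ (σ.injective.ne hij) (σ.injective.ne hik) (σ.injective.ne hjk)]
  ext; simp

theorem alt_relabel (σ : Equiv.Perm (Fin 6)) (χ : SignVector 3 6) {i j k : Fin 6}
    (hij : i ≠ j) (hik : i ≠ k) (hjk : j ≠ k) :
    alt (relabel σ χ) i j k = alt χ (σ i) (σ j) (σ k) := by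
  refine forall_distinct3_of_sorted
    (P := fun i j k => alt (relabel σ χ) i j k = alt χ (σ i) (σ j) (σ k)) ?_ ?_ ?_ hij hik hjk
  · intro i j k h H
    rw [alt_swap_left _ h, H, alt_swap_left _ (σ.injective.ne h)]
  · intro i j k h H
    rw [alt_swap_right _ _ h, H, alt_swap_right _ _ (σ.injective.ne h)]
  · intro i j k h₁ h₂
    rw [alt, alt, sgn3_of_lt h₁ h₂, one_mul, relabel, sortSign_of_lt σ h₁ h₂]
    congr 2
    exact Subtype.ext (map_tr σ h₁.ne (h₁.trans h₂).ne h₂.ne)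

theorem alt_reorient (t : Fin 6 → ℤˣ) (χ : SignVector 3 6) {i j k : Fin 6}
    (hij : i ≠ j) (hik : i ≠ k) (hjk : j ≠ k) :
    alt (reorient t χ) i j k = t i * t j * t k * alt χ i j k := by
  rw [alt, alt, reorient, tr_val i j k hij hik hjk, Finset.prod_insert, Finset.prod_insert,
    Finset.prod_singleton]
  · simp only [mul_assoc, mul_left_comm]
  · simp [hjk]
  · simp [hij, hik]

theorem alt_of_lt (χ : SignVector 3 6) {i j k : Fin 6} (h₁ : i < j) (h₂ : j < k) :
    alt χ i j k = χ (tr i j k) := by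
  rw [alt, sgn3_of_lt h₁ h₂, one_mul]

theorem alt_injective {χ χ' : SignVector 3 6}
    (h : ∀ i j k, i < j → j < k → alt χ i j k = alt χ' i j k) : χ = χ' := by
  ext1 I
  obtain ⟨i, j, k, h₁, h₂, rfl⟩ := exists_eq_tr I
  rw [← alt_of_lt χ h₁ h₂, h i j k h₁ h₂, alt_of_lt χ' h₁ h₂]

/-! ### Chirotopes: the sign condition on three-term relations -/

/-- The term of `p_{lab} p_{lcd}` differs in sign from the two other terms of its Plücker
relation. -/
def Odd (χ : SignVector 3 6) (l a b c d : Fin 6) : Prop :=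
  alt χ l a b * alt χ l c d = alt χ l a c * alt χ l b d ∧
  alt χ l a b * alt χ l c d = -(alt χ l a d * alt χ l b c)

/-- No three-term Plücker relation has three terms of the same sign. -/
def IsChirotope (χ : SignVector 3 6) : Prop :=
  ∀ l a b c d, Distinct5 l a b c d →
    ¬ (alt χ l a b * alt χ l c d = -(alt χ l a c * alt χ l b d) ∧
      alt χ l a b * alt χ l c d = alt χ l a d * alt χ l b c)

/-- Every minor becomes positive after multiplication by its sign. If the three terms of a Plücker
relation had the same sign, the relation times that sign would be a vanishing sum of positive
numbers. -/
theorem IsRealizable.isChirotope {χ : SignVector 3 6} (h : IsRealizable χ) : IsChirotope χ := by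
  obtain ⟨A, hA⟩ := h
  rintro l a b c d ⟨⟨la, lb, lc, ld⟩, nab, nac, nad, nbc, nbd, ncd⟩ ⟨e1, e2⟩
  have key : ∀ i j k : Fin 6, i ≠ j → i ≠ k → j ≠ k →
      0 < ((alt χ i j k : ℤ) : ℝ) * colDet A i j k := by
    intro i j k hij hik hjk
    rw [colDet_eq_sgn3_mul A hij hik hjk, alt]
    have h := hA (tr i j k)
    have hs : ((sgn3 i j k : ℤ) : ℝ) * ((sgn3 i j k : ℤ) : ℝ) = 1 := by
      rcases Int.units_eq_one_or (sgn3 i j k) with h | h <;> simp [h]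
    have hp : 0 < ((χ (tr i j k) : ℤ) : ℝ) * pluckerCoord A (tr i j k) := by
      rcases Int.units_eq_one_or (χ (tr i j k)) with h' | h'
      · rw [h'] at h ⊢
        have : SignType.sign (pluckerCoord A (tr i j k)) = 1 := by
          revert h; cases SignType.sign (pluckerCoord A (tr i j k)) <;> simp
        simpa using sign_eq_one_iff.1 this
      · rw [h'] at h ⊢
        have : SignType.sign (pluckerCoord A (tr i j k)) = -1 := by
          revert h; cases SignType.sign (pluckerCoord A (tr i j k)) <;> simp
        simpa using sign_eq_neg_one_iff.1 this
    calc (0 : ℝ) < ((χ (tr i j k) : ℤ) : ℝ) * pluckerCoord A (tr i j k) := hp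
      _ = _ := by
        push_cast
        linear_combination
          -(((χ (tr i j k) : ℤ) : ℝ) * pluckerCoord A (tr i j k)) * hs
  have k1 := mul_pos (key l a b la lb nab) (key l c d lc ld ncd)
  have k2 := mul_pos (key l a c la lc nac) (key l b d lb ld nbd)
  have k3 := mul_pos (key l a d la ld nad) (key l b c lb lc nbc)
  have hp := colDet_plucker A l a b c d
  have e1' : ((alt χ l a b : ℤ) : ℝ) * ((alt χ l c d : ℤ) : ℝ)
      = -(((alt χ l a c : ℤ) : ℝ) * ((alt χ l b d : ℤ) : ℝ)) := by
    exact_mod_cast congrArg (fun u : ℤˣ => (u : ℤ)) e1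
  have e2' : ((alt χ l a b : ℤ) : ℝ) * ((alt χ l c d : ℤ) : ℝ)
      = ((alt χ l a d : ℤ) : ℝ) * ((alt χ l b c : ℤ) : ℝ) := by
    exact_mod_cast congrArg (fun u : ℤˣ => (u : ℤ)) e2
  set u := ((alt χ l a b : ℤ) : ℝ) * ((alt χ l c d : ℤ) : ℝ) with hu
  have k1' : 0 < u * (colDet A l a b * colDet A l c d) := by
    rw [hu]; linarith
  have k2' : 0 < -u * (colDet A l a c * colDet A l b d) := by
    rw [e1']; linarith
  have k3' : 0 < u * (colDet A l a d * colDet A l b c) := by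
    rw [e2']; linarith
  have : u * (colDet A l a b * colDet A l c d - colDet A l a c * colDet A l b d
      + colDet A l a d * colDet A l b c) = 0 := by rw [hp, mul_zero]
  linarith

/-! ### The chirotropical Dressian in terms of all ordered quintuples -/

theorem tropMin_filter {ι : Type*} [DecidableEq ι] (x : ι → ℝ) (e₀ e₁ e₂ : ι →₀ ℕ)
    (P : (ι →₀ ℕ) → Prop) [DecidablePred P] :
    tropMin (Finset.filter P {e₀, e₁, e₂}) x =
      min (if P e₀ then ((weight x e₀ : ℝ) : WithTop ℝ) else ⊤)
        (min (if P e₁ then ((weight x e₁ : ℝ) : WithTop ℝ) else ⊤)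
          (if P e₂ then ((weight x e₂ : ℝ) : WithTop ℝ) else ⊤)) := by
  rw [Finset.filter_insert, Finset.filter_insert, Finset.filter_singleton]
  split_ifs <;> simp [tropMin]

theorem prod_expo (χ : SignVector 3 6) (l a b c d : Fin 6) :
    ((expo l a b c d).prod fun i e => (((χ i : ℤ) : ℝ)) ^ e)
      = (((χ (tr l a b) * χ (tr l c d) : ℤˣ) : ℤ) : ℝ) := by
  unfold expo
  rw [Finsupp.prod_add_index'] <;> simp [pow_add]

/-- For increasing a, b, c, d each product consists of the four comparisons of `l` with these
letters, whatever the splitting. So alternating and plain signs differ by a factor common to the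
three terms. -/
theorem sgn3_mul_sgn3 {l a b c d : Fin 6} (h₁ : a < b) (h₂ : b < c) (h₃ : c < d) :
    sgn3 l a c * sgn3 l b d = sgn3 l a b * sgn3 l c d ∧
    sgn3 l a d * sgn3 l b c = sgn3 l a b * sgn3 l c d := by
  simp only [sgn3, h₁, h₂, h₃, h₁.trans h₂, h₂.trans h₃, h₁.trans (h₂.trans h₃), if_true, mul_one]
  constructor <;> simp only [mul_left_comm, mul_comm]

/-- Reordering the letters for another splitting flips alternating values, and these flips reproduce
the signs +, -, + with which the sorted terms enter the relation. -/
theorem odd_iff_of_sorted {χ : SignVector 3 6} {l a b c d : Fin 6} (hd : Distinct5 l a b c d)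
    (h₁ : a < b) (h₂ : b < c) (h₃ : c < d) :
    (Odd χ l a b c d ↔ χ (tr l a b) * χ (tr l c d) = χ (tr l a c) * χ (tr l b d) ∧
        χ (tr l a b) * χ (tr l c d) = -(χ (tr l a d) * χ (tr l b c))) ∧
    (Odd χ l a c b d ↔ χ (tr l a c) * χ (tr l b d) = χ (tr l a b) * χ (tr l c d) ∧
        χ (tr l a c) * χ (tr l b d) = χ (tr l a d) * χ (tr l b c)) ∧
    (Odd χ l a d b c ↔ χ (tr l a d) * χ (tr l b c) = -(χ (tr l a b) * χ (tr l c d)) ∧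
        χ (tr l a d) * χ (tr l b c) = χ (tr l a c) * χ (tr l b d)) := by
  obtain ⟨s1, s2⟩ := sgn3_mul_sgn3 (l := l) h₁ h₂ h₃
  have a0 : alt χ l a b * alt χ l c d
      = sgn3 l a b * sgn3 l c d * (χ (tr l a b) * χ (tr l c d)) := by
    simp only [alt]; exact mul_mul_mul_comm _ _ _ _
  have a1 : alt χ l a c * alt χ l b d
      = sgn3 l a b * sgn3 l c d * (χ (tr l a c) * χ (tr l b d)) := by
    rw [← s1]; simp only [alt]; exact mul_mul_mul_comm _ _ _ _
  have a2 : alt χ l a d * alt χ l b c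
      = sgn3 l a b * sgn3 l c d * (χ (tr l a d) * χ (tr l b c)) := by
    rw [← s2]; simp only [alt]; exact mul_mul_mul_comm _ _ _ _
  obtain ⟨⟨la, lb, lc, ld⟩, nab, nac, nad, nbc, nbd, ncd⟩ := hd
  refine ⟨?_, ?_, ?_⟩
  · rw [Odd, a0, a1, a2, ← mul_neg, mul_right_inj, mul_right_inj]
  · rw [Odd, alt_swap_right χ l nbc, mul_neg, neg_neg, a0, a1, a2, mul_right_inj, mul_right_inj]
  · rw [Odd, alt_swap_right χ l nbd, alt_swap_right χ l ncd, mul_neg, mul_neg, neg_neg, a0, a1,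
      a2, ← mul_neg, mul_right_inj, mul_right_inj]

theorem IsChirotope.not_of_sorted {χ : SignVector 3 6} (hχ : IsChirotope χ) {l a b c d : Fin 6}
    (hd : Distinct5 l a b c d) (h₁ : a < b) (h₂ : b < c) (h₃ : c < d) :
    ¬(χ (tr l a b) * χ (tr l c d) = -(χ (tr l a c) * χ (tr l b d)) ∧
      χ (tr l a b) * χ (tr l c d) = χ (tr l a d) * χ (tr l b c)) := by
  obtain ⟨s1, s2⟩ := sgn3_mul_sgn3 (l := l) h₁ h₂ h₃
  rintro ⟨e1, e2⟩
  apply hχ l a b c d hd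
  simp only [alt]
  rw [mul_mul_mul_comm, mul_mul_mul_comm (sgn3 l a c), mul_mul_mul_comm (sgn3 l a d), s1, s2,
    ← mul_neg, ← e1, ← e2]
  exact ⟨rfl, rfl⟩

/-- The minimum at `x` of the three monomials of a Plücker relation is attained as required if the
term of `p_{lab} p_{lcd}` is the one that differs in sign. -/
def TropEq (x : KSubset 3 6 → ℝ) (l a b c d : Fin 6) : Prop :=
  x (tr l a b) + x (tr l c d) =
    min (x (tr l a c) + x (tr l b d)) (x (tr l a d) + x (tr l b c))

/-- The signs of the terms are u₀, -u₁, u₂. As `hn` excludes that they all agree, one side of the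
equation has one finite entry and the other has two. Six sign patterns remain, two for each choice
of the odd term. -/
theorem min_signed_eq_iff {u₀ u₁ u₂ : ℤˣ} (hn : ¬(u₀ = -u₁ ∧ u₀ = u₂)) (w₀ w₁ w₂ : ℝ) :
    (min (if 0 < ((u₀ : ℤ) : ℝ) then (w₀ : WithTop ℝ) else ⊤)
        (min (if 0 < -((u₁ : ℤ) : ℝ) then (w₁ : WithTop ℝ) else ⊤)
          (if 0 < ((u₂ : ℤ) : ℝ) then (w₂ : WithTop ℝ) else ⊤)) =
      min (if ((u₀ : ℤ) : ℝ) < 0 then (w₀ : WithTop ℝ) else ⊤)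
        (min (if -((u₁ : ℤ) : ℝ) < 0 then (w₁ : WithTop ℝ) else ⊤)
          (if ((u₂ : ℤ) : ℝ) < 0 then (w₂ : WithTop ℝ) else ⊤))) ↔
    (u₀ = u₁ ∧ u₀ = -u₂ → w₀ = min w₁ w₂) ∧ (u₁ = u₀ ∧ u₁ = u₂ → w₁ = min w₀ w₂) ∧
      (u₂ = -u₀ ∧ u₂ = u₁ → w₂ = min w₀ w₁) := by
  have h10 : ¬(1 : ℝ) < 0 := by norm_num
  have e : (-1 : ℤˣ) ≠ 1 := by decide
  have e' : (1 : ℤˣ) ≠ -1 := by decide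
  have c : ∀ a b c : ℝ, min (a : WithTop ℝ) (b : WithTop ℝ) = (c : WithTop ℝ) ↔ c = min a b := by
    intro a b c
    rw [← WithTop.coe_min, WithTop.coe_inj, eq_comm]
  have c' : ∀ a b c : ℝ, (c : WithTop ℝ) = min (a : WithTop ℝ) (b : WithTop ℝ) ↔ c = min a b := by
    intro a b c
    rw [← WithTop.coe_min, WithTop.coe_inj]
  rcases Int.units_eq_one_or u₀ with rfl | rfl <;> rcases Int.units_eq_one_or u₁ with rfl | rfl <;>
    rcases Int.units_eq_one_or u₂ with rfl | rfl <;>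
    simp [e, e', c, c', h10] at hn ⊢

theorem mem_chiHypersurface_threeTerm {χ : SignVector 3 6} (hχ : IsChirotope χ)
    {l a b c d : Fin 6} (hd : Distinct5 l a b c d) (h₁ : a < b) (h₂ : b < c) (h₃ : c < d)
    (x : KSubset 3 6 → ℝ) :
    x ∈ chiHypersurface χ ((threeTerm l a b c d).map (Int.castRingHom ℝ)) ↔
      (Odd χ l a b c d → TropEq x l a b c d) ∧ (Odd χ l a c b d → TropEq x l a c b d) ∧
        (Odd χ l a d b c → TropEq x l a d b c) := by
  classical
  obtain ⟨c0, c1, c2⟩ := coeff_threeTerm hd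
  have hsupp : ((threeTerm l a b c d).map (Int.castRingHom ℝ)).support =
      {expo l a b c d, expo l a c b d, expo l a d b c} := by
    rw [MvPolynomial.support_map_of_injective _ Int.cast_injective, support_threeTerm hd]
  have t0 : termValue χ ((threeTerm l a b c d).map (Int.castRingHom ℝ)) (expo l a b c d)
      = (((χ (tr l a b) * χ (tr l c d) : ℤˣ) : ℤ) : ℝ) := by
    rw [termValue, MvPolynomial.coeff_map, c0, prod_expo]; simp
  have t1 : termValue χ ((threeTerm l a b c d).map (Int.castRingHom ℝ)) (expo l a c b d)
      = -(((χ (tr l a c) * χ (tr l b d) : ℤˣ) : ℤ) : ℝ) := by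
    rw [termValue, MvPolynomial.coeff_map, c1, prod_expo]; simp
  have t2 : termValue χ ((threeTerm l a b c d).map (Int.castRingHom ℝ)) (expo l a d b c)
      = (((χ (tr l a d) * χ (tr l b c) : ℤˣ) : ℤ) : ℝ) := by
    rw [termValue, MvPolynomial.coeff_map, c2, prod_expo]; simp
  change tropMin (posSupport _ _) x = tropMin (negSupport _ _) x ↔ _
  unfold posSupport negSupport
  rw [hsupp, tropMin_filter, tropMin_filter, t0, t1, t2, weight_expo, weight_expo, weight_expo,
    min_signed_eq_iff]
  · obtain ⟨o0, o1, o2⟩ := odd_iff_of_sorted (χ := χ) hd h₁ h₂ h₃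
    rw [o0, o1, o2, TropEq, TropEq, TropEq, tr_swap_right l b c, tr_swap_right l b d,
      tr_swap_right l c d]
  · exact hχ.not_of_sorted hd h₁ h₂ h₃

theorem tropEq_swap_left (a b c d : Fin 6) {x : KSubset 3 6 → ℝ} {l : Fin 6} :
    TropEq x l b a c d ↔ TropEq x l a b c d := by
  rw [TropEq, TropEq, tr_swap_right l a b, add_comm (x (tr l b c)), add_comm (x (tr l b d)),
    min_comm]

theorem tropEq_swap_right {x : KSubset 3 6 → ℝ} {l a b c d : Fin 6} :
    TropEq x l a b d c ↔ TropEq x l a b c d := by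
  rw [TropEq, TropEq, tr_swap_right l c d, min_comm]

theorem tropEq_swap_pairs (a b c d : Fin 6) {x : KSubset 3 6 → ℝ} {l : Fin 6} :
    TropEq x l c d a b ↔ TropEq x l a b c d := by
  rw [TropEq, TropEq, tr_swap_right l a c, tr_swap_right l b d, tr_swap_right l a d,
    tr_swap_right l b c, add_comm (x (tr l c d)), add_comm (x (tr l b c))]

theorem odd_swap_left {χ : SignVector 3 6} {l a b c d : Fin 6} (h : Distinct5 l a b c d) :
    Odd χ l b a c d ↔ Odd χ l a b c d := by
  rw [Odd, Odd, alt_swap_right χ l h.2.1, neg_mul, neg_inj, neg_eq_iff_eq_neg,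
    mul_comm (alt χ l b c), mul_comm (alt χ l b d)]
  exact and_comm

theorem odd_swap_right {χ : SignVector 3 6} {l a b c d : Fin 6} (h : Distinct5 l a b c d) :
    Odd χ l a b d c ↔ Odd χ l a b c d := by
  rw [Odd, Odd, alt_swap_right χ l h.2.2.2.2.2.2, mul_neg, neg_inj, neg_eq_iff_eq_neg]
  exact and_comm

theorem odd_swap_pairs {χ : SignVector 3 6} {l a b c d : Fin 6} (h : Distinct5 l a b c d) :
    Odd χ l c d a b ↔ Odd χ l a b c d := by
  rw [Odd, Odd, alt_swap_right χ l h.2.2.1, alt_swap_right χ l h.2.2.2.1,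
    alt_swap_right χ l h.2.2.2.2.1, alt_swap_right χ l h.2.2.2.2.2.1, neg_mul_neg, neg_mul_neg,
    mul_comm (alt χ l c d), mul_comm (alt χ l b c)]

/-- Quantifying over all orderings, not only the increasing ones, gives a form on which relabelings
act by substitution. -/
theorem mem_chiDressian_iff {χ : SignVector 3 6} (hχ : IsChirotope χ) {x : KSubset 3 6 → ℝ} :
    x ∈ chiDressian χ ↔
      ∀ l a b c d, Distinct5 l a b c d → Odd χ l a b c d → TropEq x l a b c d := by
  rw [chiDressian, Set.mem_iInter₂]
  constructor
  · intro h l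
    suffices H : ∀ a b c d, Distinct5 l a b c d →
        ((Odd χ l a b c d → TropEq x l a b c d) ∧ (Odd χ l a c b d → TropEq x l a c b d) ∧
        (Odd χ l a d b c → TropEq x l a d b c)) from
      fun a b c d hd => (H a b c d hd).1
    apply forall_distinct_of_sorted
    · rintro a b c d hd ⟨h0, h1, h2⟩
      refine ⟨?_, ?_, ?_⟩
      · rwa [tropEq_swap_left a b c d, odd_swap_left hd]
      · rwa [tropEq_swap_pairs a d b c, odd_swap_pairs hd.swap₃.swap₂]
      · rwa [tropEq_swap_pairs a c b d, odd_swap_pairs hd.swap₂]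
    · rintro a b c d hd ⟨h0, h1, h2⟩
      refine ⟨h1, h0, ?_⟩
      rwa [tropEq_swap_right, odd_swap_right hd.swap₃.swap₂]
    · rintro a b c d hd ⟨h0, h1, h2⟩
      refine ⟨?_, h2, h1⟩
      rwa [tropEq_swap_right, odd_swap_right hd]
    · intro a b c d hd hab hbc hcd
      exact (mem_chiHypersurface_threeTerm hχ hd hab hbc hcd x).1
        (h _ (mem_threeTermRelations_iff.2 ⟨l, a, b, c, d, hd, hab, hbc, hcd, rfl⟩))
  · intro h g hg
    obtain ⟨l, a, b, c, d, hd, hab, hbc, hcd, rfl⟩ := mem_threeTermRelations_iff.1 hg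
    exact (mem_chiHypersurface_threeTerm hχ hd hab hbc hcd x).2
      ⟨h _ _ _ _ _ hd, h _ _ _ _ _ hd.swap₂, h _ _ _ _ _ hd.swap₃.swap₂⟩

end Chirotropical

namespace Chirotropical

/-! ### The fan axioms -/

/-- Quintuples of elements of the ground set. -/
abbrev Quint : Type := Fin 6 × Fin 6 × Fin 6 × Fin 6 × Fin 6

/-- The minimal monomials of all three-term Plücker relations at `w`. -/
def pattern (w : KSubset 3 6 → ℝ) : Set Quint :=
  {q | Distinct5 q.1 q.2.1 q.2.2.1 q.2.2.2.1 q.2.2.2.2 ∧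
    Dominates w q.1 q.2.1 q.2.2.1 q.2.2.2.1 q.2.2.2.2}

theorem mem_pattern {w : KSubset 3 6 → ℝ} {l a b c d : Fin 6} :
    (l, a, b, c, d) ∈ pattern w ↔ Distinct5 l a b c d ∧ Dominates w l a b c d := Iff.rfl

theorem mem_dressianCone_iff_pattern {w x : KSubset 3 6 → ℝ} :
    x ∈ dressianCone w ↔ pattern w ⊆ pattern x := by
  rw [mem_dressianCone_iff]
  constructor
  · rintro h ⟨l, a, b, c, d⟩ ⟨hd, hq⟩
    exact ⟨hd, h l a b c d hd hq⟩
  · intro h l a b c d hd hq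
    exact (h (show (l, a, b, c, d) ∈ pattern w from ⟨hd, hq⟩)).2

theorem self_mem_dressianCone (w : KSubset 3 6 → ℝ) : w ∈ dressianCone w :=
  mem_dressianCone_iff_pattern.2 subset_rfl

theorem dressianCone_le_iff {w w' : KSubset 3 6 → ℝ} :
    dressianCone w ≤ dressianCone w' ↔ w ∈ dressianCone w' :=
  ⟨fun h => h (self_mem_dressianCone w), fun h _ hx => mem_dressianCone_iff_pattern.2
    ((mem_dressianCone_iff_pattern.1 h).trans (mem_dressianCone_iff_pattern.1 hx))⟩

theorem dressianCone_congr {w w' : KSubset 3 6 → ℝ} (h : pattern w = pattern w') :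
    dressianCone w = dressianCone w' := by
  ext x; rw [mem_dressianCone_iff_pattern, mem_dressianCone_iff_pattern, h]

theorem dominates_cases (x : KSubset 3 6 → ℝ) (l a b c d : Fin 6) :
    Dominates x l a b c d ∨ Dominates x l a c b d ∨ Dominates x l a d b c := by
  simp only [Dominates, tr_swap_right l b c, tr_swap_right l b d, tr_swap_right l c d]
  rcases le_total (x (tr l a b) + x (tr l c d)) (x (tr l a c) + x (tr l b d)) with h | h <;>
  rcases le_total (x (tr l a b) + x (tr l c d)) (x (tr l a d) + x (tr l b c)) with h' | h' <;>
  rcases le_total (x (tr l a c) + x (tr l b d)) (x (tr l a d) + x (tr l b c)) with h'' | h''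
  all_goals first
    | exact Or.inl ⟨h, h'⟩
    | exact Or.inr (Or.inl ⟨by linarith, by linarith⟩)
    | exact Or.inr (Or.inr ⟨by linarith, by linarith⟩)

theorem tropEq_iff {x : KSubset 3 6 → ℝ} {l a b c d : Fin 6} :
    TropEq x l a b c d ↔ Dominates x l a b c d ∧
      (Dominates x l a c b d ∨ Dominates x l a d b c) := by
  simp only [TropEq, Dominates, tr_swap_right l b c, tr_swap_right l b d, tr_swap_right l c d]
  constructor
  · intro h
    rcases le_total (x (tr l a c) + x (tr l b d)) (x (tr l a d) + x (tr l b c)) with h' | h'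
    · rw [min_eq_left h'] at h
      exact ⟨⟨by linarith, by linarith⟩, Or.inl ⟨by linarith, by linarith⟩⟩
    · rw [min_eq_right h'] at h
      exact ⟨⟨by linarith, by linarith⟩, Or.inr ⟨by linarith, by linarith⟩⟩
  · rintro ⟨⟨h1, h2⟩, ⟨h3, h4⟩ | ⟨h3, h4⟩⟩
    · rw [min_eq_left h4]; linarith
    · rw [min_eq_right h4]; linarith

theorem mem_chiDressian_of_mem_dressianCone {χ : SignVector 3 6} (hχ : IsChirotope χ)
    {w x : KSubset 3 6 → ℝ} (hw : w ∈ chiDressian χ) (hx : x ∈ dressianCone w) :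
    x ∈ chiDressian χ := by
  rw [mem_chiDressian_iff hχ] at hw ⊢
  rw [mem_dressianCone_iff] at hx
  intro l a b c d hd ho
  have h := tropEq_iff.1 (hw l a b c d hd ho)
  exact tropEq_iff.2 ⟨hx _ _ _ _ _ hd h.1, h.2.imp (hx _ _ _ _ _ hd.swap₂)
    (hx _ _ _ _ _ hd.swap₃.swap₂)⟩

/-- In each relation some monomial is minimal at `w`, hence at both `x` and `y`. A monomial minimal
at `x + y` ties with it there, and two nonnegative excesses with sum zero vanish. -/
theorem pattern_add {w x y : KSubset 3 6 → ℝ} (hx : x ∈ dressianCone w)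
    (hy : y ∈ dressianCone w) : pattern (x + y) ⊆ pattern x := by
  rintro ⟨l, a, b, c, d⟩ ⟨hd, hq⟩
  refine ⟨hd, ?_⟩
  rw [mem_dressianCone_iff] at hx hy
  have h1 := hx l a b c d hd
  have h2 := hx l a c b d hd.swap₂
  have h3 := hx l a d b c hd.swap₃.swap₂
  have g1 := hy l a b c d hd
  have g2 := hy l a c b d hd.swap₂
  have g3 := hy l a d b c hd.swap₃.swap₂
  simp only [Dominates, tr_swap_right l b c, tr_swap_right l b d, tr_swap_right l c d,
    Pi.add_apply] at *
  have hc := dominates_cases w l a b c d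
  simp only [Dominates, tr_swap_right l b c, tr_swap_right l b d, tr_swap_right l c d] at hc
  rcases hc with hc | hc | hc
  · exact h1 hc
  · have := h2 hc; have := g2 hc
    constructor <;> linarith
  · have := h3 hc; have := g3 hc
    constructor <;> linarith

theorem pattern_smul {x : KSubset 3 6 → ℝ} {a : ℝ} (ha : 0 < a) : pattern (a • x) = pattern x := by
  ext ⟨l, i, j, m, n⟩
  simp only [mem_pattern, Dominates, Pi.smul_apply, smul_eq_mul, ← mul_add,
    mul_le_mul_iff_right₀ ha]

theorem zero_mem_chiDressian {χ : SignVector 3 6} (hχ : IsChirotope χ) :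
    (0 : KSubset 3 6 → ℝ) ∈ chiDressian χ := by
  rw [mem_chiDressian_iff hχ]
  intro l a b c d _ _
  simp [TropEq]

/-- A cone depends only on the pattern of its point, and patterns are subsets of the finite type
`Quint`. -/
theorem chiFan_finite (χ : SignVector 3 6) : (chiFan χ).Finite := by
  classical
  refine (Set.finite_range fun T : Set Quint =>
    if h : ∃ w, pattern w = T then dressianCone h.choose else ⊥).subset ?_
  rintro _ ⟨w, -, rfl⟩
  refine ⟨pattern w, ?_⟩
  have h : ∃ w', pattern w' = pattern w := ⟨w, rfl⟩
  simp only [h, dif_pos]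
  exact dressianCone_congr h.choose_spec

/-- The coordinate functional of `I`. -/
def coord (I : KSubset 3 6) : Module.Dual ℝ (KSubset 3 6 → ℝ) := LinearMap.proj I

/-- The difference of the weights of `p_{lac} p_{lbd}` and `p_{lab} p_{lcd}`. -/
noncomputable def gap (l a b c d : Fin 6) : Module.Dual ℝ (KSubset 3 6 → ℝ) :=
  coord (tr l a c) + coord (tr l b d) - (coord (tr l a b) + coord (tr l c d))

theorem gap_apply (l a b c d : Fin 6) (x : KSubset 3 6 → ℝ) : gap l a b c d x =
    x (tr l a c) + x (tr l b d) - (x (tr l a b) + x (tr l c d)) := rfl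

theorem dominates_iff_gap {x : KSubset 3 6 → ℝ} {l a b c d : Fin 6} :
    Dominates x l a b c d ↔ 0 ≤ gap l a b c d x ∧ 0 ≤ gap l a b d c x := by
  rw [Dominates, gap_apply, gap_apply, sub_nonneg, sub_nonneg, tr_swap_right l c d]

theorem polyhedral_dressianCone (w : KSubset 3 6 → ℝ) :
    ∃ s : Finset (Module.Dual ℝ (KSubset 3 6 → ℝ)), ∀ x, x ∈ dressianCone w ↔
      ∀ f ∈ s, 0 ≤ f x := by
  classical
  refine ⟨(Finset.univ.filter (· ∈ pattern w)).image
      (fun q : Quint => gap q.1 q.2.1 q.2.2.1 q.2.2.2.1 q.2.2.2.2) ∪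
    (Finset.univ.filter (· ∈ pattern w)).image
      (fun q : Quint => gap q.1 q.2.1 q.2.2.1 q.2.2.2.2 q.2.2.2.1), fun x => ?_⟩
  rw [mem_dressianCone_iff_pattern]
  constructor
  · intro h f hf
    simp only [Finset.mem_union, Finset.mem_image, Finset.mem_filter, Finset.mem_univ,
      true_and] at hf
    rcases hf with ⟨q, hq, rfl⟩ | ⟨q, hq, rfl⟩
    · exact (dominates_iff_gap.1 (h hq).2).1
    · exact (dominates_iff_gap.1 (h hq).2).2
  · intro h q hq
    refine ⟨hq.1, dominates_iff_gap.2 ⟨h _ ?_, h _ ?_⟩⟩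
    · exact Finset.mem_union_left _ (Finset.mem_image.2 ⟨q, by simpa using hq, rfl⟩)
    · exact Finset.mem_union_right _ (Finset.mem_image.2 ⟨q, by simpa using hq, rfl⟩)

theorem gap_eq_zero_of_mem {w y : KSubset 3 6 → ℝ} (hy : y ∈ dressianCone w)
    {l a b c d : Fin 6} (hd : Distinct5 l a b c d) (h : Dominates w l a b c d)
    (h0 : gap l a b c d w = 0) : gap l a b c d y = 0 := by
  rw [mem_dressianCone_iff] at hy
  have h1 := hy _ _ _ _ _ hd h
  have h2 : Dominates w l a c b d := by
    simp only [Dominates, gap_apply, tr_swap_right l b c] at *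
    constructor <;> linarith
  have h3 := hy _ _ _ _ _ hd.swap₂ h2
  rw [gap_apply]
  exact le_antisymm (by linarith [h3.1]) (by linarith [h1.1])

/-- The point `w'` is in the relative interior of its own cone, so one can step back from it along
`y`. A gap at a minimal monomial of `w'` is zero or positive: a zero gap is also zero at `y`, and a
positive one survives for small ε. -/
theorem exists_sub_smul_mem {w w' y : KSubset 3 6 → ℝ} (hw' : w' ∈ dressianCone w)
    (hy : y ∈ dressianCone w') : ∃ ε : ℝ, 0 < ε ∧ w' - ε • y ∈ dressianCone w := by
  have hpat := mem_dressianCone_iff_pattern.1 hw'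
  have key : ∀ l a b c d, Distinct5 l a b c d → Dominates w' l a b c d →
      ∀ᶠ ε : ℝ in nhdsWithin 0 (Set.Ioi 0), 0 ≤ gap l a b c d (w' - ε • y) := by
    intro l a b c d hd h
    rcases (dominates_iff_gap.1 h).1.eq_or_lt with h0 | h0
    · refine Filter.Eventually.of_forall fun ε => ?_
      rw [map_sub, map_smul, ← h0, gap_eq_zero_of_mem hy hd h h0.symm]
      simp
    · have hc : Filter.Tendsto (fun ε : ℝ => gap l a b c d (w' - ε • y)) (nhdsWithin 0 (Set.Ioi 0))
          (nhds (gap l a b c d (w' - (0 : ℝ) • y))) := by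
        refine Filter.Tendsto.mono_left (Continuous.tendsto ?_ 0) nhdsWithin_le_nhds
        simp only [map_sub, map_smul]
        fun_prop
      have h0' : 0 < gap l a b c d (w' - (0 : ℝ) • y) := by simpa using h0
      filter_upwards [hc.eventually (lt_mem_nhds h0')] with ε h
      exact h.le
  have hall : ∀ᶠ ε : ℝ in nhdsWithin 0 (Set.Ioi 0), ∀ q : Quint, q ∈ pattern w →
      Dominates (w' - ε • y) q.1 q.2.1 q.2.2.1 q.2.2.2.1 q.2.2.2.2 := by
    rw [Filter.eventually_all]
    rintro ⟨l, a, b, c, d⟩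
    by_cases hq : (l, a, b, c, d) ∈ pattern w
    · obtain ⟨hd, h⟩ := hpat hq
      filter_upwards [key l a b c d hd h, key l a b d c hd.swap₃ (dominates_swap_right.2 h)]
        with ε h1 h2 _
      exact dominates_iff_gap.2 ⟨h1, h2⟩
    · exact Filter.Eventually.of_forall fun ε h => absurd h hq
  obtain ⟨ε, hε, hε'⟩ := (hall.and self_mem_nhdsWithin).exists
  exact ⟨ε, hε', mem_dressianCone_iff_pattern.2 fun q hq => ⟨hq.1, hε q hq⟩⟩

/-- A relative interior point of the face is a `w'` in `D` with minimal pattern: adding any `x` in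
`D` can only shrink the pattern, so minimality puts the pattern of `w'` inside that of `x`.
Conversely, `w'` is the sum of a positive multiple of `y` and a point of the large cone, so the face
property puts `y` into `D`. -/
theorem face_eq_dressianCone {w : KSubset 3 6 → ℝ} {D : PointedCone ℝ (KSubset 3 6 → ℝ)}
    (hD : D.IsFaceOf (dressianCone w)) : ∃ w' ∈ D, D = dressianCone w' := by
  obtain ⟨T, hT⟩ := (Set.toFinite (pattern '' (D : Set (KSubset 3 6 → ℝ)))).exists_minimal
    ⟨_, Set.mem_image_of_mem _ D.zero_mem⟩
  obtain ⟨⟨w', hw', rfl⟩, hmin⟩ := hT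
  refine ⟨w', hw', le_antisymm (fun x hx => ?_) fun y hy => ?_⟩
  · rw [mem_dressianCone_iff_pattern]
    have hle : pattern (w' + x) ⊆ pattern w' := pattern_add (hD.le hw') (hD.le hx)
    have hle' : pattern (w' + x) ⊆ pattern x := by
      rw [add_comm]; exact pattern_add (hD.le hx) (hD.le hw')
    exact (hmin (Set.mem_image_of_mem _ (D.add_mem hw' hx)) hle).trans hle'
  · obtain ⟨ε, hε, h⟩ := exists_sub_smul_mem (hD.le hw') hy
    refine hD.mem_of_smul_add_mem (dressianCone_le_iff.2 (hD.le hw') hy) h hε ?_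
    rwa [add_sub_cancel]

/-- By `pattern_add`, the minima that `w'` demands of a sum are already attained at each summand
from the cone of `w`. -/
theorem inter_isFaceOf_dressianCone (w w' : KSubset 3 6 → ℝ) :
    (dressianCone w ⊓ dressianCone w').IsFaceOf (dressianCone w) := by
  refine ⟨inf_le_left, fun {x y a} hx hy ha h => ⟨hx, ?_⟩⟩
  have hax : a • x ∈ dressianCone w := PointedCone.smul_mem _ ha.le hx
  have h1 := pattern_add hax hy
  rw [pattern_smul ha] at h1
  exact mem_dressianCone_iff_pattern.2 ((mem_dressianCone_iff_pattern.1 h.2).trans h1)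

theorem isPolyhedralFan_chiFan {χ : SignVector 3 6} (hχ : IsChirotope χ) :
    IsPolyhedralFan (chiFan χ) where
  nonempty := ⟨_, 0, zero_mem_chiDressian hχ, rfl⟩
  finite := chiFan_finite χ
  polyhedral := by
    rintro _ ⟨w, -, rfl⟩
    exact polyhedral_dressianCone w
  face_mem := by
    rintro _ ⟨w, hw, rfl⟩ D hD
    obtain ⟨w', hw', rfl⟩ := face_eq_dressianCone hD
    exact ⟨w', mem_chiDressian_of_mem_dressianCone hχ hw (hD.le hw'), rfl⟩
  inter_isFaceOf := by
    rintro _ ⟨w, -, rfl⟩ _ ⟨w', -, rfl⟩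
    exact inter_isFaceOf_dressianCone w w'

theorem iUnion_chiFan {χ : SignVector 3 6} (hχ : IsChirotope χ) :
    (⋃ C ∈ chiFan χ, (C : Set (KSubset 3 6 → ℝ))) = chiDressian χ := by
  ext x
  simp only [Set.mem_iUnion, SetLike.mem_coe]
  constructor
  · rintro ⟨_, ⟨w, hw, rfl⟩, hx⟩
    exact mem_chiDressian_of_mem_dressianCone hχ hw hx
  · exact fun hx => ⟨_, ⟨x, hx, rfl⟩, self_mem_dressianCone x⟩

/-! ### The lineality space -/

theorem mem_lineality_iff {x : KSubset 3 6 → ℝ} :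
    x ∈ lineality 3 6 ↔ ∃ z : Fin 6 → ℝ, ∀ I : KSubset 3 6, x I = ∑ i ∈ I.1, z i := by
  simp only [lineality, LinearMap.mem_range, funext_iff, LinearMap.pi_apply,
    LinearMap.coe_sum, Finset.sum_apply, LinearMap.coe_proj, Function.eval]
  exact ⟨fun ⟨z, h⟩ => ⟨z, fun I => (h I).symm⟩, fun ⟨z, h⟩ => ⟨z, fun I => (h I).symm⟩⟩

theorem sum_tr (z : Fin 6 → ℝ) {i j k : Fin 6} (hij : i ≠ j) (hik : i ≠ k) (hjk : j ≠ k) :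
    ∑ m ∈ (tr i j k).1, z m = z i + z j + z k := by
  rw [tr_val i j k hij hik hjk, Finset.sum_insert (by simp [hij, hik]), Finset.sum_pair hjk,
    add_assoc]

theorem gap_eq_zero_of_mem_lineality {x : KSubset 3 6 → ℝ} (hx : x ∈ lineality 3 6)
    {l a b c d : Fin 6} (h : Distinct5 l a b c d) : gap l a b c d x = 0 := by
  obtain ⟨z, hz⟩ := mem_lineality_iff.1 hx
  obtain ⟨⟨la, lb, lc, ld⟩, nab, nac, nad, nbc, nbd, ncd⟩ := h
  rw [gap_apply, hz, hz, hz, hz, sum_tr z la lc nac, sum_tr z lb ld nbd, sum_tr z la lb nab,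
    sum_tr z lc ld ncd]
  ring

theorem mem_lineality_of_gap {x : KSubset 3 6 → ℝ}
    (h : ∀ l a b c d, Distinct5 l a b c d → gap l a b c d x = 0) : x ∈ lineality 3 6 := by
  have h1 := h 0 1 2 3 4 (by decide)
  have h2 := h 0 1 2 4 3 (by decide)
  have h3 := h 0 1 2 3 5 (by decide)
  have h4 := h 0 1 2 5 3 (by decide)
  have h5 := h 0 1 2 4 5 (by decide)
  have h6 := h 1 0 2 3 4 (by decide)
  have h7 := h 1 0 2 4 3 (by decide)
  have h8 := h 1 0 2 3 5 (by decide)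
  have h9 := h 1 0 2 5 3 (by decide)
  have h10 := h 1 0 2 4 5 (by decide)
  have h11 := h 2 0 1 3 4 (by decide)
  have h12 := h 2 0 1 3 5 (by decide)
  have h13 := h 2 0 1 4 5 (by decide)
  have h14 := h 3 0 1 4 5 (by decide)
  simp [gap_apply, tr, code3] at h1 h2 h3 h4 h5 h6 h7 h8 h9 h10 h11 h12 h13 h14
  -- The witness solves x_I = ∑ z_i. The codes 25, 26, 28 stand for 034, 134, 234, so the
  -- differences are z₀ - z₁ and z₀ - z₂, and code 7, for 012, then gives 3 z₀. The codes 11, 19, 35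
  -- of 013, 014, 015 give the remaining entries.
  set z₀ : ℝ := (x (decode 7) + (x (decode 25) - x (decode 26)) +
    (x (decode 25) - x (decode 28))) / 3
    with hz₀
  set z₁ : ℝ := z₀ - (x (decode 25) - x (decode 26)) with hz₁
  refine mem_lineality_iff.2 ⟨![z₀, z₁, z₀ - (x (decode 25) - x (decode 28)),
    x (decode 11) - z₀ - z₁, x (decode 19) - z₀ - z₁, x (decode 35) - z₀ - z₁], fun I => ?_⟩
  obtain ⟨i, j, k, hij, hjk, rfl⟩ := exists_eq_tr I
  rw [sum_tr _ hij.ne (hij.trans hjk).ne hjk.ne]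
  fin_cases i <;> fin_cases j <;> fin_cases k <;>
    first
      | exact absurd hij (by decide)
      | exact absurd hjk (by decide)
      | (simp [tr, code3] <;> linarith)

/-- In each relation some monomial is minimal at `w`. If `x` and `-x` lie in the cone, it is minimal
at both, so all three weights agree at `x` and every gap vanishes, whichever `w` is taken. -/
theorem lineal_dressianCone (w : KSubset 3 6 → ℝ) : (dressianCone w).lineal = lineality 3 6 := by
  ext x
  rw [PointedCone.mem_lineal]
  constructor
  · rintro ⟨h1, h2⟩
    rw [mem_dressianCone_iff] at h1 h2
    refine mem_lineality_of_gap fun l a b c d hd => ?_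
    have a1 := h1 l a b c d hd
    have a2 := h1 l a c b d hd.swap₂
    have a3 := h1 l a d b c hd.swap₃.swap₂
    have b1 := h2 l a b c d hd
    have b2 := h2 l a c b d hd.swap₂
    have b3 := h2 l a d b c hd.swap₃.swap₂
    have hc := dominates_cases w l a b c d
    simp only [Dominates, gap_apply, tr_swap_right l b c, tr_swap_right l b d, tr_swap_right l c d,
      Pi.neg_apply] at *
    rcases hc with hc | hc | hc
    · have := a1 hc; have := b1 hc; linarith
    · have := a2 hc; have := b2 hc; linarith
    · have := a3 hc; have := b3 hc; linarith
  · intro hx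
    have hx' : -x ∈ lineality 3 6 := neg_mem hx
    constructor <;> rw [mem_dressianCone_iff] <;> intro l a b c d hd _ <;> rw [dominates_iff_gap]
    · rw [gap_eq_zero_of_mem_lineality hx hd, gap_eq_zero_of_mem_lineality hx hd.swap₃]; simp
    · rw [gap_eq_zero_of_mem_lineality hx' hd, gap_eq_zero_of_mem_lineality hx' hd.swap₃]; simp

end Chirotropical

namespace Chirotropical

open Filter Topology

/-! ### Leading exponents of real functions near zero -/

/-- The function `f` behaves like `c t ^ e` for some `c > 0` as `t` decreases to zero. -/
def Lead (f : ℝ → ℝ) (e : ℝ) : Prop :=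
  ∃ c : ℝ, 0 < c ∧ Tendsto (fun t => f t / t ^ e) (𝓝[>] 0) (𝓝 c)

theorem Lead.congr {f g : ℝ → ℝ} {e : ℝ} (hf : Lead f e) (h : f =ᶠ[𝓝[>] 0] g) : Lead g e := by
  obtain ⟨c, hc, ht⟩ := hf
  refine ⟨c, hc, ht.congr' ?_⟩
  filter_upwards [h] with t h
  rw [h]

theorem lead_rpow (e : ℝ) : Lead (fun t => t ^ e) e := by
  refine ⟨1, one_pos, tendsto_const_nhds.congr' ?_⟩
  filter_upwards [self_mem_nhdsWithin] with t ht
  exact (div_self (Real.rpow_pos_of_pos ht e).ne').symm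

theorem Lead.eventually_pos {f : ℝ → ℝ} {e : ℝ} (hf : Lead f e) : ∀ᶠ t in 𝓝[>] 0, 0 < f t := by
  obtain ⟨c, hc, ht⟩ := hf
  filter_upwards [ht.eventually (lt_mem_nhds hc), self_mem_nhdsWithin] with t h h0
  exact (div_pos_iff_of_pos_right (Real.rpow_pos_of_pos h0 e)).1 h

theorem Lead.const_mul {f : ℝ → ℝ} {e a : ℝ} (hf : Lead f e) (ha : 0 < a) :
    Lead (fun t => a * f t) e := by
  obtain ⟨c, hc, ht⟩ := hf
  refine ⟨a * c, mul_pos ha hc, (ht.const_mul a).congr fun t => ?_⟩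
  rw [mul_div_assoc]

theorem Lead.mul {f g : ℝ → ℝ} {e e' : ℝ} (hf : Lead f e) (hg : Lead g e') :
    Lead (fun t => f t * g t) (e + e') := by
  obtain ⟨c, hc, ht⟩ := hf
  obtain ⟨c', hc', ht'⟩ := hg
  refine ⟨c * c', mul_pos hc hc', (ht.mul ht').congr' ?_⟩
  filter_upwards [self_mem_nhdsWithin] with t h0
  rw [Real.rpow_add h0, div_mul_div_comm]

theorem Lead.inv {f : ℝ → ℝ} {e : ℝ} (hf : Lead f e) : Lead (fun t => (f t)⁻¹) (-e) := by
  obtain ⟨c, hc, ht⟩ := hf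
  refine ⟨c⁻¹, inv_pos.2 hc, (ht.inv₀ hc.ne').congr' ?_⟩
  filter_upwards [self_mem_nhdsWithin] with t h0
  rw [Real.rpow_neg (le_of_lt h0), inv_div, div_inv_eq_mul, div_eq_mul_inv, mul_comm]

theorem Lead.pow {f : ℝ → ℝ} {e : ℝ} (hf : Lead f e) (n : ℕ) :
    Lead (fun t => f t ^ n) (n * e) := by
  induction n with
  | zero => simpa using lead_rpow 0
  | succ n ih =>
    have := ih.mul hf
    simp only [pow_succ]
    convert this using 1
    push_cast; ring

theorem Lead.prod {ι : Type*} (s : Finset ι) {f : ι → ℝ → ℝ} {e : ι → ℝ}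
    (h : ∀ i ∈ s, Lead (f i) (e i)) : Lead (fun t => ∏ i ∈ s, f i t) (∑ i ∈ s, e i) := by
  classical
  induction s using Finset.induction_on with
  | empty => simpa using lead_rpow 0
  | insert a s ha ih =>
    simp only [Finset.prod_insert ha, Finset.sum_insert ha]
    exact (h a (Finset.mem_insert_self a s)).mul
      (ih fun i hi => h i (Finset.mem_insert_of_mem hi))

theorem Lead.isLittleO {g : ℝ → ℝ} {e e' : ℝ} (hg : Lead g e') (h : e < e') :
    Tendsto (fun t => g t / t ^ e) (𝓝[>] 0) (𝓝 0) := by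
  obtain ⟨c, hc, ht⟩ := hg
  have h1 : Tendsto (fun t : ℝ => t ^ (e' - e)) (𝓝[>] 0) (𝓝 0) := by
    have h2 : Tendsto (fun t : ℝ => t ^ (e' - e)) (𝓝[>] 0) (𝓝 ((0 : ℝ) ^ (e' - e))) :=
      (Real.continuousAt_rpow_const _ _ (Or.inr (sub_pos.2 h).le)).tendsto.mono_left
        nhdsWithin_le_nhds
    rwa [Real.zero_rpow (sub_pos.2 h).ne'] at h2
  have h2 := ht.mul h1
  rw [mul_zero] at h2
  refine h2.congr' ?_
  filter_upwards [self_mem_nhdsWithin] with t h0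
  have h3 := (Real.rpow_pos_of_pos h0 e).ne'
  have h4 := (Real.rpow_pos_of_pos h0 e').ne'
  rw [Real.rpow_sub h0]
  field_simp

theorem Lead.add_of_lt {f g : ℝ → ℝ} {e e' : ℝ} (hf : Lead f e) (hg : Lead g e') (h : e < e') :
    Lead (fun t => f t + g t) e := by
  have h0 := hg.isLittleO h
  obtain ⟨c, hc, ht⟩ := hf
  refine ⟨c, hc, ?_⟩
  have := ht.add h0
  rw [add_zero] at this
  exact this.congr fun t => (add_div _ _ _).symm

/-- The strict inequality is what makes subtraction safe; in the lifting it comes from a slack that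
is required to be positive. -/
theorem Lead.sub_of_lt {f g : ℝ → ℝ} {e e' : ℝ} (hf : Lead f e) (hg : Lead g e') (h : e < e') :
    Lead (fun t => f t - g t) e := by
  have h0 := hg.isLittleO h
  obtain ⟨c, hc, ht⟩ := hf
  refine ⟨c, hc, ?_⟩
  have := ht.sub h0
  rw [sub_zero] at this
  exact this.congr fun t => (sub_div _ _ _).symm

/-- Leading constants are positive, so they cannot cancel when the exponents agree. -/
theorem Lead.add {f g : ℝ → ℝ} {e e' : ℝ} (hf : Lead f e) (hg : Lead g e') :
    Lead (fun t => f t + g t) (min e e') := by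
  rcases lt_trichotomy e e' with h | rfl | h
  · rw [min_eq_left h.le]; exact hf.add_of_lt hg h
  · rw [min_self]
    obtain ⟨c, hc, ht⟩ := hf
    obtain ⟨c', hc', ht'⟩ := hg
    exact ⟨c + c', add_pos hc hc', (ht.add ht').congr fun t => (add_div _ _ _).symm⟩
  · rw [min_eq_right h.le]
    exact (hg.add_of_lt hf h).congr (Eventually.of_forall fun t => add_comm _ _)

theorem Lead.of_mul {f g h : ℝ → ℝ} {e e' : ℝ} (hg : Lead g e) (hh : Lead h (e' + e))
    (hfg : ∀ᶠ t in 𝓝[>] 0, f t * g t = h t) : Lead f e' := by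
  have := hh.mul hg.inv
  rw [add_neg_cancel_right] at this
  refine this.congr ?_
  filter_upwards [hfg, hg.eventually_pos] with t h1 h2
  rw [← h1, mul_inv_cancel_right₀ h2.ne']

theorem Lead.unique {f : ℝ → ℝ} {e e' : ℝ} (h : Lead f e) (h' : Lead f e') : e = e' := by
  by_contra hne
  wlog hlt : e < e' generalizing e e'
  · exact this h' h (Ne.symm hne) (lt_of_le_of_ne (not_lt.1 hlt) (Ne.symm hne))
  obtain ⟨c, hc, ht⟩ := h
  exact hc.ne' (tendsto_nhds_unique ht (h'.isLittleO hlt))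

/-! ### Lifts of points to the Plücker variety -/

/-- A combination with positive coefficients has no cancellation, so its leading exponent is the
value of the tropical polynomial. -/
theorem lead_sum {ι : Type*} {s : Finset (ι →₀ ℕ)} (hs : s.Nonempty) {x : ι → ℝ}
    {a : (ι →₀ ℕ) → ℝ} (ha : ∀ m ∈ s, 0 < a m) {M : (ι →₀ ℕ) → ℝ → ℝ}
    (hM : ∀ m ∈ s, Lead (M m) (weight x m)) :
    ∃ e : ℝ, tropMin s x = (e : WithTop ℝ) ∧ Lead (fun t => ∑ m ∈ s, a m * M m t) e := by
  classical
  induction hs using Finset.Nonempty.cons_induction with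
  | singleton m =>
    refine ⟨weight x m, by simp [tropMin], ?_⟩
    simpa using (hM m (by simp)).const_mul (ha m (by simp))
  | cons m s hm hs ih =>
    obtain ⟨e, h1, h2⟩ := ih (fun n hn => ha n (Finset.mem_cons_of_mem hn))
      (fun n hn => hM n (Finset.mem_cons_of_mem hn))
    refine ⟨min (weight x m) e, ?_, ?_⟩
    · rw [tropMin, Finset.inf_cons, ← tropMin, h1, WithTop.coe_min]
    · simp only [Finset.sum_cons]
      exact ((hM m (Finset.mem_cons_self m s)).const_mul (ha m (Finset.mem_cons_self m s))).add h2

/-- A family of matrices whose Plücker coordinates have signs `χ` and leading exponents `x`. -/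
def Liftable (χ : SignVector 3 6) (x : KSubset 3 6 → ℝ) : Prop :=
  ∃ A : ℝ → Matrix (Fin 3) (Fin 6) ℝ,
    ∀ I, Lead (fun t => ((χ I : ℤ) : ℝ) * pluckerCoord (A t) I) (x I)

theorem map_pluckerCoord {R S : Type*} [CommRing R] [CommRing S] (f : R →+* S) {k n : ℕ}
    (A : Matrix (Fin k) (Fin n) R) (I : KSubset k n) :
    f (pluckerCoord A I) = pluckerCoord (A.map f) I := by
  simp only [pluckerCoord, RingHom.map_det, RingHom.mapMatrix_apply, Matrix.submatrix_map]

theorem eval_eq_zero_of_mem_pluckerIdeal {k n : ℕ} {g : MvPolynomial (KSubset k n) ℤ}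
    (hg : g ∈ pluckerIdeal k n) (A : Matrix (Fin k) (Fin n) ℝ) :
    MvPolynomial.eval (pluckerCoord A) (g.map (Int.castRingHom ℝ)) = 0 := by
  have h1 := congrArg (MvPolynomial.eval₂Hom (Int.castRingHom ℝ) fun p : Fin k × Fin n => A p.1 p.2)
    (RingHom.mem_ker.1 hg)
  rw [map_zero] at h1
  have h2 : (MvPolynomial.eval (pluckerCoord A)).comp (MvPolynomial.map (Int.castRingHom ℝ)) =
      (MvPolynomial.eval₂Hom (Int.castRingHom ℝ) fun p : Fin k × Fin n => A p.1 p.2).comp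
        (MvPolynomial.aeval (R := ℤ) fun I : KSubset k n =>
          pluckerCoord (Matrix.mvPolynomialX (Fin k) (Fin n) ℤ) I).toRingHom := by
    refine MvPolynomial.ringHom_ext (fun a => by simp) fun I => ?_
    simp only [RingHom.comp_apply, MvPolynomial.map_X, MvPolynomial.eval_X, AlgHom.toRingHom_eq_coe,
      RingHom.coe_coe, MvPolynomial.aeval_X, map_pluckerCoord]
    congr 1
    ext i j
    simp
  rw [← h1]
  exact DFunLike.congr_fun h2 g

/-- This is the easy half of a fundamental theorem, with real one-parameter families in the role of
Puiseux series. Since `g` vanishes on the minors of `A t`, its terms positive at `χ` and the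
negatives of the others have equal sums. By `lead_sum` these have the two tropical minima as leading
exponents, and leading exponents are unique. If only one side were empty, a sum that is eventually
positive would be zero. -/
theorem Liftable.mem_chiGrassmannian {χ : SignVector 3 6} {x : KSubset 3 6 → ℝ}
    (h : Liftable χ x) : x ∈ chiGrassmannian χ := by
  classical
  obtain ⟨A, hA⟩ := h
  rw [chiGrassmannian, Set.mem_iInter₂]
  intro g hg
  set G := g.map (Int.castRingHom ℝ) with hG
  set M : (KSubset 3 6 →₀ ℕ) → ℝ → ℝ := fun m t =>
    ∏ I, (((χ I : ℤ) : ℝ) * pluckerCoord (A t) I) ^ m I with hMdef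
  have hM : ∀ m, Lead (M m) (weight x m) := by
    intro m
    have := Lead.prod Finset.univ fun I _ => (hA I).pow (m I)
    convert this using 1
    rw [weight, Finsupp.sum_fintype]
    simp
  have hterm : ∀ m t, termValue χ G m * M m t = G.coeff m * ∏ I, pluckerCoord (A t) I ^ m I := by
    intro m t
    rw [termValue, Finsupp.prod_fintype _ _ (by simp), mul_assoc, ← Finset.prod_mul_distrib]
    congr 1
    refine Finset.prod_congr rfl fun I _ => ?_
    rw [← mul_pow, ← mul_assoc]
    congr 1
    rcases Int.units_eq_one_or (χ I) with h | h <;> simp [h]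
  have hsum : ∀ t, ∑ m ∈ posSupport χ G, termValue χ G m * M m t =
      ∑ m ∈ negSupport χ G, (-termValue χ G m) * M m t := by
    intro t
    have h0 := eval_eq_zero_of_mem_pluckerIdeal hg (A t)
    rw [← hG, MvPolynomial.eval_eq'] at h0
    simp only [← hterm] at h0
    have hne : ∀ m ∈ G.support, termValue χ G m ≠ 0 := by
      intro m hm
      rw [termValue, Finsupp.prod_fintype _ _ (by simp)]
      refine mul_ne_zero (MvPolynomial.mem_support_iff.1 hm) (Finset.prod_ne_zero_iff.2 ?_)
      intro I _
      rcases Int.units_eq_one_or (χ I) with h | h <;> simp [h]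
    have hsplit : G.support.filter (fun m => ¬ 0 < termValue χ G m) = negSupport χ G := by
      refine Finset.filter_congr fun m hm => ?_
      rw [not_lt]
      exact ⟨fun h => lt_of_le_of_ne h (hne m hm), le_of_lt⟩
    rw [← Finset.sum_filter_add_sum_filter_not G.support (fun m => 0 < termValue χ G m),
      hsplit] at h0
    simp only [neg_mul, Finset.sum_neg_distrib]
    exact eq_neg_of_add_eq_zero_left h0
  have hp : ∀ m ∈ posSupport χ G, 0 < termValue χ G m := fun m hm => (Finset.mem_filter.1 hm).2
  have hn : ∀ m ∈ negSupport χ G, 0 < -termValue χ G m := fun m hm =>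
    neg_pos.2 (Finset.mem_filter.1 hm).2
  change tropMin (posSupport χ G) x = tropMin (negSupport χ G) x
  rcases (posSupport χ G).eq_empty_or_nonempty with h1 | h1
  · rcases (negSupport χ G).eq_empty_or_nonempty with h2 | h2
    · rw [h1, h2]
    · obtain ⟨e, -, he⟩ := lead_sum h2 hn fun m _ => hM m
      obtain ⟨t, ht⟩ := he.eventually_pos.exists
      rw [← hsum t, h1] at ht
      simp at ht
  · obtain ⟨e, h3, he⟩ := lead_sum h1 hp fun m _ => hM m
    rcases (negSupport χ G).eq_empty_or_nonempty with h2 | h2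
    · obtain ⟨t, ht⟩ := he.eventually_pos.exists
      rw [hsum t, h2] at ht
      simp at ht
    · obtain ⟨e', h4, he'⟩ := lead_sum h2 hn fun m _ => hM m
      rw [h3, h4, he.unique (he'.congr (Eventually.of_forall fun t => (hsum t).symm))]

theorem threeTermRelations_subset_pluckerIdeal :
    threeTermRelations 3 6 ⊆ (pluckerIdeal 3 6 : Set (MvPolynomial (KSubset 3 6) ℤ)) := by
  intro g hg
  obtain ⟨l, a, b, c, d, ⟨⟨la, lb, lc, ld⟩, nab, nac, nad, nbc, nbd, ncd⟩, hab, hbc, hcd, rfl⟩ :=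
    mem_threeTermRelations_iff.1 hg
  have hp := colDet_plucker (Matrix.mvPolynomialX (Fin 3) (Fin 6) ℤ) l a b c d
  rw [colDet_eq_sgn3_mul _ la lb nab, colDet_eq_sgn3_mul _ lc ld ncd,
    colDet_eq_sgn3_mul _ la lc nac,
    colDet_eq_sgn3_mul _ lb ld nbd, colDet_eq_sgn3_mul _ la ld nad,
    colDet_eq_sgn3_mul _ lb lc nbc] at hp
  obtain ⟨s1, s2⟩ := sgn3_mul_sgn3 (l := l) hab hbc hcd
  set v := Matrix.mvPolynomialX (Fin 3) (Fin 6) ℤ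
  have e1 := congrArg (fun u : ℤˣ => (((u : ℤ)) : MvPolynomial (Fin 3 × Fin 6) ℤ)) s1
  have e2 := congrArg (fun u : ℤˣ => (((u : ℤ)) : MvPolynomial (Fin 3 × Fin 6) ℤ)) s2
  push_cast at e1 e2
  -- The sorting signs give the three terms a common factor with square 1; multiplying by it turns
  -- the determinant identity into the sorted relation.
  have e0 : ((sgn3 l a b * sgn3 l c d : ℤ) : MvPolynomial (Fin 3 × Fin 6) ℤ)
      * ((sgn3 l a b * sgn3 l c d : ℤ) : MvPolynomial (Fin 3 × Fin 6) ℤ) = 1 := by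
    rcases Int.units_eq_one_or (sgn3 l a b) with h | h <;>
      rcases Int.units_eq_one_or (sgn3 l c d) with h' | h' <;> simp [h, h']
  push_cast at e0
  change _ ∈ RingHom.ker _
  rw [RingHom.mem_ker]
  simp only [threeTerm, map_add, map_sub, map_mul, MvPolynomial.aeval_X]
  linear_combination ((sgn3 l a b : ℤ) : MvPolynomial (Fin 3 × Fin 6) ℤ) *
    ((sgn3 l c d : ℤ) : MvPolynomial (Fin 3 × Fin 6) ℤ) * hp
    + ((sgn3 l a b : ℤ) : MvPolynomial (Fin 3 × Fin 6) ℤ) *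
      ((sgn3 l c d : ℤ) : MvPolynomial (Fin 3 × Fin 6) ℤ) *
      (pluckerCoord v (tr l a c) * pluckerCoord v (tr l b d) * e1
        - pluckerCoord v (tr l a d) * pluckerCoord v (tr l b c) * e2)
    - (pluckerCoord v (tr l a b) * pluckerCoord v (tr l c d)
        - pluckerCoord v (tr l a c) * pluckerCoord v (tr l b d)
        + pluckerCoord v (tr l a d) * pluckerCoord v (tr l b c)) * e0

theorem chiGrassmannian_subset_chiDressian (χ : SignVector 3 6) :
    chiGrassmannian χ ⊆ chiDressian χ := by
  intro x hx
  rw [chiGrassmannian, Set.mem_iInter₂] at hx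
  rw [chiDressian, Set.mem_iInter₂]
  exact fun g hg => hx g (threeTermRelations_subset_pluckerIdeal hg)

/-! ### Limits of points of the Grassmannian -/

theorem tropMin_eq_inf' {ι : Type*} {s : Finset (ι →₀ ℕ)} (hs : s.Nonempty) (x : ι → ℝ) :
    tropMin s x = ((s.inf' hs fun m => weight x m : ℝ) : WithTop ℝ) := by
  rw [tropMin, Finset.coe_inf']; rfl

/-- Finite minima of weights are continuous in ε, so their equality passes to the limit. Whether a
minimum is infinite does not depend on the point. -/
theorem mem_chiHypersurface_of_forall_add_smul {ι : Type*} {χ : ι → ℤˣ} {g : MvPolynomial ι ℝ}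
    {x w : ι → ℝ} (h : ∀ ε : ℝ, 0 < ε → x + ε • w ∈ chiHypersurface χ g) :
    x ∈ chiHypersurface χ g := by
  have h1 : ∀ ε : ℝ, 0 < ε → tropMin (posSupport χ g) (x + ε • w)
    = tropMin (negSupport χ g) (x + ε • w) := h
  change tropMin (posSupport χ g) x = tropMin (negSupport χ g) x
  rcases (posSupport χ g).eq_empty_or_nonempty with hp | hp <;>
    rcases (negSupport χ g).eq_empty_or_nonempty with hn | hn
  · rw [hp, hn]
  · have := h1 1 one_pos
    rw [hp, tropMin_eq_inf' hn] at this
    exact absurd this WithTop.top_ne_coe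
  · have := h1 1 one_pos
    rw [hn, tropMin_eq_inf' hp] at this
    exact absurd this WithTop.coe_ne_top
  · have hc : ∀ (s : Finset (ι →₀ ℕ)) (hs : s.Nonempty),
        Tendsto (fun ε : ℝ => s.inf' hs fun m => weight (x + ε • w) m) (𝓝[>] 0)
          (𝓝 (s.inf' hs fun m => weight x m)) := by
      intro s hs
      have hcont : Continuous (fun ε : ℝ => s.inf' hs fun m => weight (x + ε • w) m) := by
        refine Continuous.finset_inf'_apply hs fun m _ => ?_
        simp only [weight_add, weight_smul]
        fun_prop
      have := (hcont.tendsto 0).mono_left (nhdsWithin_le_nhds (s := Set.Ioi 0))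
      simpa using this
    rw [tropMin_eq_inf' hp, tropMin_eq_inf' hn, WithTop.coe_inj]
    refine tendsto_nhds_unique ((hc _ hp).congr' ?_) (hc _ hn)
    filter_upwards [self_mem_nhdsWithin] with ε hε
    have := h1 ε hε
    rwa [tropMin_eq_inf' hp, tropMin_eq_inf' hn, WithTop.coe_inj] at this

theorem mem_chiGrassmannian_of_forall_add_smul {χ : SignVector 3 6} {x w : KSubset 3 6 → ℝ}
    (h : ∀ ε : ℝ, 0 < ε → x + ε • w ∈ chiGrassmannian χ) : x ∈ chiGrassmannian χ := by
  rw [chiGrassmannian, Set.mem_iInter₂]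
  intro g hg
  refine mem_chiHypersurface_of_forall_add_smul (w := w) fun ε hε => ?_
  have := h ε hε
  rw [chiGrassmannian, Set.mem_iInter₂] at this
  exact this g hg

end Chirotropical

namespace Chirotropical

/-! ### The Dressian in coded coordinates -/

/-- The code of a subset of the ground set. -/
def encode (I : Finset (Fin 6)) : ℕ := ∑ i ∈ I, 2 ^ (i : ℕ)

theorem encode_tr : ∀ i j k : Fin 6, i ≠ j → i ≠ k → j ≠ k →
    encode (tr i j k).1 = code3 i j k := by
  decide +kernel

theorem decode_encode (I : KSubset 3 6) : decode (encode I.1) = I := by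
  obtain ⟨i, j, k, hij, hjk, rfl⟩ := exists_eq_tr I
  rw [encode_tr i j k hij.ne (hij.trans hjk).ne hjk.ne]
  rfl

/-- A signed three-term relation in coded form: the pair of codes of the monomial with the
exceptional sign, followed by the pairs of the two other monomials. -/
abbrev CodedRel : Type := (ℕ × ℕ) × (ℕ × ℕ) × (ℕ × ℕ)

/-- The thirty increasing choices of `a, b, c, d` outside of `l`. -/
def quints : List Quint :=
  (List.finRange 6).flatMap fun l =>
    (([(0, 1, 2, 3), (0, 1, 2, 4), (0, 1, 2, 5), (0, 1, 3, 4), (0, 1, 3, 5), (0, 1, 4, 5),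
      (0, 2, 3, 4), (0, 2, 3, 5), (0, 2, 4, 5), (0, 3, 4, 5), (1, 2, 3, 4), (1, 2, 3, 5),
      (1, 2, 4, 5), (1, 3, 4, 5), (2, 3, 4, 5)] : List (Fin 6 × Fin 6 × Fin 6 × Fin 6)).filter
        fun q => l ≠ q.1 ∧ l ≠ q.2.1 ∧ l ≠ q.2.2.1 ∧ l ≠ q.2.2.2).map fun q => (l, q)

/-- The quintuple is increasing up to its first entry. -/
def IsSorted (q : Quint) : Prop :=
  Distinct5 q.1 q.2.1 q.2.2.1 q.2.2.2.1 q.2.2.2.2 ∧ q.2.1 < q.2.2.1 ∧ q.2.2.1 < q.2.2.2.1 ∧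
    q.2.2.2.1 < q.2.2.2.2

instance (q : Quint) : Decidable (IsSorted q) := by unfold IsSorted; infer_instance

theorem mem_quints {q : Quint} : q ∈ quints ↔ IsSorted q := by
  constructor
  · have : (quints.all fun q => decide (IsSorted q)) = true := by decide +kernel
    exact fun hq => of_decide_eq_true (List.all_eq_true.1 this q hq)
  · have : ∀ a b : Fin 6, a < b → ∀ c, b < c → ∀ d, c < d → ∀ l, Distinct5 l a b c d →
      (l, a, b, c, d) ∈ quints := by decide +kernel
    rintro ⟨hd, h1, h2, h3⟩
    exact this _ _ h1 _ h2 _ h3 _ hd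

/-- The sign coded by a binary digit. -/
def bitSign (b : Bool) : ℤˣ := if b then -1 else 1

theorem bitSign_mul (b b' : Bool) : bitSign b * bitSign b' = bitSign (b ^^ b') := by
  cases b <;> cases b' <;> simp [bitSign]

/-- The coded form of a three-term relation, given the code of the set of negative signs. -/
def codedRel (neg : ℕ) (q : Quint) : CodedRel :=
  let m₀ := (code3 q.1 q.2.1 q.2.2.1, code3 q.1 q.2.2.2.1 q.2.2.2.2)
  let m₁ := (code3 q.1 q.2.1 q.2.2.2.1, code3 q.1 q.2.2.1 q.2.2.2.2)
  let m₂ := (code3 q.1 q.2.1 q.2.2.2.2, code3 q.1 q.2.2.1 q.2.2.2.1)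
  let s₀ := neg.testBit m₀.1 ^^ neg.testBit m₀.2
  let s₁ := neg.testBit m₁.1 ^^ neg.testBit m₁.2
  let s₂ := neg.testBit m₂.1 ^^ neg.testBit m₂.2
  -- The middle term enters with a minus sign. So s₀ = s₁ means that the first two terms differ in
  -- sign, and s₂ decides which of them is odd; if s₀ ≠ s₁ they agree, and for a chirotope the third
  -- is odd.
  if s₀ = s₁ then (if s₁ = s₂ then (m₁, m₀, m₂) else (m₀, m₁, m₂)) else (m₂, m₀, m₁)

/-- The sum of the coordinates of a pair of codes. -/
def pairVal (x : ℕ → ℝ) (p : ℕ × ℕ) : ℝ := x p.1 + x p.2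

/-- The tropical form of a signed three-term relation. -/
def IsTropical (x : ℕ → ℝ) (ρ : CodedRel) : Prop :=
  pairVal x ρ.1 = min (pairVal x ρ.2.1) (pairVal x ρ.2.2)

/-- The signs `χ` are given by the binary digits of `neg`. -/
def HasCode (χ : SignVector 3 6) (neg : ℕ) : Prop :=
  ∀ I : KSubset 3 6, χ I = bitSign (neg.testBit (encode I.1))

theorem HasCode.apply_tr {χ : SignVector 3 6} {neg : ℕ} (h : HasCode χ neg) {i j k : Fin 6}
    (hij : i ≠ j) (hik : i ≠ k) (hjk : j ≠ k) :
    χ (tr i j k) = bitSign (neg.testBit (code3 i j k)) := by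
  rw [h, encode_tr i j k hij hik hjk]

/-- The coded form of a relation describes which of its terms has the exceptional sign. -/
theorem codedRel_cases {χ : SignVector 3 6} {neg : ℕ} (hneg : HasCode χ neg) (hχ : IsChirotope χ)
    {l a b c d : Fin 6} (hs : IsSorted (l, a, b, c, d)) :
    (Odd χ l a b c d ∧ ¬Odd χ l a c b d ∧ ¬Odd χ l a d b c ∧ codedRel neg (l, a, b, c, d) =
      ((code3 l a b, code3 l c d), (code3 l a c, code3 l b d), (code3 l a d, code3 l b c))) ∨
    (Odd χ l a c b d ∧ ¬Odd χ l a b c d ∧ ¬Odd χ l a d b c ∧ codedRel neg (l, a, b, c, d) =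
      ((code3 l a c, code3 l b d), (code3 l a b, code3 l c d), (code3 l a d, code3 l b c))) ∨
    (Odd χ l a d b c ∧ ¬Odd χ l a b c d ∧ ¬Odd χ l a c b d ∧ codedRel neg (l, a, b, c, d) =
      ((code3 l a d, code3 l b c), (code3 l a b, code3 l c d), (code3 l a c, code3 l b d))) := by
  obtain ⟨hd, h1, h2, h3⟩ := hs
  simp only at hd h1 h2 h3
  obtain ⟨o0, o1, o2⟩ := odd_iff_of_sorted (χ := χ) hd h1 h2 h3
  have hn' := hχ.not_of_sorted hd h1 h2 h3
  obtain ⟨⟨la, lb, lc, ld⟩, nab, nac, nad, nbc, nbd, ncd⟩ := hd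
  rw [hneg.apply_tr la lb nab, hneg.apply_tr lc ld ncd, hneg.apply_tr la lc nac,
    hneg.apply_tr lb ld nbd, hneg.apply_tr la ld nad, hneg.apply_tr lb lc nbc] at *
  rw [o0, o1, o2]
  simp only [codedRel]
  simp only [bitSign_mul] at *
  generalize (neg.testBit (code3 l a b) ^^ neg.testBit (code3 l c d)) = b₀ at *
  generalize (neg.testBit (code3 l a c) ^^ neg.testBit (code3 l b d)) = b₁ at *
  generalize (neg.testBit (code3 l a d) ^^ neg.testBit (code3 l b c)) = b₂ at *
  clear o0 o1 o2
  revert hn'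
  have e : (-1 : ℤˣ) ≠ 1 := by decide
  have e' : (1 : ℤˣ) ≠ -1 := by decide
  cases b₀ <;> cases b₁ <;> cases b₂ <;> simp [bitSign, e, e']

theorem mem_chiDressian_iff_sorted {χ : SignVector 3 6} (hχ : IsChirotope χ)
    {x : KSubset 3 6 → ℝ} : x ∈ chiDressian χ ↔ ∀ l a b c d, IsSorted (l, a, b, c, d) →
      (Odd χ l a b c d → TropEq x l a b c d) ∧ (Odd χ l a c b d → TropEq x l a c b d) ∧
        (Odd χ l a d b c → TropEq x l a d b c) := by
  constructor
  · intro h l a b c d hs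
    rw [mem_chiDressian_iff hχ] at h
    exact ⟨h _ _ _ _ _ hs.1, h _ _ _ _ _ hs.1.swap₂, h _ _ _ _ _ hs.1.swap₃.swap₂⟩
  · intro h
    rw [chiDressian, Set.mem_iInter₂]
    intro g hg
    obtain ⟨l, a, b, c, d, hd, hab, hbc, hcd, rfl⟩ := mem_threeTermRelations_iff.1 hg
    exact (mem_chiHypersurface_threeTerm hχ hd hab hbc hcd x).2 (h l a b c d ⟨hd, hab, hbc, hcd⟩)

/-- The coded coordinates of a vector. -/
def coded (y : KSubset 3 6 → ℝ) (n : ℕ) : ℝ := y (decode n)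

theorem mem_chiDressian_iff_coded {χ : SignVector 3 6} {neg : ℕ} (hneg : HasCode χ neg)
    (hχ : IsChirotope χ) {y : KSubset 3 6 → ℝ} :
    y ∈ chiDressian χ ↔ ∀ ρ ∈ quints.map (codedRel neg), IsTropical (coded y) ρ := by
  rw [mem_chiDressian_iff_sorted hχ]
  rw [List.forall_mem_map]
  simp only [mem_quints, Prod.forall]
  refine forall₅_congr fun l a b c d => forall_congr' fun hs => ?_
  rcases codedRel_cases hneg hχ hs with ⟨h0, h1, h2, h⟩ | ⟨h0, h1, h2, h⟩ | ⟨h0, h1, h2, h⟩ <;>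
    rw [h] <;> simp only [h0, h1, h2, true_imp_iff, false_imp_iff, and_true, true_and] <;>
    simp only [TropEq, IsTropical, pairVal, coded, tr_swap_right l b c, tr_swap_right l b d,
      tr_swap_right l c d] <;>
    simp only [tr]

theorem mem_dressianCone_iff_sorted {w x : KSubset 3 6 → ℝ} :
    x ∈ dressianCone w ↔ ∀ l a b c d, IsSorted (l, a, b, c, d) →
      (Dominates w l a b c d → Dominates x l a b c d) ∧
      (Dominates w l a c b d → Dominates x l a c b d) ∧
      (Dominates w l a d b c → Dominates x l a d b c) := by
  constructor
  · intro h l a b c d hs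
    rw [mem_dressianCone_iff] at h
    exact ⟨h _ _ _ _ _ hs.1, h _ _ _ _ _ hs.1.swap₂, h _ _ _ _ _ hs.1.swap₃.swap₂⟩
  · intro h
    change ∀ g ∈ threeTermRelations 3 6, minMonomials g w ⊆ minMonomials g x
    intro g hg
    obtain ⟨l, a, b, c, d, hd, hab, hbc, hcd, rfl⟩ := mem_threeTermRelations_iff.1 hg
    obtain ⟨h0, h1, h2⟩ := h l a b c d ⟨hd, hab, hbc, hcd⟩
    have Ew := expo_mem_minMonomials (x := w) hd
    have Ex := expo_mem_minMonomials (x := x) hd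
    intro m hm
    have hm' := hm.1
    rw [support_threeTerm hd] at hm'
    simp only [Finset.mem_insert, Finset.mem_singleton] at hm'
    rcases hm' with rfl | rfl | rfl
    · exact Ex.1.2 (h0 (Ew.1.1 hm))
    · exact Ex.2.1.2 (h1 (Ew.2.1.1 hm))
    · exact Ex.2.2.2 (h2 (Ew.2.2.1 hm))

/-- On the Dressian the odd monomial is always minimal. Inclusion of sets of minimal monomials
therefore reduces to inclusion of the sets of vanishing slacks. -/
theorem minimal_iff_of_eq_min {a₀ a₁ a₂ b₀ b₁ b₂ : ℝ} (ha : a₀ = min a₁ a₂) (hb : b₀ = min b₁ b₂) :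
    ((b₀ ≤ b₁ ∧ b₀ ≤ b₂ → a₀ ≤ a₁ ∧ a₀ ≤ a₂) ∧ (b₁ ≤ b₀ ∧ b₁ ≤ b₂ → a₁ ≤ a₀ ∧ a₁ ≤ a₂) ∧
      (b₂ ≤ b₀ ∧ b₂ ≤ b₁ → a₂ ≤ a₀ ∧ a₂ ≤ a₁)) ↔
    (b₁ - b₀ = 0 → a₁ - a₀ = 0) ∧ (b₂ - b₀ = 0 → a₂ - a₀ = 0) := by
  have a1 : a₀ ≤ a₁ := ha ▸ min_le_left _ _
  have a2 : a₀ ≤ a₂ := ha ▸ min_le_right _ _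
  have b1 : b₀ ≤ b₁ := hb ▸ min_le_left _ _
  have b2 : b₀ ≤ b₂ := hb ▸ min_le_right _ _
  constructor
  · rintro ⟨-, h1, h2⟩
    constructor
    · intro h
      have := h1 ⟨by linarith, by linarith⟩
      linarith
    · intro h
      have := h2 ⟨by linarith, by linarith⟩
      linarith
  · rintro ⟨h1, h2⟩
    refine ⟨fun _ => ⟨a1, a2⟩, fun h => ?_, fun h => ?_⟩
    · have := h1 (by linarith)
      constructor <;> linarith
    · have := h2 (by linarith)
      constructor <;> linarith

theorem mem_dressianCone_iff_coded {χ : SignVector 3 6} {neg : ℕ} (hneg : HasCode χ neg)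
    (hχ : IsChirotope χ) {w x : KSubset 3 6 → ℝ} (hw : w ∈ chiDressian χ)
    (hx : x ∈ chiDressian χ) :
    x ∈ dressianCone w ↔ ∀ ρ ∈ quints.map (codedRel neg),
      (pairVal (coded w) ρ.2.1 - pairVal (coded w) ρ.1 = 0 →
        pairVal (coded x) ρ.2.1 - pairVal (coded x) ρ.1 = 0) ∧
      (pairVal (coded w) ρ.2.2 - pairVal (coded w) ρ.1 = 0 →
        pairVal (coded x) ρ.2.2 - pairVal (coded x) ρ.1 = 0) := by
  rw [mem_chiDressian_iff_coded hneg hχ] at hw hx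
  rw [mem_dressianCone_iff_sorted, List.forall_mem_map]
  rw [List.forall_mem_map] at hw hx
  simp only [mem_quints, Prod.forall] at hw hx ⊢
  refine forall₅_congr fun l a b c d => forall_congr' fun hs => ?_
  have hw := hw l a b c d hs
  have hx := hx l a b c d hs
  rw [← minimal_iff_of_eq_min hx hw]
  simp only [Dominates, tr_swap_right l b c, tr_swap_right l b d, tr_swap_right l c d]
  rcases codedRel_cases hneg hχ hs with ⟨-, -, -, h⟩ | ⟨-, -, -, h⟩ | ⟨-, -, -, h⟩ <;>
    rw [h] <;> simp only [pairVal, coded, tr]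
  · exact ⟨fun ⟨h0, h1, h2⟩ => ⟨h1, h0, fun h => (h2 h.symm).symm⟩,
      fun ⟨h1, h0, h2⟩ => ⟨h0, h1, fun h => (h2 h.symm).symm⟩⟩
  · exact ⟨fun ⟨h0, h1, h2⟩ => ⟨h2, fun h => (h0 h.symm).symm, fun h => (h1 h.symm).symm⟩,
      fun ⟨h2, h0, h1⟩ => ⟨fun h => (h0 h.symm).symm, fun h => (h1 h.symm).symm, h2⟩⟩

end Chirotropical

namespace Chirotropical

/-! ### Supports of tropical points -/

/-- The number with binary digits `b 0, …, b (k - 1)`. -/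
def digits (b : ℕ → Bool) : ℕ → ℕ
  | 0 => 0
  | k + 1 => bif b k then digits b k ||| 2 ^ k else digits b k

theorem testBit_digits (b : ℕ → Bool) (k i : ℕ) :
    (digits b k).testBit i = (decide (i < k) && b i) := by
  induction k with
  | zero => simp [digits]
  | succ k ih =>
    rw [digits]
    rcases lt_trichotomy i k with h | rfl | h
    · cases hb : b k <;> simp [ih, Nat.testBit_or, h, h.ne', h.trans (Nat.lt_succ_self k)]
    · cases hb : b i <;> simp [ih, Nat.testBit_or, hb]
    · have h1 : ¬ i < k := by omega
      have h2 : ¬ i < k + 1 := by omega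
      cases hb : b k <;> simp [ih, Nat.testBit_or, h1, h2, h.ne]

/-- The `j`-th slack of the relations `rs`: a pair of codes and the pair to be subtracted. -/
def slack (rs : List CodedRel) (j : ℕ) : (ℕ × ℕ) × (ℕ × ℕ) :=
  match rs[j / 2]? with
  | none => ((0, 0), (0, 0))
  | some ρ => (bif j % 2 == 0 then ρ.2.1 else ρ.2.2, ρ.1)

/-- The value of the `j`-th slack: by how much one of the monomials fails to be minimal. -/
def slackVal (rs : List CodedRel) (x : ℕ → ℝ) (j : ℕ) : ℝ :=
  pairVal x (slack rs j).1 - pairVal x (slack rs j).2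

/-- All the relations `rs` hold tropically at `x`. -/
def Tropical (rs : List CodedRel) (x : ℕ → ℝ) : Prop := ∀ ρ ∈ rs, IsTropical x ρ

theorem slackVal_even {rs : List CodedRel} {r : ℕ} {ρ : CodedRel} (h : rs[r]? = some ρ)
    (x : ℕ → ℝ) : slackVal rs x (2 * r) = pairVal x ρ.2.1 - pairVal x ρ.1 := by
  have : 2 * r / 2 = r := by omega
  have h2 : 2 * r % 2 = 0 := by omega
  simp [slackVal, slack, this, h, h2]

theorem slackVal_odd {rs : List CodedRel} {r : ℕ} {ρ : CodedRel} (h : rs[r]? = some ρ)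
    (x : ℕ → ℝ) : slackVal rs x (2 * r + 1) = pairVal x ρ.2.2 - pairVal x ρ.1 := by
  have : (2 * r + 1) / 2 = r := by omega
  have h2 : (2 * r + 1) % 2 = 1 := by omega
  simp [slackVal, slack, this, h, h2]

/-- The default pairs in `slack` make all positions out of range vanish, so statements may quantify
over every j. -/
theorem slackVal_of_le {rs : List CodedRel} {j : ℕ} (h : 2 * rs.length ≤ j) (x : ℕ → ℝ) :
    slackVal rs x j = 0 := by
  have : rs[j / 2]? = none := List.getElem?_eq_none (by omega)
  simp [slackVal, slack, this]

theorem slackVal_add (rs : List CodedRel) (x y : ℕ → ℝ) (j : ℕ) :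
    slackVal rs (x + y) j = slackVal rs x j + slackVal rs y j := by
  simp only [slackVal, pairVal, Pi.add_apply]; ring

theorem slackVal_smul (rs : List CodedRel) (c : ℝ) (x : ℕ → ℝ) (j : ℕ) :
    slackVal rs (c • x) j = c * slackVal rs x j := by
  simp only [slackVal, pairVal, Pi.smul_apply, smul_eq_mul]; ring

theorem isTropical_iff {x : ℕ → ℝ} {ρ : CodedRel} : IsTropical x ρ ↔
    0 ≤ pairVal x ρ.2.1 - pairVal x ρ.1 ∧ 0 ≤ pairVal x ρ.2.2 - pairVal x ρ.1 ∧
    (pairVal x ρ.2.1 - pairVal x ρ.1 = 0 ∨ pairVal x ρ.2.2 - pairVal x ρ.1 = 0) := by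
  rw [IsTropical]
  constructor
  · intro h
    have h1 := h ▸ min_le_left (pairVal x ρ.2.1) (pairVal x ρ.2.2)
    have h2 := h ▸ min_le_right (pairVal x ρ.2.1) (pairVal x ρ.2.2)
    refine ⟨by linarith, by linarith, ?_⟩
    rcases min_choice (pairVal x ρ.2.1) (pairVal x ρ.2.2) with h3 | h3
    · left; linarith
    · right; linarith
  · rintro ⟨h1, h2, h3 | h3⟩
    · rw [min_eq_left] <;> linarith
    · rw [min_eq_right] <;> linarith

theorem tropical_iff {rs : List CodedRel} {x : ℕ → ℝ} : Tropical rs x ↔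
    (∀ j, 0 ≤ slackVal rs x j) ∧
      ∀ r, slackVal rs x (2 * r) = 0 ∨ slackVal rs x (2 * r + 1) = 0 := by
  constructor
  · intro h
    have key : ∀ r, 0 ≤ slackVal rs x (2 * r) ∧ 0 ≤ slackVal rs x (2 * r + 1) ∧
        (slackVal rs x (2 * r) = 0 ∨ slackVal rs x (2 * r + 1) = 0) := by
      intro r
      cases hr : rs[r]? with
      | none =>
        have := List.getElem?_eq_none_iff.1 hr
        rw [slackVal_of_le (by omega), slackVal_of_le (by omega)]
        simp
      | some ρ =>
        rw [slackVal_even hr, slackVal_odd hr]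
        exact isTropical_iff.1 (h ρ (List.mem_of_getElem? hr))
    refine ⟨fun j => ?_, fun r => (key r).2.2⟩
    rcases Nat.even_or_odd' j with ⟨r, rfl | rfl⟩
    · exact (key r).1
    · exact (key r).2.1
  · rintro ⟨h1, h2⟩ ρ hρ
    obtain ⟨r, hr⟩ := List.getElem?_of_mem hρ
    refine isTropical_iff.2 ?_
    have a := h1 (2 * r)
    have b := h1 (2 * r + 1)
    have c := h2 r
    rw [slackVal_even hr, slackVal_odd hr] at c
    rw [slackVal_even hr] at a
    rw [slackVal_odd hr] at b
    exact ⟨a, b, c⟩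

open Classical in
/-- The positions of the positive slacks at `x`, as binary digits. -/
noncomputable def support (rs : List CodedRel) (x : ℕ → ℝ) : ℕ :=
  digits (fun j => decide (0 < slackVal rs x j)) (2 * rs.length)

theorem testBit_support {rs : List CodedRel} {x : ℕ → ℝ} {j : ℕ} :
    (support rs x).testBit j = true ↔ 0 < slackVal rs x j := by
  rw [support, testBit_digits]
  by_cases h : j < 2 * rs.length
  · simp [h]
  · simp [h, slackVal_of_le (not_lt.1 h)]

/-! ### Enumeration of the supports -/

/-- The condition on binary digits that is implied by identities between sums of slacks. -/
noncomputable def balanced (m : ℕ) (cs : List (ℕ × ℕ)) : Bool :=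
  List.rec true (fun c _ ih => bif Nat.beq (Nat.land m c.1) 0
    then (bif Nat.beq (Nat.land m c.2) 0 then ih else false)
    else (bif Nat.beq (Nat.land m c.2) 0 then false else ih)) cs

/-- Prepends `m` to a list if it satisfies the conditions. -/
noncomputable def consBalanced (cs : List (ℕ × ℕ)) (m : ℕ) (L : List ℕ) : List ℕ :=
  bif balanced m cs then m :: L else L

/-- Extends the numbers in a list by a binary digit in base four, other than `3`, in all ways that
satisfy the conditions. -/
noncomputable def extend (cs : List (ℕ × ℕ)) (b : ℕ) (L : List ℕ) : List ℕ :=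
  List.rec [] (fun m _ acc => consBalanced cs m (consBalanced cs (Nat.lor m b)
    (consBalanced cs (Nat.lor m (Nat.mul 2 b)) acc))) L

/-- Extends the numbers in a list by all digits for which there are conditions. -/
noncomputable def enumerate : List (List (ℕ × ℕ)) → ℕ → List ℕ → List ℕ
  | [], _, L => L
  | cs :: T, b, L => enumerate T (Nat.mul 4 b) (extend cs b L)

/-- The `j`-th binary digit, in terms of operations that the kernel evaluates directly. -/
def digit (m j : ℕ) : Bool := Nat.beq (Nat.land (Nat.shiftRight m j) 1) 1

theorem digit_eq_testBit (m j : ℕ) : digit m j = m.testBit j := by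
  rw [Bool.eq_iff_iff, digit, Nat.beq_eq, Nat.testBit_eq_decide_div_mod_eq, decide_eq_true_iff]
  change (m >>> j) &&& 1 = 1 ↔ _
  rw [Nat.and_one_is_mod, Nat.shiftRight_eq_div_pow]

/-- The positions of the binary digits `1` below the `k`-th. -/
def positions (k p : ℕ) : List ℕ := (List.range k).filter (digit p)

/-- The codes in the leading terms of the slacks at the given positions. -/
def leftCodes (rs : List CodedRel) (l : List ℕ) : List ℕ :=
  l.flatMap fun j => [(slack rs j).1.1, (slack rs j).1.2]

/-- The codes that are subtracted in the slacks at the given positions. -/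
def rightCodes (rs : List CodedRel) (l : List ℕ) : List ℕ :=
  l.flatMap fun j => [(slack rs j).2.1, (slack rs j).2.2]

/-- The sum of the slacks in the set `c.1` equals the sum of the slacks in the set `c.2`, and the
sets are contained in `{0, …, k - 1}`. -/
def validIdentity (rs : List CodedRel) (k : ℕ) (c : ℕ × ℕ) : Bool :=
  Nat.blt c.1 (2 ^ k) && Nat.blt c.2 (2 ^ k) &&
    (leftCodes rs (positions k c.1) ++ rightCodes rs (positions k c.2)).isPerm
      (leftCodes rs (positions k c.2) ++ rightCodes rs (positions k c.1))

/-- All identities in the table are valid. -/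
def validTable (rs : List CodedRel) : ℕ → List (List (ℕ × ℕ)) → Bool
  | _, [] => true
  | k, cs :: T => cs.all (validIdentity rs (k + 2)) && validTable rs (k + 2) T

theorem sum_slackVal (rs : List CodedRel) (x : ℕ → ℝ) (l : List ℕ) :
    (l.map (slackVal rs x)).sum = ((leftCodes rs l).map x).sum - ((rightCodes rs l).map x).sum := by
  induction l with
  | nil => simp [leftCodes, rightCodes]
  | cons j l ih =>
    have e1 : leftCodes rs (j :: l) = [(slack rs j).1.1, (slack rs j).1.2] ++ leftCodes rs l := by
      simp [leftCodes]
    have e2 : rightCodes rs (j :: l) = [(slack rs j).2.1, (slack rs j).2.2] ++ rightCodes rs l := by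
      simp [rightCodes]
    rw [e1, e2, List.map_cons, List.sum_cons, ih]
    simp only [List.map_append, List.sum_append, List.map_cons, List.map_nil, List.sum_cons,
      List.sum_nil, slackVal, pairVal]
    ring

/-- Moving the subtracted codes to the other side turns the identity into an equality of two
multisets of codes, so it holds at every `x`. -/
theorem validIdentity.sum_eq {rs : List CodedRel} {k : ℕ} {c : ℕ × ℕ}
    (h : validIdentity rs k c = true) (x : ℕ → ℝ) :
    ((positions k c.1).map (slackVal rs x)).sum = ((positions k c.2).map (slackVal rs x)).sum := by
  rw [validIdentity, Bool.and_eq_true, List.isPerm_iff] at h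
  have := (h.2.map x).sum_eq
  rw [List.map_append, List.map_append, List.sum_append, List.sum_append] at this
  rw [sum_slackVal, sum_slackVal]
  linarith

theorem sum_pos_iff_of_nonneg {α : Type*} {f : α → ℝ} (hf : ∀ a, 0 ≤ f a) (l : List α) :
    0 < (l.map f).sum ↔ ∃ a ∈ l, 0 < f a := by
  induction l with
  | nil => simp
  | cons a l ih =>
    have h : 0 ≤ (l.map f).sum := List.sum_nonneg (by simpa using fun b _ => hf b)
    rw [List.map_cons, List.sum_cons, List.exists_mem_cons_iff, ← ih]
    refine ⟨fun hp => ?_, fun hp => ?_⟩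
    · by_contra hc
      push Not at hc
      linarith
    · have := hf a
      rcases hp with hp | hp <;> linarith

/-- A set of slacks meets the support if and only if the slacks have a positive sum. -/
theorem land_digits_eq_zero_iff {rs : List CodedRel} {x : ℕ → ℝ} (h : ∀ j, 0 ≤ slackVal rs x j)
    {k p : ℕ} {b : ℕ → Bool} (hb : ∀ j, b j = true ↔ 0 < slackVal rs x j) (_ : p < 2 ^ k) :
    Nat.land (digits b k) p = 0 ↔ ¬0 < ((positions k p).map (slackVal rs x)).sum := by
  rw [sum_pos_iff_of_nonneg h, not_exists]
  change digits b k &&& p = 0 ↔ _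
  constructor
  · rintro h0 j ⟨hj, hj'⟩
    have := congrArg (fun n => n.testBit j) h0
    simp only [positions, List.mem_filter, List.mem_range, digit_eq_testBit] at hj
    simp [Nat.testBit_and, testBit_digits, hj.1, hj.2, (hb j).2 hj'] at this
  · intro h0
    refine Nat.eq_of_testBit_eq fun j => ?_
    rw [Nat.testBit_and, testBit_digits, Nat.zero_testBit]
    by_contra hc
    simp only [Bool.and_eq_false_iff, decide_eq_false_iff_not, not_or, Bool.not_eq_false,
      Decidable.not_not, Bool.not_eq_false] at hc
    refine h0 j ⟨?_, (hb j).1 hc.1.2⟩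
    simp only [positions, List.mem_filter, List.mem_range, digit_eq_testBit]
    exact ⟨hc.1.1, hc.2⟩

theorem balanced_iff {m : ℕ} {cs : List (ℕ × ℕ)} : balanced m cs = true ↔
    ∀ c ∈ cs, Nat.land m c.1 = 0 ↔ Nat.land m c.2 = 0 := by
  induction cs with
  | nil => simp [balanced]
  | cons c cs ih =>
    rw [List.forall_mem_cons, ← ih]
    change (bif Nat.beq (Nat.land m c.1) 0
      then (bif Nat.beq (Nat.land m c.2) 0 then balanced m cs else false)
      else (bif Nat.beq (Nat.land m c.2) 0 then false else balanced m cs)) = true ↔ _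
    rw [← Nat.beq_eq, ← Nat.beq_eq]
    cases Nat.beq (Nat.land m c.1) 0 <;> cases Nat.beq (Nat.land m c.2) 0 <;> simp

theorem mem_consBalanced {cs : List (ℕ × ℕ)} {m n : ℕ} {L : List ℕ} :
    n ∈ consBalanced cs m L ↔ (n = m ∧ balanced m cs = true) ∨ n ∈ L := by
  unfold consBalanced
  cases h : balanced m cs <;> simp

theorem mem_extend {cs : List (ℕ × ℕ)} {b m n : ℕ} {L : List ℕ} (hm : m ∈ L)
    (hn : n = m ∨ n = m ||| b ∨ n = m ||| 2 * b) (ha : balanced n cs = true) :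
    n ∈ extend cs b L := by
  induction L with
  | nil => simp at hm
  | cons a L ih =>
    change n ∈ consBalanced cs a (consBalanced cs (a ||| b) (consBalanced cs (a ||| 2 * b)
      (extend cs b L)))
    simp only [mem_consBalanced]
    rcases List.mem_cons.1 hm with rfl | hm
    · rcases hn with rfl | rfl | rfl
      · exact Or.inl ⟨rfl, ha⟩
      · exact Or.inr (Or.inl ⟨rfl, ha⟩)
      · exact Or.inr (Or.inr (Or.inl ⟨rfl, ha⟩))
    · exact Or.inr (Or.inr (Or.inr (ih hm)))

/-- The two slacks of a relation form one digit in base four, never 3 because one of them vanishes.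
A valid identity equates two sums of nonnegative slacks, so the support meets both sets or neither,
which is what `balanced` tests. The identities stored with a relation involve only its slacks and
earlier ones, so later digits cannot affect the test. -/
theorem digits_mem_enumerate {rs : List CodedRel} {x : ℕ → ℝ} (hx : Tropical rs x) {b : ℕ → Bool}
    (hb : ∀ j, b j = true ↔ 0 < slackVal rs x j) (T : List (List (ℕ × ℕ))) (k : ℕ) (L : List ℕ)
    (hL : digits b (2 * k) ∈ L) (hT : validTable rs (2 * k) T = true) :
    digits b (2 * (k + T.length)) ∈ enumerate T (2 ^ (2 * k)) L := by
  obtain ⟨h1, h2⟩ := tropical_iff.1 hx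
  induction T generalizing k L with
  | nil => simpa [enumerate] using hL
  | cons cs T ih =>
    rw [validTable, Bool.and_eq_true, List.all_eq_true] at hT
    rw [enumerate, List.length_cons, ← add_assoc, add_right_comm]
    have e : Nat.mul 4 (2 ^ (2 * k)) = 2 ^ (2 * (k + 1)) := by
      change 4 * 2 ^ (2 * k) = _
      rw [mul_add, pow_add]; ring
    rw [e]
    refine ih (k + 1) _ (mem_extend hL ?_ (balanced_iff.2 fun c hc => ?_)) hT.2
    · rw [show 2 * (k + 1) = 2 * k + 1 + 1 by ring, digits, digits]
      have : b (2 * k) = false ∨ b (2 * k + 1) = false := by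
        rw [← Bool.not_eq_true, ← Bool.not_eq_true, hb, hb]
        rcases h2 k with h | h <;> simp [h]
      rcases this with h | h
      · cases h' : b (2 * k + 1) <;> simp [h, pow_succ']
      · cases h' : b (2 * k) <;> simp [h]
    · have hv := hT.1 c hc
      have hs := validIdentity.sum_eq hv x
      rw [validIdentity, Bool.and_eq_true, Bool.and_eq_true, Nat.blt_eq, Nat.blt_eq] at hv
      rw [show 2 * (k + 1) = 2 * k + 2 by ring, land_digits_eq_zero_iff h1 hb hv.1.1,
        land_digits_eq_zero_iff h1 hb hv.1.2, hs]

/-- The support of a tropical point is among the enumerated numbers. -/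
theorem Tropical.support_mem {rs : List CodedRel} {T : List (List (ℕ × ℕ))}
    (hT : validTable rs 0 T = true) (hl : T.length = rs.length) {x : ℕ → ℝ}
    (hx : Tropical rs x) : support rs x ∈ enumerate T 1 [0] := by
  classical
  have := digits_mem_enumerate hx (b := fun j => decide (0 < slackVal rs x j)) (by simp) T 0 [0]
    (by simp [digits]) hT
  rw [zero_add, hl] at this
  exact this

/-! ### Points with a given support -/

/-- The vector whose entries are the multiplicities in a list. -/
def countVec (l : List ℕ) (n : ℕ) : ℝ := (l.count n : ℝ)

/-- The sum of the multiplicities of a pair of codes. -/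
def pairCount (l : List ℕ) (p : ℕ × ℕ) : ℕ := l.count p.1 + l.count p.2

/-- The support of the vector of multiplicities in a list. -/
def countSupport (rs : List CodedRel) (l : List ℕ) : ℕ :=
  digits (fun j => Nat.blt (pairCount l (slack rs j).2) (pairCount l (slack rs j).1))
    (2 * rs.length)

/-- The slacks of the vector of multiplicities in a list are nonnegative. -/
def countNonneg (rs : List CodedRel) (l : List ℕ) : Bool :=
  (List.range (2 * rs.length)).all fun j =>
    Nat.ble (pairCount l (slack rs j).2) (pairCount l (slack rs j).1)

theorem pairVal_countVec (l : List ℕ) (p : ℕ × ℕ) : pairVal (countVec l) p = pairCount l p := by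
  simp [pairVal, countVec, pairCount]

theorem slackVal_countVec (rs : List CodedRel) (l : List ℕ) (j : ℕ) :
    slackVal rs (countVec l) j = pairCount l (slack rs j).1 - pairCount l (slack rs j).2 := by
  rw [slackVal, pairVal_countVec, pairVal_countVec]

theorem countNonneg.slackVal_nonneg {rs : List CodedRel} {l : List ℕ}
    (h : countNonneg rs l = true) (j : ℕ) : 0 ≤ slackVal rs (countVec l) j := by
  by_cases hj : j < 2 * rs.length
  · rw [countNonneg, List.all_eq_true] at h
    have := h j (List.mem_range.2 hj)
    rw [slackVal_countVec, sub_nonneg]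
    exact_mod_cast Nat.le_of_ble_eq_true this
  · rw [slackVal_of_le (not_lt.1 hj)]

theorem testBit_countSupport {rs : List CodedRel} {l : List ℕ} {j : ℕ} :
    (countSupport rs l).testBit j = true ↔ 0 < slackVal rs (countVec l) j := by
  rw [countSupport, testBit_digits]
  by_cases hj : j < 2 * rs.length
  · simp only [hj, decide_true, Bool.true_and, slackVal_countVec, sub_pos, Nat.cast_lt]
    rw [Nat.blt_eq]
  · simp [hj, slackVal_of_le (not_lt.1 hj)]

/-- The sum of the vectors of multiplicities. -/
theorem slackVal_countVec_flatten {rs : List CodedRel} {R : List (List ℕ)}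
    (hR : ∀ l ∈ R, countNonneg rs l = true) (j : ℕ) :
    0 ≤ slackVal rs (countVec R.flatten) j ∧ (0 < slackVal rs (countVec R.flatten) j ↔
      ((R.map (countSupport rs)).foldr (· ||| ·) 0).testBit j = true) := by
  induction R with
  | nil => simp [slackVal, pairVal, countVec]
  | cons l R ih =>
    obtain ⟨h1, h2⟩ := ih fun l' hl' => hR l' (List.mem_cons_of_mem _ hl')
    have h3 := countNonneg.slackVal_nonneg (hR l List.mem_cons_self) j
    -- Concatenating lists adds the vectors of multiplicities; as all slacks are nonnegative,
    -- supports of sums are unions.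
    have h4 : countVec (l :: R).flatten = countVec l + countVec R.flatten := by
      ext n; simp [countVec]
    rw [h4, slackVal_add, List.map_cons, List.foldr_cons, Nat.testBit_or, Bool.or_eq_true, ← h2,
      testBit_countSupport]
    refine ⟨add_nonneg h3 h1, fun h => ?_, fun h => ?_⟩
    · by_contra hc
      push Not at hc
      linarith
    · rcases h with h | h <;> linarith

/-- Containment of sets coded by binary digits. -/
def subBits (m n : ℕ) : Bool := Nat.beq (Nat.land m n) m

theorem subBits_iff {m n : ℕ} : subBits m n = true ↔
    ∀ j, m.testBit j = true → n.testBit j = true := by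
  rw [subBits, Nat.beq_eq]
  change m &&& n = m ↔ _
  constructor
  · intro h j hj
    rw [← h, Nat.testBit_and, Bool.and_eq_true] at hj
    exact hj.2
  · intro h
    refine Nat.eq_of_testBit_eq fun j => ?_
    rw [Nat.testBit_and]
    cases hm : m.testBit j
    · simp
    · simp [h j hm]

/-- The union of the members of a list that are contained in `S`. -/
noncomputable def unionBelow (R : List ℕ) (S : ℕ) : ℕ :=
  List.rec 0 (fun m _ ih => bif subBits m S then Nat.lor m ih else ih) R

theorem unionBelow_eq (R : List ℕ) (S : ℕ) :
    unionBelow R S = (R.filter fun m => subBits m S).foldr (· ||| ·) 0 := by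
  induction R with
  | nil => rfl
  | cons m R ih =>
    rw [List.filter_cons]
    change (bif subBits m S then m ||| unionBelow R S else unionBelow R S) = _
    cases h : subBits m S <;> simp [ih]

/-- No two slacks of the same relation are in `S`, where the digits of `M` are the positions of the
first slacks of all relations. -/
def isCompatible (M S : ℕ) : Bool :=
  Nat.beq (Nat.land (Nat.land S (Nat.shiftRight S 1)) M) 0

theorem isCompatible.testBit_eq_false {M S r : ℕ} (h : isCompatible M S = true)
    (hM : M.testBit (2 * r) = true) (h0 : S.testBit (2 * r) = true) :
    S.testBit (2 * r + 1) = false := by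
  rw [isCompatible, Nat.beq_eq] at h
  change S &&& (S >>> 1) &&& M = 0 at h
  have := congrArg (fun n => n.testBit (2 * r)) h
  simpa [Nat.testBit_and, hM, h0, Nat.testBit_shiftRight, add_comm 1] using this

/-- The sum of the rays with support inside `S` has nonnegative slacks and support `S`. That it is
tropical needs one vanishing slack in each relation, which `isCompatible` supplies. This is the
converse to the enumeration, whose conditions are only necessary. -/
theorem exists_tropical {rs : List CodedRel} {rays : List (List ℕ)}
    (hr : (rays.all (countNonneg rs)) = true) {S : ℕ}
    (h₁ : unionBelow (rays.map (countSupport rs)) S = S)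
    {M : ℕ} (hM : ∀ r < rs.length, M.testBit (2 * r) = true) (h₂ : isCompatible M S = true) :
    ∃ x, Tropical rs x ∧ support rs x = S := by
  rw [unionBelow_eq, List.filter_map] at h₁
  rw [List.all_eq_true] at hr
  set R := rays.filter ((fun m => subBits m S) ∘ countSupport rs)
  have hR : ∀ l ∈ R, countNonneg rs l = true := fun l hl => hr l (List.mem_filter.1 hl).1
  have key := fun j => slackVal_countVec_flatten hR j
  rw [h₁] at key
  refine ⟨countVec R.flatten, tropical_iff.2 ⟨fun j => (key j).1, fun r => ?_⟩, ?_⟩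
  · by_contra hc
    push Not at hc
    have a := (key (2 * r)).2.1 (lt_of_le_of_ne (key _).1 (Ne.symm hc.1))
    have b := (key (2 * r + 1)).2.1 (lt_of_le_of_ne (key _).1 (Ne.symm hc.2))
    by_cases hrl : r < rs.length
    · rw [isCompatible.testBit_eq_false h₂ (hM r hrl) a] at b
      exact absurd b (by simp)
    · exact hc.1 (slackVal_of_le (by omega) _)
  · refine Nat.eq_of_testBit_eq fun j => ?_
    rw [Bool.eq_iff_iff, testBit_support, (key j).2]

end Chirotropical

namespace Chirotropical

/-! ### Evaluation of lists of numbers -/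

/-- Evaluates the argument of a function before the function is applied. -/
noncomputable def forceNat {α : Type*} (n : ℕ) (f : ℕ → α) : α :=
  Nat.rec (f 0) (fun m _ => f (Nat.succ m)) n

/-- Evaluates a list of numbers before a function is applied to it. -/
noncomputable def forceList {α : Type*} (L : List ℕ) (f : List ℕ → α) : α :=
  List.rec (motive := fun _ => (List ℕ → α) → α) (fun f => f [])
    (fun m _ ih f => forceNat m fun m' => ih fun L' => f (m' :: L')) L f

theorem forceNat_eq {α : Type*} (n : ℕ) (f : ℕ → α) : forceNat n f = f n := by
  cases n <;> rfl

theorem forceList_eq {α : Type*} (L : List ℕ) (f : List ℕ → α) : forceList L f = f L := by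
  induction L generalizing f with
  | nil => rfl
  | cons m L ih =>
    change forceNat m (fun m' => forceList L fun L' => f (m' :: L')) = _
    rw [forceNat_eq, ih]

/-! ### Reconstruction of all coordinates from few of them -/

/-- A step in the reconstruction of a matrix from some of its minors: either a new column `f` is
determined by the minors `ijf`, `ikf`, `lmf`, or a minor is computed from a three-term relation. -/
inductive Step : Type
  | place (f i j k l m : Fin 6) : Step
  | derive (r n : ℕ) : Step

/-- The codes of the minors that are known in addition after a step. -/
def Step.newCodes : Step → List ℕ
  | .place f i j k l m => [code3 i j f, code3 i k f, code3 l m f]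
  | .derive _ n => [n]

/-- The codes of the minors that can be chosen in a step. -/
def Step.freeCodes : Step → List ℕ
  | .place f i j k l m => [code3 i j f, code3 i k f, code3 l m f]
  | .derive _ _ => []

/-- The codes of all triples. -/
def allCodes : List ℕ :=
  [7, 11, 19, 35, 13, 21, 37, 25, 41, 49, 14, 22, 38, 26, 42, 50, 28, 44, 52, 56]

theorem code3_mem_allCodes : ∀ i j k : Fin 6, i ≠ j → i ≠ k → j ≠ k →
    code3 i j k ∈ allCodes := by
  decide +kernel

/-- Membership in a list of numbers. -/
def elem (n : ℕ) (K : List ℕ) : Bool := K.any (Nat.beq n)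

theorem elem_iff {n : ℕ} {K : List ℕ} : elem n K = true ↔ n ∈ K := by
  simp [elem]

/-- Both codes of a pair are in the list. -/
def bothKnown (K : List ℕ) (p : ℕ × ℕ) : Bool := elem p.1 K && elem p.2 K

/-- One of the codes of a pair is `n` and the other is in the list. -/
def otherKnown (K : List ℕ) (n : ℕ) (p : ℕ × ℕ) : Bool :=
  (Nat.beq p.1 n && elem p.2 K) || (Nat.beq p.2 n && elem p.1 K)

/-- The step is possible if the minors with codes in `K` are known and the slacks in `req` are
positive. -/
def Step.isValid (rs : List CodedRel) (req : ℕ) (K : List ℕ) : Step → Bool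
  | .place f i j k l m => (decide (i ≠ j) && decide (i ≠ k) && decide (j ≠ k) && decide (i ≠ l) &&
      decide (i ≠ m) && decide (l ≠ m)) && (K.all fun n => !digit n f) &&
      elem (code3 i j k) K && elem (code3 i l m) K
  | .derive r n => match rs[r]? with
    | none => false
    | some ρ => (otherKnown K n ρ.1 && bothKnown K ρ.2.1 && bothKnown K ρ.2.2) ||
        (digit req (2 * r + 1) && otherKnown K n ρ.2.1 && bothKnown K ρ.1 && bothKnown K ρ.2.2) ||
        (digit req (2 * r) && otherKnown K n ρ.2.2 && bothKnown K ρ.1 && bothKnown K ρ.2.1)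

/-- The steps are possible and make all minors known. -/
def isProgram (rs : List CodedRel) (req : ℕ) : List Step → List ℕ → Bool
  | [], K => allCodes.all fun n => elem n K
  | s :: l, K => s.isValid rs req K && isProgram rs req l (s.newCodes ++ K)

/-! ### The combinatorial check -/

/-- The number of members of a list that are contained in `S`, but at most four. -/
noncomputable def rankBelow (R : List ℕ) (S : ℕ) : ℕ :=
  forceNat (List.rec 0 (fun m _ ih => bif subBits m S then Nat.succ ih else ih) R) fun c =>
    bif Nat.ble c 4 then c else 4

/-- The members of a list that have rank `d`. -/
noncomputable def layer (R L : List ℕ) (d : ℕ) : List ℕ :=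
  L.filter fun S => Nat.beq (rankBelow R S) d

/-- Every member of `L` is contained in a member of `L'`, and every member of `L'` contains a member
of `L`. -/
def linked (L L' : List ℕ) : Bool :=
  (L.all fun S => L'.any fun S' => subBits S S') && (L'.all fun S' => L.any fun S => subBits S S')

/-- The members of a list are distinct. -/
def distinct : List ℕ → Bool
  | [] => true
  | n :: L => (L.all fun m => !Nat.beq n m) && distinct L

/-- The properties of the enumerated supports that determine the structure of the fan. -/
structure IsGraded (rs : List CodedRel) (progs : List (ℕ × List Step)) (f : Fin 4 → ℕ)
    (R L : List ℕ) : Prop where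
  spanned : ∀ S ∈ L, unionBelow R S = S
  compatible : ∀ S ∈ L, isCompatible 384307168202282325 S = true
  up : ∀ d < 4, ∀ S ∈ layer R L d, ∃ S' ∈ layer R L (d + 1), subBits S S' = true
  down : ∀ d < 4, ∀ S' ∈ layer R L (d + 1), ∃ S ∈ layer R L d, subBits S S' = true
  nodup : ∀ d : Fin 4, (layer R L (d + 1)).Nodup
  length_eq : ∀ d : Fin 4, (layer R L (d + 1)).length = f d
  exists_prog : ∀ S ∈ layer R L 4, ∃ P ∈ progs, subBits P.1 S = true

/-- A computation which verifies the properties of the enumerated supports. -/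
noncomputable def gradedCheck (rs : List CodedRel) (T : List (List (ℕ × ℕ)))
    (rays : List (List ℕ)) (progs : List (ℕ × List Step)) (f : Fin 4 → ℕ) : Bool :=
  forceList (rays.map (countSupport rs)) fun R => forceList (enumerate T 1 [0]) fun L =>
    (L.all fun S => Nat.beq (unionBelow R S) S && isCompatible 384307168202282325 S) &&
    forceList (layer R L 0) fun L₀ => forceList (layer R L 1) fun L₁ =>
    forceList (layer R L 2) fun L₂ => forceList (layer R L 3) fun L₃ =>
    forceList (layer R L 4) fun L₄ =>
      (linked L₀ L₁ && linked L₁ L₂ && linked L₂ L₃ && linked L₃ L₄) &&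
      (distinct L₁ && distinct L₂ && distinct L₃ && distinct L₄) &&
      (Nat.beq L₁.length (f 0) && Nat.beq L₂.length (f 1) && Nat.beq L₃.length (f 2) &&
        Nat.beq L₄.length (f 3)) &&
      L₄.all fun S => progs.any fun P => subBits P.1 S

theorem nodup_of_distinct {L : List ℕ} (h : distinct L = true) : L.Nodup := by
  induction L with
  | nil => exact List.nodup_nil
  | cons n L ih =>
    rw [distinct, Bool.and_eq_true, List.all_eq_true] at h
    refine List.nodup_cons.2 ⟨fun hn => ?_, ih h.2⟩
    have := h.1 n hn
    simp at this

theorem linked_iff {L L' : List ℕ} : linked L L' = true ↔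
    (∀ S ∈ L, ∃ S' ∈ L', subBits S S' = true) ∧ ∀ S' ∈ L', ∃ S ∈ L, subBits S S' = true := by
  simp only [linked, Bool.and_eq_true, List.all_eq_true, List.any_eq_true]

theorem isGraded_of_gradedCheck {rs : List CodedRel} {T : List (List (ℕ × ℕ))}
    {rays : List (List ℕ)} {progs : List (ℕ × List Step)} {f : Fin 4 → ℕ}
    (h : gradedCheck rs T rays progs f = true) :
    IsGraded rs progs f (rays.map (countSupport rs)) (enumerate T 1 [0]) := by
  rw [gradedCheck] at h
  simp only [forceList_eq, Bool.and_eq_true, linked_iff, Nat.beq_eq, List.all_eq_true,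
    List.any_eq_true] at h
  obtain ⟨h1, ⟨⟨⟨⟨⟨l0, l1⟩, l2⟩, l3⟩, ⟨⟨d1, d2⟩, d3⟩, d4⟩, ⟨⟨f1, f2⟩, f3⟩, f4⟩, hp⟩ := h
  refine ⟨fun S hS => (h1 S hS).1, fun S hS => (h1 S hS).2, fun d hd => ?_, fun d hd => ?_,
    fun d => ?_, fun d => ?_, hp⟩
  · interval_cases d
    exacts [l0.1, l1.1, l2.1, l3.1]
  · interval_cases d
    exacts [l0.2, l1.2, l2.2, l3.2]
  · fin_cases d
    exacts [nodup_of_distinct d1, nodup_of_distinct d2, nodup_of_distinct d3, nodup_of_distinct d4]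
  · fin_cases d
    exacts [f1, f2, f3, f4]

end Chirotropical

namespace Chirotropical

/-! ### The four representatives -/

/-- The code of the set of negative signs of each representative. -/
def negCode : Fin 4 → ℕ := ![1691048883519488, 76561193665298432, 72057594037927936, 0]

/-- The coded three-term relations of each representative. -/
def relations : Fin 4 → List CodedRel :=
  ![
      [((11, 21), (7, 25), (19, 13)), ((35, 13), (7, 41), (11, 37)), ((35, 21), (7, 49), (19,
      37)), ((11, 49), (19, 41), (35, 25)), ((13, 49), (21, 41), (37, 25)), ((11, 22), (7,
      26), (19, 14)), ((11, 38), (7, 42), (35, 14)), ((35, 22), (7, 50), (19, 38)), ((35, 26),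
      (11, 50), (19, 42)), ((38, 26), (14, 50), (22, 42)), ((13, 22), (7, 28), (21, 14)),
      ((13, 38), (7, 44), (37, 14)), ((21, 38), (7, 52), (37, 22)), ((21, 44), (13, 52), (37,
      28)), ((22, 44), (14, 52), (38, 28)), ((13, 26), (11, 28), (25, 14)), ((11, 44), (13,
      42), (41, 14)), ((11, 56), (25, 42), (41, 26)), ((13, 56), (25, 44), (41, 28)), ((26,
      44), (14, 56), (42, 28)), ((21, 26), (19, 28), (25, 22)), ((49, 22), (19, 52), (21,
      50)), ((49, 26), (19, 56), (25, 50)), ((21, 56), (25, 52), (49, 28)), ((22, 56), (26,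
      52), (50, 28)), ((35, 44), (37, 42), (41, 38)), ((49, 38), (35, 52), (37, 50)), ((35,
      56), (41, 50), (49, 42)), ((49, 44), (37, 56), (41, 52)), ((38, 56), (42, 52), (50,
      44))],
      [((11, 21), (7, 25), (19, 13)), ((11, 37), (7, 41), (35, 13)), ((19, 37), (7, 49), (35,
      21)), ((19, 41), (11, 49), (35, 25)), ((21, 41), (13, 49), (37, 25)), ((11, 22), (7,
      26), (19, 14)), ((11, 38), (7, 42), (35, 14)), ((19, 38), (7, 50), (35, 22)), ((19, 42),
      (11, 50), (35, 26)), ((22, 42), (14, 50), (38, 26)), ((13, 22), (7, 28), (21, 14)),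
      ((13, 38), (7, 44), (37, 14)), ((37, 22), (7, 52), (21, 38)), ((37, 28), (13, 52), (21,
      44)), ((38, 28), (14, 52), (22, 44)), ((13, 26), (11, 28), (25, 14)), ((13, 42), (11,
      44), (41, 14)), ((41, 26), (11, 56), (25, 42)), ((41, 28), (13, 56), (25, 44)), ((42,
      28), (14, 56), (26, 44)), ((21, 26), (19, 28), (25, 22)), ((49, 22), (19, 52), (21,
      50)), ((49, 26), (19, 56), (25, 50)), ((21, 56), (25, 52), (49, 28)), ((22, 56), (26,
      52), (50, 28)), ((37, 42), (35, 44), (41, 38)), ((49, 38), (35, 52), (37, 50)), ((49,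
      42), (35, 56), (41, 50)), ((37, 56), (41, 52), (49, 44)), ((38, 56), (42, 52), (50,
      44))],
      [((11, 21), (7, 25), (19, 13)), ((11, 37), (7, 41), (35, 13)), ((19, 37), (7, 49), (35,
      21)), ((19, 41), (11, 49), (35, 25)), ((21, 41), (13, 49), (37, 25)), ((11, 22), (7,
      26), (19, 14)), ((11, 38), (7, 42), (35, 14)), ((19, 38), (7, 50), (35, 22)), ((19, 42),
      (11, 50), (35, 26)), ((22, 42), (14, 50), (38, 26)), ((13, 22), (7, 28), (21, 14)),
      ((13, 38), (7, 44), (37, 14)), ((21, 38), (7, 52), (37, 22)), ((21, 44), (13, 52), (37,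
      28)), ((22, 44), (14, 52), (38, 28)), ((13, 26), (11, 28), (25, 14)), ((13, 42), (11,
      44), (41, 14)), ((41, 26), (11, 56), (25, 42)), ((41, 28), (13, 56), (25, 44)), ((42,
      28), (14, 56), (26, 44)), ((21, 26), (19, 28), (25, 22)), ((21, 50), (19, 52), (49,
      22)), ((49, 26), (19, 56), (25, 50)), ((49, 28), (21, 56), (25, 52)), ((50, 28), (22,
      56), (26, 52)), ((37, 42), (35, 44), (41, 38)), ((37, 50), (35, 52), (49, 38)), ((49,
      42), (35, 56), (41, 50)), ((49, 44), (37, 56), (41, 52)), ((50, 44), (38, 56), (42,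
      52))],
      [((11, 21), (7, 25), (19, 13)), ((11, 37), (7, 41), (35, 13)), ((19, 37), (7, 49), (35,
      21)), ((19, 41), (11, 49), (35, 25)), ((21, 41), (13, 49), (37, 25)), ((11, 22), (7,
      26), (19, 14)), ((11, 38), (7, 42), (35, 14)), ((19, 38), (7, 50), (35, 22)), ((19, 42),
      (11, 50), (35, 26)), ((22, 42), (14, 50), (38, 26)), ((13, 22), (7, 28), (21, 14)),
      ((13, 38), (7, 44), (37, 14)), ((21, 38), (7, 52), (37, 22)), ((21, 44), (13, 52), (37,
      28)), ((22, 44), (14, 52), (38, 28)), ((13, 26), (11, 28), (25, 14)), ((13, 42), (11,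
      44), (41, 14)), ((25, 42), (11, 56), (41, 26)), ((25, 44), (13, 56), (41, 28)), ((26,
      44), (14, 56), (42, 28)), ((21, 26), (19, 28), (25, 22)), ((21, 50), (19, 52), (49,
      22)), ((25, 50), (19, 56), (49, 26)), ((25, 52), (21, 56), (49, 28)), ((26, 52), (22,
      56), (50, 28)), ((37, 42), (35, 44), (41, 38)), ((37, 50), (35, 52), (49, 38)), ((41,
      50), (35, 56), (49, 42)), ((41, 52), (37, 56), (49, 44)), ((42, 52), (38, 56), (50,
      44))]]

/-- Identities between sums of slacks, given by the sets of positions of both sides. -/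
def identities : Fin 4 → List (List (ℕ × ℕ)) :=
  ![
      [[], [], [(32, 10)], [(1, 144)], [(4, 272), (258, 64), (512, 136)], [], [], [(2048,
      40960)], [(66560, 16384)], [(262144, 73728), (4096, 525312), (557056, 131072)], [(2048,
      2097154)], [(8388608, 8200)], [(32, 33587200), (8388608, 35651584)], [(16777216,
      71303168)], [(69206016, 268435456), (1048576, 541065216), (134217728, 570425344)],
      [(1073742848, 1048576), (2097153, 2147484672)], [(4096, 4299161600), (537395200,
      5368709120), (8196, 8594128896)], [], [(17179869184, 73014444032), (35433480192,
      137438953472)], [(2147483648, 343597383680), (8589934592, 309237645312), (5368709120,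
      549755813888)], [(1099511627776, 1073741826), (2147483648, 2199025352704)], [(16809984,
      4398046511120), (8796093022224, 16384)], [(64, 17626545782784), (65664, 35184372088832),
      (10995116277760, 35184372088832)], [(70368744177664, 68786585600), (1099511627776,
      158329674399744), (140737488355584, 137438953472)], [(70368744177664, 283673999966208),
      (281749854617600, 268435456), (562949953421312, 149533581377536)], [(4294967304,
      1125899906842624)], [(4503599627403264, 4398046511104), (8796126576640,
      9007199254740992)], [(18014398509481984, 34359803904), (17179869184, 36028797018964096),
      (36046389205008384, 131072)], [(1125899906842624, 108086391056891904), (67109120,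
      144115188075855872), (6755399441055744, 144115188075855872)], [(281474977234944,
      288230376151711744), (40532396646334464, 288230376151711744), (562949953421312,
      576460752840294400), (576461027181330432, 262144), (578712552117108736,
      18014398509481984), (648518346341351424, 9007199254740992)]],
      [[], [], [(8, 34)], [(16, 68)], [(66, 256), (516, 1), (544, 128)], [], [], [(34816,
      8192)], [(69632, 16384)], [(262144, 67584), (1024, 528384), (557056, 131072)], [(2048,
      2097154)], [(8388616, 8192)], [(32, 33587200), (2097152, 41943040)], [(16777216,
      68157440), (37748736, 135266304)], [(75497472, 268435456), (134217728, 570425344),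
      (537919488, 4194304)], [(1073742848, 1048576), (2097153, 2147484672)], [(4294971392,
      4194304), (2147614720, 8589934720), (8589938688, 8388612)], [(42949672960, 2147483648)],
      [(17179869184, 69793218560), (134218240, 137438953472)], [(77309411328, 274877906944),
      (550829555712, 4294967296), (584115552256, 137438953472)], [(1099511627776, 1073741826),
      (2147483648, 2199025352704), (2199023256576, 1)], [(16777216, 4398046511120),
      (8796093022224, 33570816)], [(17179869184, 17592186044480), (10995116277760,
      35184372088832)], [(6597069766656, 87960930222080), (140806207832064, 256)],
      [(299067162755072, 4398046511104), (562949953421312, 149533581377536)], [(4294967304,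
      1125899906842624), (8589934592, 2251799822073856)], [(4398046543872, 4503599627370496),
      (9007199288295424, 8796093022208)], [(17592186175488, 18014398509481984), (65536,
      36028797018964032), (11258999068426240, 36028797018963968), (36028831378702336,
      35184372088832)], [(67108864, 72057662757404672), (70368744177664, 72057594037928448),
      (1125899906842624, 162129586585337856), (144115188075855872, 140737622573056)],
      [(72057594037927936, 290482175965396992), (288230376152236032, 281474976710656),
      (153122387330596864, 576460752303423488)]],
      [[], [], [(8, 34)], [(16, 68)], [(66, 256), (516, 1), (544, 128)], [], [], [(34816,
      8192)], [(69632, 16384)], [(262144, 67584), (1024, 528384), (557056, 131072)], [(2048,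
      2097154)], [(8388616, 8192)], [(32768, 33554464), (8388608, 35651584)], [(16777216,
      71303168), (34603008, 138412032)], [(69206016, 268435456), (134217728, 570425344)],
      [(1073742848, 1048576), (2097153, 2147484672)], [(4294971392, 4194304), (1074266112,
      4831838208), (8589938688, 8388612)], [(34359869440, 128), (42949672960, 2147483648)],
      [(17179869184, 69793218560), (512, 137573171200)], [(77309411328, 274877906944),
      (550829555712, 4294967296), (584115552256, 137438953472)], [(1099511627776, 1073741826),
      (2147483648, 2199025352704), (2199023256576, 1)], [(4398046527488, 16777216)],
      [(17179869184, 17592186044480), (2199023255552, 43980465111040)], [(71468255805440,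
      17592186044416), (39582418599936, 141836999983104)], [(79164837199872, 281474976710656),
      (281474976972800, 274877906944), (140737488355328, 598134325510144), (564049465049088,
      4398046511104)], [(4294967304, 1125899906842624)], [(4398046511136, 4503599627370496),
      (9007199254757376, 16), (9007199288295424, 8796093022208)], [(17592186175488,
      18014398509481984), (65536, 36028797018964032), (36028831378702336, 35184372088832),
      (45035996273704960, 2251799813685248)], [(73183493944770560, 18014398509481984)],
      [(81064793292668928, 288230376151711744), (288230376151711744, 281475513581568),
      (562949953421312, 576461302059237376), (576460752303685632, 268435456),
      (612489549322387456, 144115188075855872)]],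
      [[], [], [(8, 34)], [(16, 68)], [(66, 256), (516, 1), (544, 128)], [], [], [(34816,
      8192)], [(69632, 16384)], [(262144, 67584), (1024, 528384), (557056, 131072)], [(2048,
      2097154)], [(8388616, 8192)], [(32768, 33554464), (8388608, 35651584)], [(16777216,
      71303168), (34603008, 138412032)], [(69206016, 268435456), (1048576, 541065216),
      (134217728, 570425344)], [(1073742848, 1048576)], [(4294971392, 4194304), (1074266112,
      4831838208), (8589938688, 8388612), (2147614720, 8589934720)], [(8589934592,
      36507222016)], [(17179869184, 73014444032), (134217728, 137438953984)], [(70866960384,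
      274877906944), (549756338176, 536870912), (584115552256, 137438953472)],
      [(1099511627776, 1073741826), (2147483648, 2199025352704), (2199023256576, 1)],
      [(4398046576640, 4362076160)], [(17179869184, 17592186109952), (4466765987840,
      17592253153280), (37383395344384, 8796093022208), (35184372154368, 34359738432)],
      [(74766790688768, 17592186044416)], [(72567767433216, 281474976710656),
      (281475245146112, 274877906944), (1099511627776, 567347999932416), (140737488355328,
      598134325510144)], [(4294967304, 1125899906842624)], [(4398046511136, 4503599627370496),
      (9007199254757376, 16), (9007199288295424, 8796093022208)], [(17592186044544,
      18014398509481984), (9007199254740992, 38280596832649216)], [(76561193665298432,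
      18014398509481984), (144115188142964736, 256), (144115325514809344, 140737488355328)],
      [(281474977234944, 288230376151711744), (74309393851613184, 288230376151711744),
      (562949953421312, 576461302059237376), (1125899906842624, 580964351930793984),
      (612489549322387456, 144115188075855872)]]]

/-- Generators of the rays of the Dressian, as lists of codes with multiplicities. -/
def rayLists : Fin 4 → List (List ℕ) :=
  ![
      [[7], [19], [37], [25], [41], [14], [42], [50], [28], [52], [7, 19, 21, 22, 28, 52], [7,
      35, 37, 38, 42, 50], [25, 41, 49, 50, 52, 56], [11, 19, 25, 14, 26, 42], [13, 37, 41,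
      14, 28, 44]],
      [[7], [35], [25], [14], [50], [44], [52], [7, 11, 13, 14], [19, 35, 49, 50], [28, 44,
      52, 56], [7, 11, 13, 14, 28, 44], [7, 35, 37, 38, 44, 52], [19, 35, 49, 50, 52, 56],
      [25, 41, 49, 50, 52, 56], [13, 21, 25, 14, 28, 44]],
      [[7], [35], [25], [14], [52], [56], [7, 11, 13, 14], [7, 35, 37, 38], [25, 41, 49, 56],
      [28, 44, 52, 56], [7, 35, 37, 38, 44, 52], [19, 35, 49, 50, 52, 56], [25, 41, 49, 50,
      52, 56], [7, 35, 37, 14, 22, 38]],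
      [[7], [35], [49], [14], [28], [56], [7, 11, 13, 14], [7, 35, 37, 38], [19, 35, 49, 50],
      [25, 41, 49, 56], [14, 22, 26, 28], [28, 44, 52, 56], [7, 11, 13, 14, 28, 44], [19, 35,
      49, 50, 52, 56], [7, 35, 37, 14, 22, 38], [25, 41, 49, 26, 28, 56]]]

/-- Ways to reconstruct all coordinates from ten of them, each for the supports that contain a
given one. -/
def programs : Fin 4 → List (ℕ × List Step) :=
  ![
      [(134348800, [.place 3 0 1 2 1 2, .place 4 3 0 2 0 1, .derive 0 21, .derive 10 22,
      .derive 15 26, .place 5 3 0 1 0 2, .derive 1 35, .derive 3 49, .derive 6 38, .derive 16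
      44, .derive 17 56, .derive 8 50, .derive 13 52]), (4398113619968, [.place 3 0 1 2 1 2,
      .place 4 3 0 2 0 1, .derive 0 21, .derive 10 22, .derive 15 26, .place 5 3 0 1 2 4,
      .derive 16 44, .derive 17 56, .derive 13 37, .derive 1 35, .derive 3 49, .derive 6 38,
      .derive 21 50]), (8796093087744, [.place 3 0 1 2 1 2, .place 5 3 0 1 0 2, .derive 1 35,
      .derive 6 38, .derive 16 44, .place 4 3 2 0 1 5, .derive 15 26, .derive 17 56, .derive 8
      19, .derive 0 21, .derive 3 49, .derive 5 22, .derive 21 52])],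
      [(0, [.place 3 0 1 2 1 2, .place 5 3 0 2 0 1, .derive 1 37, .derive 11 38, .derive 16
      42, .place 4 5 1 2 0 3, .derive 26 49, .derive 28 56, .derive 3 19, .derive 4 21,
      .derive 12 22, .derive 13 28, .derive 15 26])],
      [(0, [.place 3 0 1 2 1 2, .place 4 3 0 2 0 1, .derive 0 21, .derive 10 22, .derive 15
      26, .place 5 4 2 3 0 1, .derive 23 49, .derive 24 50, .derive 2 37, .derive 3 41,
      .derive 7 38, .derive 8 42, .derive 13 44])],
      [(0, [.place 3 0 1 2 1 2, .place 4 3 0 2 0 1, .derive 0 21, .derive 10 22, .derive 15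
      26, .place 5 4 0 3 0 1, .derive 2 37, .derive 3 41, .derive 17 42, .derive 18 44,
      .derive 22 50, .derive 23 52, .derive 6 38])]]

/-- The tables are certificates: they enter the proof only through finite evaluations such as this
one. -/
theorem map_codedRel_quints : ∀ i, quints.map (codedRel (negCode i)) = relations i := by
  decide +kernel

theorem validTable_identities : ∀ i, validTable (relations i) 0 (identities i) = true := by
  decide +kernel

theorem length_identities : ∀ i, (identities i).length = (relations i).length := by
  decide +kernel

theorem countNonneg_rayLists : ∀ i, ((rayLists i).all (countNonneg (relations i))) = true := by
  decide +kernel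

theorem isProgram_programs : ∀ i, ∀ P ∈ programs i, isProgram (relations i) P.1 P.2 [7] = true ∧
    (P.2.flatMap Step.freeCodes).length = 9 := by
  decide +kernel

theorem gradedCheck_eq_true : ∀ i, gradedCheck (relations i) (identities i) (rayLists i)
    (programs i) (fVectors i) = true := by
  decide +kernel

/-- The mask is (4 ^ 30 - 1) / 3, with a digit 1 at the position of the first slack of each of the
thirty relations. -/
theorem testBit_mask : ∀ r < 30, (384307168202282325 : ℕ).testBit (2 * r) = true := by
  decide +kernel

theorem isGraded (i : Fin 4) : IsGraded (relations i) (programs i) (fVectors i)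
    ((rayLists i).map (countSupport (relations i))) (enumerate (identities i) 1 [0]) :=
  isGraded_of_gradedCheck (gradedCheck_eq_true i)

end Chirotropical

namespace Chirotropical

/-! ### Combinatorial structure of the fan -/

theorem slack_mem_allCodes : ∀ i, ∀ ρ ∈ relations i, ρ.1.1 ∈ allCodes ∧ ρ.1.2 ∈ allCodes ∧
    ρ.2.1.1 ∈ allCodes ∧ ρ.2.1.2 ∈ allCodes ∧ ρ.2.2.1 ∈ allCodes ∧ ρ.2.2.2 ∈ allCodes := by
  decide +kernel

theorem length_relations : ∀ i, (relations i).length = 30 := by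
  decide +kernel

theorem encode_decode : ∀ n ∈ allCodes, encode (decode n).1 = n := by
  decide +kernel

theorem encode_mem_allCodes (I : KSubset 3 6) : encode I.1 ∈ allCodes := by
  obtain ⟨i, j, k, hij, hjk, rfl⟩ := exists_eq_tr I
  rw [encode_tr i j k hij.ne (hij.trans hjk).ne hjk.ne]
  exact code3_mem_allCodes i j k hij.ne (hij.trans hjk).ne hjk.ne

/-- Slacks involve only codes of triples, so a function on ℕ can be replaced by the coded form of a
vector. -/
theorem slackVal_congr {i : Fin 4} {x y : ℕ → ℝ} (h : ∀ n ∈ allCodes, x n = y n) (j : ℕ) :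
    slackVal (relations i) x j = slackVal (relations i) y j := by
  rcases Nat.even_or_odd' j with ⟨r, rfl | rfl⟩ <;> cases hr : (relations i)[r]? with
  | none =>
    have := List.getElem?_eq_none_iff.1 hr
    rw [slackVal_of_le (by omega), slackVal_of_le (by omega)]
  | some ρ =>
    obtain ⟨h1, h2, h3, h4, h5, h6⟩ := slack_mem_allCodes i ρ (List.mem_of_getElem? hr)
    first
    | rw [slackVal_even hr, slackVal_even hr]
    | rw [slackVal_odd hr, slackVal_odd hr]
    simp only [pairVal, h _ h1, h _ h2, h _ h3, h _ h4, h _ h5, h _ h6]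

theorem support_congr {rs : List CodedRel} {x y : ℕ → ℝ}
    (h : ∀ j, slackVal rs x j = slackVal rs y j) : support rs x = support rs y := by
  refine Nat.eq_of_testBit_eq fun j => ?_
  rw [Bool.eq_iff_iff, testBit_support, testBit_support, h]

/-! ### Cones in the coordinates of a representative -/

/-- The isomorphism `P` of coordinate spaces identifies the chirotropical Dressian of `χ` with the
one of the `i`-th representative. -/
structure IsModel (i : Fin 4) (χ : SignVector 3 6)
    (P : (KSubset 3 6 → ℝ) ≃ₗ[ℝ] (KSubset 3 6 → ℝ)) : Prop where
  isChirotope : IsChirotope χ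
  mem_iff : ∀ x, x ∈ chiDressian χ ↔ Tropical (relations i) (coded (P x))
  cone_iff : ∀ w ∈ chiDressian χ, ∀ x ∈ chiDressian χ, x ∈ dressianCone w ↔
    ∀ j, slackVal (relations i) (coded (P w)) j = 0 → slackVal (relations i) (coded (P x)) j = 0
  liftable : ∀ x, Liftable (representative i) (P x) → Liftable χ x

namespace IsModel

variable {i : Fin 4} {χ : SignVector 3 6} {P : (KSubset 3 6 → ℝ) ≃ₗ[ℝ] (KSubset 3 6 → ℝ)}

/-- A slack as a linear form. -/
def slackForm (i : Fin 4) (P : (KSubset 3 6 → ℝ) ≃ₗ[ℝ] (KSubset 3 6 → ℝ)) (j : ℕ) :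
    (KSubset 3 6 → ℝ) →ₗ[ℝ] ℝ where
  toFun x := slackVal (relations i) (coded (P x)) j
  map_add' x y := by
    rw [map_add, ← slackVal_add]; rfl
  map_smul' c x := by
    rw [map_smul, RingHom.id_apply, smul_eq_mul, ← slackVal_smul]; rfl

/-- The slacks of both points are nonnegative, so inclusion of zero sets is reverse inclusion of
supports. -/
theorem mem_dressianCone_iff (h : IsModel i χ P) {w x : KSubset 3 6 → ℝ} (hw : w ∈ chiDressian χ)
    (hx : x ∈ chiDressian χ) : x ∈ dressianCone w ↔
      subBits (support (relations i) (coded (P x)))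
        (support (relations i) (coded (P w))) = true := by
  rw [h.cone_iff w hw x hx, subBits_iff]
  have h1 := (tropical_iff.1 ((h.mem_iff w).1 hw)).1
  have h2 := (tropical_iff.1 ((h.mem_iff x).1 hx)).1
  refine forall_congr' fun j => ?_
  rw [testBit_support, testBit_support, ← not_imp_not, ← ne_eq, ← ne_eq, ← (h1 j).lt_iff_ne',
    ← (h2 j).lt_iff_ne']

theorem exists_support_eq (h : IsModel i χ P) {y : ℕ → ℝ} (hy : Tropical (relations i) y) :
    ∃ x ∈ chiDressian χ, support (relations i) (coded (P x)) = support (relations i) y := by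
  have e : ∀ n ∈ allCodes, coded (P (P.symm fun I => y (encode I.1))) n = y n := by
    intro n hn
    rw [LinearEquiv.apply_symm_apply, coded, encode_decode n hn]
  refine ⟨P.symm fun I => y (encode I.1), ?_, support_congr (slackVal_congr e)⟩
  rw [h.mem_iff, tropical_iff]
  simp only [slackVal_congr e]
  exact tropical_iff.1 hy

theorem slackForm_eq_zero (h : IsModel i χ P) {w : KSubset 3 6 → ℝ} (hw : w ∈ chiDressian χ)
    {j : ℕ} (hj : slackVal (relations i) (coded (P w)) j = 0) {x : KSubset 3 6 → ℝ}
    (hx : x ∈ Submodule.span ℝ (dressianCone w : Set (KSubset 3 6 → ℝ))) :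
    slackVal (relations i) (coded (P x)) j = 0 := by
  have : Submodule.span ℝ (dressianCone w : Set (KSubset 3 6 → ℝ)) ≤
      LinearMap.ker (slackForm i P j) := by
    rw [Submodule.span_le]
    intro x hx
    exact (h.cone_iff w hw x (mem_chiDressian_of_mem_dressianCone h.isChirotope hw hx)).1 hx j hj
  exact this hx

theorem lineality_le_span (w : KSubset 3 6 → ℝ) :
    lineality 3 6 ≤ Submodule.span ℝ (dressianCone w : Set (KSubset 3 6 → ℝ)) := by
  intro x hx
  rw [← lineal_dressianCone w] at hx
  exact Submodule.subset_span (PointedCone.mem_lineal.1 hx).1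

/-- A slack that vanishes at `w` but not at `w'` vanishes on the whole span of the cone of `w`, so
`w'` lies outside that span. Both spans contain the lineality space, so the strict inclusion
survives in the quotient. -/
theorem dimMod_lt_dimMod (h : IsModel i χ P) {w w' : KSubset 3 6 → ℝ} (hw : w ∈ chiDressian χ)
    (hw' : w' ∈ chiDressian χ)
    (hs : subBits (support (relations i) (coded (P w)))
      (support (relations i) (coded (P w'))) = true)
    (hne : support (relations i) (coded (P w)) ≠ support (relations i) (coded (P w'))) :
    dimMod (lineality 3 6) (dressianCone w) < dimMod (lineality 3 6) (dressianCone w') := by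
  have hle : dressianCone w ≤ dressianCone w' :=
    dressianCone_le_iff.2 ((h.mem_dressianCone_iff hw' hw).2 hs)
  have hle' := Submodule.span_mono (R := ℝ)
    (show (dressianCone w : Set (KSubset 3 6 → ℝ)) ⊆ dressianCone w' from hle)
  obtain ⟨j, hj, hj'⟩ : ∃ j, slackVal (relations i) (coded (P w)) j = 0 ∧
      slackVal (relations i) (coded (P w')) j ≠ 0 := by
    by_contra hc
    push Not at hc
    have := (h.mem_dressianCone_iff hw hw').1 ((h.cone_iff w hw w' hw').2 hc)
    rw [subBits_iff] at hs this
    refine hne (Nat.eq_of_testBit_eq fun j => ?_)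
    rw [Bool.eq_iff_iff]
    exact ⟨hs j, this j⟩
  refine Submodule.finrank_lt_finrank_of_lt (lt_of_le_of_ne (Submodule.map_mono hle') fun he => ?_)
  have he' := congrArg (Submodule.comap (lineality 3 6).mkQ) he
  rw [Submodule.comap_map_mkQ, Submodule.comap_map_mkQ, sup_eq_right.2 (lineality_le_span w),
    sup_eq_right.2 (lineality_le_span w')] at he'
  have : w' ∈ Submodule.span ℝ (dressianCone w : Set (KSubset 3 6 → ℝ)) :=
    he' ▸ Submodule.subset_span (self_mem_dressianCone w')
  exact hj' (h.slackForm_eq_zero hw hj this)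

end IsModel

theorem finrank_lineality : Module.finrank ℝ (lineality 3 6) = 6 := by
  rw [lineality, LinearMap.finrank_range_of_inj]
  · simp
  · rw [← LinearMap.ker_eq_bot, LinearMap.ker_eq_bot']
    intro x hx
    have key : ∀ i j k : Fin 6, i ≠ j → i ≠ k → j ≠ k → x i + x j + x k = 0 := by
      intro i j k hij hik hjk
      have := congrFun hx (tr i j k)
      simp only [LinearMap.pi_apply, LinearMap.sum_apply, LinearMap.proj_apply,
        Pi.zero_apply] at this
      rw [tr_val i j k hij hik hjk, Finset.sum_insert (by simp [hij, hik]),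
        Finset.sum_insert (by simp [hjk]), Finset.sum_singleton] at this
      linarith
    have h1 := key 0 1 2 (by decide) (by decide) (by decide)
    have h2 := key 0 1 3 (by decide) (by decide) (by decide)
    have h3 := key 0 1 4 (by decide) (by decide) (by decide)
    have h4 := key 0 1 5 (by decide) (by decide) (by decide)
    have h5 := key 0 2 3 (by decide) (by decide) (by decide)
    have h6 := key 1 2 3 (by decide) (by decide) (by decide)
    ext i
    rw [Pi.zero_apply]
    fin_cases i <;> simp only [Fin.zero_eta, Fin.mk_one, Fin.reduceFinMk] <;> linarith

theorem dimMod_add_finrank {V : Type*} [AddCommGroup V] [Module ℝ V] [FiniteDimensional ℝ V]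
    {L : Submodule ℝ V} {C : PointedCone ℝ V} (h : L ≤ Submodule.span ℝ (C : Set V)) :
    dimMod L C + Module.finrank ℝ L = Module.finrank ℝ (Submodule.span ℝ (C : Set V)) := by
  have := LinearMap.finrank_range_add_finrank_ker
    (L.mkQ.domRestrict (Submodule.span ℝ (C : Set V)))
  rw [LinearMap.range_domRestrict, LinearMap.ker_domRestrict, Submodule.ker_mkQ] at this
  rw [← this, dimMod]
  congr 1
  exact (Submodule.comapSubtypeEquivOfLe h).finrank_eq.symm

/-! ### Dimensions of the maximal cones -/

theorem pairVal_eq_zero_of_bothKnown {K : List ℕ} {x : ℕ → ℝ} (hK : ∀ n ∈ K, x n = 0) {p : ℕ × ℕ}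
    (h : bothKnown K p = true) : pairVal x p = 0 := by
  rw [bothKnown, Bool.and_eq_true, elem_iff, elem_iff] at h
  rw [pairVal, hK _ h.1, hK _ h.2, add_zero]

theorem eq_zero_of_otherKnown {K : List ℕ} {x : ℕ → ℝ} (hK : ∀ n ∈ K, x n = 0) {n : ℕ} {p : ℕ × ℕ}
    (h : otherKnown K n p = true) (h0 : pairVal x p = 0) : x n = 0 := by
  rw [otherKnown, Bool.or_eq_true, Bool.and_eq_true, Bool.and_eq_true, elem_iff, elem_iff,
    Nat.beq_eq, Nat.beq_eq] at h
  rw [pairVal] at h0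
  rcases h with ⟨rfl, h⟩ | ⟨rfl, h⟩
  · rwa [hK _ h, add_zero] at h0
  · rwa [hK _ h, zero_add] at h0

/-- A vector which vanishes at the free coordinates of a program and satisfies the equations of a
cone vanishes. -/
theorem eq_zero_of_isProgram {rs : List CodedRel} {w x : ℕ → ℝ} (hw : Tropical rs w) {req : ℕ}
    (hreq : subBits req (support rs w) = true)
    (hx : ∀ j, slackVal rs w j = 0 → slackVal rs x j = 0) {l : List Step} {K : List ℕ}
    (hl : isProgram rs req l K = true) (hK : ∀ n ∈ K, x n = 0)
    (hfree : ∀ n ∈ l.flatMap Step.freeCodes, x n = 0) : ∀ n ∈ allCodes, x n = 0 := by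
  obtain ⟨-, hw⟩ := tropical_iff.1 hw
  induction l generalizing K with
  | nil =>
    rw [isProgram, List.all_eq_true] at hl
    exact fun n hn => hK n (elem_iff.1 (hl n hn))
  | cons s l ih =>
    rw [isProgram, Bool.and_eq_true] at hl
    rw [List.flatMap_cons] at hfree
    refine ih hl.2 (fun n hn => ?_) fun n hn => hfree n (List.mem_append_right _ hn)
    rcases List.mem_append.1 hn with hn | hn
    swap
    · exact hK n hn
    cases s with
    | place f i j k l m => exact hfree n (List.mem_append_left _ hn)
    | derive r n' =>
      obtain rfl := List.mem_singleton.1 hn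
      have hs := hl.1
      rw [Step.isValid] at hs
      cases hr : rs[r]? with
      | none => simp [hr] at hs
      | some ρ =>
        have hp : slackVal rs w (2 * r) = 0 → pairVal x ρ.2.1 = pairVal x ρ.1 := fun h => by
          rw [← sub_eq_zero, ← slackVal_even hr]; exact hx _ h
        have hq : slackVal rs w (2 * r + 1) = 0 → pairVal x ρ.2.2 = pairVal x ρ.1 := fun h => by
          rw [← sub_eq_zero, ← slackVal_odd hr]; exact hx _ h
        have hpos : ∀ j, digit req j = true → slackVal rs w j ≠ 0 := fun j hj => by
          rw [digit_eq_testBit] at hj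
          exact (testBit_support.1 (subBits_iff.1 hreq j hj)).ne'
        simp only [hr, Bool.or_eq_true, Bool.and_eq_true] at hs
        -- If the new coordinate is in the odd monomial, a tie with either of the other monomials
        -- determines it. Otherwise the positive slack required of one monomial forces the tie to be
        -- with the monomial that contains the new coordinate.
        rcases hs with (⟨⟨h1, h2⟩, h3⟩ | ⟨⟨⟨h1, h2⟩, h3⟩, h4⟩) | ⟨⟨⟨h1, h2⟩, h3⟩, h4⟩
        · refine eq_zero_of_otherKnown hK h1 ?_
          rcases hw r with h | h
          · rw [← hp h]; exact pairVal_eq_zero_of_bothKnown hK h2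
          · rw [← hq h]; exact pairVal_eq_zero_of_bothKnown hK h3
        · refine eq_zero_of_otherKnown hK h2 ?_
          rw [hp ((hw r).resolve_right (hpos _ h1))]; exact pairVal_eq_zero_of_bothKnown hK h3
        · refine eq_zero_of_otherKnown hK h2 ?_
          rw [hq ((hw r).resolve_left (hpos _ h1))]; exact pairVal_eq_zero_of_bothKnown hK h3

namespace IsModel

variable {i : Fin 4} {χ : SignVector 3 6} {P : (KSubset 3 6 → ℝ) ≃ₗ[ℝ] (KSubset 3 6 → ℝ)}

/-- The nine free coordinates of a program, together with the coordinate 012 of code 7, determine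
every vector in the span of the cone. So the span has dimension at most 10, of which 6 belong to the
lineality space. -/
theorem dimMod_le_four (h : IsModel i χ P) {w : KSubset 3 6 → ℝ} (hw : w ∈ chiDressian χ)
    {Q : ℕ × List Step} (hQ : Q ∈ programs i)
    (hs : subBits Q.1 (support (relations i) (coded (P w))) = true) :
    dimMod (lineality 3 6) (dressianCone w) ≤ 4 := by
  obtain ⟨h1, h2⟩ := isProgram_programs i Q hQ
  have h3 := dimMod_add_finrank (lineality_le_span w)
  rw [finrank_lineality] at h3
  suffices Module.finrank ℝ (Submodule.span ℝ (dressianCone w : Set (KSubset 3 6 → ℝ))) ≤ 10 by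
    omega
  set l := 7 :: Q.2.flatMap Step.freeCodes with hl
  let φ : (KSubset 3 6 → ℝ) →ₗ[ℝ] (Fin l.length → ℝ) :=
    LinearMap.pi fun a => (LinearMap.proj (decode (l.get a))).comp P.toLinearMap
  have hinj : Function.Injective
      (φ.domRestrict (Submodule.span ℝ (dressianCone w : Set (KSubset 3 6 → ℝ)))) := by
    rw [← LinearMap.ker_eq_bot, LinearMap.ker_eq_bot']
    rintro ⟨x, hx⟩ h0
    have h0' : ∀ n ∈ l, coded (P x) n = 0 := by
      intro n hn
      obtain ⟨a, rfl⟩ := List.get_of_mem hn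
      exact congrFun h0 a
    have := eq_zero_of_isProgram ((h.mem_iff w).1 hw) hs
      (fun j hj => h.slackForm_eq_zero hw hj hx) h1
      (fun n hn => h0' n (by rw [List.mem_singleton.1 hn]; exact List.mem_cons_self))
      (fun n hn => h0' n (List.mem_cons_of_mem _ hn))
    have hP : P x = 0 := by
      ext I
      have := this _ (encode_mem_allCodes I)
      rwa [coded, decode_encode] at this
    exact Subtype.ext (P.map_eq_zero_iff.1 hP)
  have := LinearMap.finrank_le_finrank_of_injective hinj
  rw [Module.finrank_fin_fun, hl, List.length_cons, h2] at this
  exact this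

end IsModel

end Chirotropical

/-! ### Dimension as rank; purity, f-vector and equality with the Grassmannian -/

namespace Chirotropical
namespace IsModel

variable {i : Fin 4} {χ : SignVector 3 6} {P : (KSubset 3 6 → ℝ) ≃ₗ[ℝ] (KSubset 3 6 → ℝ)}

/-- The supports of the generators of the rays. -/
noncomputable abbrev raySupports (i : Fin 4) : List ℕ :=
  (rayLists i).map (countSupport (relations i))

/-- The supports of the points of the Dressian. -/
noncomputable abbrev supports (i : Fin 4) : List ℕ := enumerate (identities i) 1 [0]

/-- The support of a point in the coordinates of the representative. -/
noncomputable abbrev supp (i : Fin 4) (P : (KSubset 3 6 → ℝ) ≃ₗ[ℝ] (KSubset 3 6 → ℝ))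
    (x : KSubset 3 6 → ℝ) : ℕ := support (relations i) (coded (P x))

theorem mem_dressianCone_iff_supp (h : IsModel i χ P) {w x : KSubset 3 6 → ℝ}
    (hw : w ∈ chiDressian χ) (hx : x ∈ chiDressian χ) :
    x ∈ dressianCone w ↔ subBits (supp i P x) (supp i P w) = true :=
  h.mem_dressianCone_iff hw hx

theorem supp_mem (h : IsModel i χ P) {w : KSubset 3 6 → ℝ} (hw : w ∈ chiDressian χ) :
    supp i P w ∈ supports i :=
  Tropical.support_mem (validTable_identities i) (length_identities i) ((h.mem_iff w).1 hw)

theorem exists_supp_eq (h : IsModel i χ P) {S : ℕ} (hS : S ∈ supports i) :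
    ∃ w ∈ chiDressian χ, supp i P w = S := by
  obtain ⟨y, hy, hy'⟩ := exists_tropical (countNonneg_rayLists i) ((isGraded i).spanned S hS)
    (fun r hr => testBit_mask r (by rwa [length_relations] at hr)) ((isGraded i).compatible S hS)
  obtain ⟨w, hw, hw'⟩ := h.exists_support_eq hy
  exact ⟨w, hw, hw'.trans hy'⟩

theorem mem_layer {R L : List ℕ} {d S : ℕ} : S ∈ layer R L d ↔ S ∈ L ∧ rankBelow R S = d := by
  rw [layer, List.mem_filter, Nat.beq_eq]

theorem rankBelow_le (R : List ℕ) (S : ℕ) : rankBelow R S ≤ 4 := by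
  rw [rankBelow, forceNat_eq]
  generalize (List.rec 0 (fun m _ ih => bif subBits m S then Nat.succ ih else ih) R : ℕ) = c
  cases hc : Nat.ble c 4
  · exact le_rfl
  · exact Nat.le_of_ble_eq_true hc

theorem exists_up (h : IsModel i χ P) {w : KSubset 3 6 → ℝ} (hw : w ∈ chiDressian χ)
    (hr : rankBelow (raySupports i) (supp i P w) < 4) : ∃ w' ∈ chiDressian χ,
      rankBelow (raySupports i) (supp i P w') = rankBelow (raySupports i) (supp i P w) + 1 ∧
      subBits (supp i P w) (supp i P w') = true ∧
      dimMod (lineality 3 6) (dressianCone w) < dimMod (lineality 3 6) (dressianCone w') := by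
  obtain ⟨S, hS, hs⟩ := (isGraded i).up _ hr _ (mem_layer.2 ⟨h.supp_mem hw, rfl⟩)
  obtain ⟨hS, hr'⟩ := mem_layer.1 hS
  obtain ⟨w', hw', rfl⟩ := h.exists_supp_eq hS
  refine ⟨w', hw', hr', hs, h.dimMod_lt_dimMod hw hw' hs fun he => ?_⟩
  have he' : rankBelow (raySupports i) (supp i P w) = rankBelow (raySupports i) (supp i P w') :=
    congrArg _ he
  have hr'' : rankBelow (raySupports i) (supp i P w') =
    rankBelow (raySupports i) (supp i P w) + 1 := hr'
  omega

/-- Each step down through the layers to rank zero strictly lowers the dimension. -/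
theorem rankBelow_le_dimMod (h : IsModel i χ P) (d : ℕ) {w : KSubset 3 6 → ℝ}
    (hw : w ∈ chiDressian χ) (hr : rankBelow (raySupports i) (supp i P w) = d) :
    d ≤ dimMod (lineality 3 6) (dressianCone w) := by
  induction d generalizing w with
  | zero => exact Nat.zero_le _
  | succ d ih =>
    have hd : d < 4 := by have := rankBelow_le (raySupports i) (supp i P w); omega
    obtain ⟨S, hS, hs⟩ := (isGraded i).down d hd _ (mem_layer.2 ⟨h.supp_mem hw, hr⟩)
    obtain ⟨hS, hr'⟩ := mem_layer.1 hS
    obtain ⟨w', hw', rfl⟩ := h.exists_supp_eq hS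
    refine (ih hw' hr').trans_lt (h.dimMod_lt_dimMod hw' hw hs fun he => ?_)
    have he' : rankBelow (raySupports i) (supp i P w') = rankBelow (raySupports i) (supp i P w) :=
      congrArg _ he
    have hr'' : rankBelow (raySupports i) (supp i P w') = d := hr'
    omega

/-- Each step up through the layers strictly raises the dimension, and in rank four the programs
bound it by four. -/
theorem dimMod_le_rankBelow (h : IsModel i χ P) (d : ℕ) {w : KSubset 3 6 → ℝ}
    (hw : w ∈ chiDressian χ) (hr : rankBelow (raySupports i) (supp i P w) + d = 4) :
    dimMod (lineality 3 6) (dressianCone w) + d ≤ 4 := by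
  induction d generalizing w with
  | zero =>
    obtain ⟨Q, hQ, hs⟩ := (isGraded i).exists_prog _ (mem_layer.2 ⟨h.supp_mem hw, hr⟩)
    exact h.dimMod_le_four hw hQ hs
  | succ d ih =>
    obtain ⟨w', hw', hr', -, hlt⟩ := h.exists_up hw (by omega)
    have := ih hw' (by omega)
    omega

/-- Upper and lower bound meet. The cap in `rankBelow` leaves room for cones of dimension four with
more than four rays. -/
theorem dimMod_eq (h : IsModel i χ P) {w : KSubset 3 6 → ℝ} (hw : w ∈ chiDressian χ) :
    dimMod (lineality 3 6) (dressianCone w) = rankBelow (raySupports i) (supp i P w) := by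
  have h1 := h.rankBelow_le_dimMod _ hw rfl
  have h2 := rankBelow_le (raySupports i) (supp i P w)
  have h3 := h.dimMod_le_rankBelow (4 - rankBelow (raySupports i) (supp i P w)) hw (by omega)
  omega

/-- The fan is pure of dimension four modulo the lineality space. -/
theorem isPureOfDim (h : IsModel i χ P) : IsPureOfDim (lineality 3 6) (chiFan χ) 4 := by
  rintro _ ⟨⟨w, hw, rfl⟩, hmax⟩
  rw [h.dimMod_eq hw]
  by_contra hne
  have := rankBelow_le (raySupports i) (supp i P w)
  obtain ⟨w', hw', hr, hs, hlt⟩ := h.exists_up hw (by omega)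
  have hle : dressianCone w ≤ dressianCone w' :=
    dressianCone_le_iff.2 ((h.mem_dressianCone_iff hw' hw).2 hs)
  have heq : dressianCone w = dressianCone w' := le_antisymm hle (hmax ⟨w', hw', rfl⟩ hle)
  exact hlt.ne (congrArg _ heq)

/-- The numbers of cones of all dimensions. -/
theorem numCones_eq (h : IsModel i χ P) (d : Fin 4) :
    numCones (lineality 3 6) (chiFan χ) (d + 1) = fVectors i d := by
  classical
  -- Points with equal supports define equal cones, so one chosen point for each support gives a
  -- bijection from the layer of rank d + 1 to the cones of that dimension.
  choose! W hW hW' using fun (S : ℕ) (hS : S ∈ supports i) => h.exists_supp_eq hS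
  have hset : {C | C ∈ chiFan χ ∧ dimMod (lineality 3 6) C = d + 1} =
      (fun S => dressianCone (W S)) '' {S | S ∈ layer (raySupports i) (supports i) (d + 1)} := by
    ext C
    constructor
    · rintro ⟨⟨w, hw, rfl⟩, hd⟩
      have hm := h.supp_mem hw
      refine ⟨supp i P w, mem_layer.2 ⟨hm, by rw [← h.dimMod_eq hw, hd]⟩, ?_⟩
      refine le_antisymm (dressianCone_le_iff.2 ?_) (dressianCone_le_iff.2 ?_)
      · rw [h.mem_dressianCone_iff_supp hw (hW _ hm), hW' _ hm, subBits_iff]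
        exact fun _ => id
      · rw [h.mem_dressianCone_iff_supp (hW _ hm) hw, hW' _ hm, subBits_iff]
        exact fun _ => id
    · rintro ⟨S, hS, rfl⟩
      obtain ⟨hm, hr⟩ := mem_layer.1 hS
      exact ⟨⟨W S, hW S hm, rfl⟩, by rw [h.dimMod_eq (hW S hm), hW' S hm, hr]⟩
  have hinj : Set.InjOn (fun S => dressianCone (W S))
      {S | S ∈ layer (raySupports i) (supports i) (d + 1)} := by
    intro S hS S' hS' he
    replace hS := (mem_layer.1 hS).1
    replace hS' := (mem_layer.1 hS').1
    have h1 := dressianCone_le_iff.1 (le_of_eq he)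
    have h2 := dressianCone_le_iff.1 (ge_of_eq he)
    rw [h.mem_dressianCone_iff_supp (hW _ hS') (hW _ hS), hW' _ hS, hW' _ hS', subBits_iff] at h1
    rw [h.mem_dressianCone_iff_supp (hW _ hS) (hW _ hS'), hW' _ hS, hW' _ hS', subBits_iff] at h2
    refine Nat.eq_of_testBit_eq fun j => ?_
    rw [Bool.eq_iff_iff]
    exact ⟨h1 j, h2 j⟩
  rw [numCones, hset, hinj.ncard_image, ← (isGraded i).length_eq d,
    ← List.toFinset_card_of_nodup ((isGraded i).nodup d), ← Set.ncard_coe_finset]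
  congr 1
  ext S
  simp

theorem exists_rankBelow_eq_four (h : IsModel i χ P) (d : ℕ) {w : KSubset 3 6 → ℝ}
    (hw : w ∈ chiDressian χ) (hr : rankBelow (raySupports i) (supp i P w) + d = 4) :
    ∃ w' ∈ chiDressian χ, rankBelow (raySupports i) (supp i P w') = 4 ∧
      subBits (supp i P w) (supp i P w') = true := by
  induction d generalizing w with
  | zero => exact ⟨w, hw, hr, subBits_iff.2 fun _ => id⟩
  | succ d ih =>
    obtain ⟨w', hw', hr', hs, -⟩ := h.exists_up hw (by omega)
    obtain ⟨w'', hw'', hr'', hs'⟩ := ih hw' (by omega)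
    refine ⟨w'', hw'', hr'', subBits_iff.2 fun j hj => ?_⟩
    exact subBits_iff.1 hs' j (subBits_iff.1 hs j hj)

/-- If all points of the cones of dimension four can be lifted, then all points of the Dressian are
in the Grassmannian. -/
theorem chiDressian_eq_chiGrassmannian (h : IsModel i χ P)
    (hl : ∀ Q ∈ programs i, ∀ y : KSubset 3 6 → ℝ, Tropical (relations i) (coded y) →
      subBits Q.1 (support (relations i) (coded y)) = true → Liftable (representative i) y) :
    chiDressian χ = chiGrassmannian χ := by
  refine Set.Subset.antisymm (fun x hx => ?_) (chiGrassmannian_subset_chiDressian χ)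
  obtain ⟨w, hw, hr, hs⟩ := h.exists_rankBelow_eq_four
    (4 - rankBelow (raySupports i) (supp i P x)) hx
    (by have := rankBelow_le (raySupports i) (supp i P x); omega)
  -- The point `w` has rank four and `x` lies in its cone. The positive slacks of `x + ε • w`
  -- include those of `w`, so a program applies to it, and `x` is the limit of these liftable
  -- points.
  refine mem_chiGrassmannian_of_forall_add_smul (w := w) fun ε hε => ?_
  have hxw := (h.mem_dressianCone_iff hw hx).2 hs
  have hmem : x + ε • w ∈ dressianCone w :=
    add_mem hxw ((dressianCone w).smul_mem hε.le (self_mem_dressianCone w))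
  have hmem' := mem_chiDressian_of_mem_dressianCone h.isChirotope hw hmem
  obtain ⟨Q, hQ, hs'⟩ := (isGraded i).exists_prog _ (mem_layer.2 ⟨h.supp_mem hw, hr⟩)
  refine (h.liftable _ (hl Q hQ _ ((h.mem_iff _).1 hmem')
    (subBits_iff.2 fun j hj => ?_))).mem_chiGrassmannian
  have h1 := testBit_support.1 (subBits_iff.1 hs' j hj)
  have h2 := (tropical_iff.1 ((h.mem_iff x).1 hx)).1 j
  rw [testBit_support]
  have e : coded (P (x + ε • w)) = coded (P x) + ε • coded (P w) := by
    rw [map_add, map_smul]; rfl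
  rw [e, slackVal_add, slackVal_smul]
  have := mul_pos hε h1
  linarith

end IsModel
end Chirotropical

namespace Chirotropical

open Filter Topology

/-! ### Lifting of points with large support -/

theorem negCode_testBit : ∀ i, ∀ n ∈ allCodes,
    representative i (decode n) = bitSign ((negCode i).testBit n) := by
  decide +kernel

theorem hasCode_representative (i : Fin 4) : HasCode (representative i) (negCode i) := by
  intro I
  have := negCode_testBit i _ (encode_mem_allCodes I)
  rwa [decode_encode] at this

theorem exists_code3_eq : ∀ n ∈ allCodes, ∃ i j k : Fin 6, i ≠ j ∧ i ≠ k ∧ j ≠ k ∧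
    n = code3 i j k := by
  decide +kernel

theorem testBit_code3 : ∀ i j k f : Fin 6, i ≠ j → i ≠ k → j ≠ k →
    (code3 i j k).testBit f = (decide (f = i) || decide (f = j) || decide (f = k)) := by
  decide +kernel

/-- The minor with code `n`, multiplied by its sign in `χ`. -/
def signedMinor (χ : SignVector 3 6) (A : Matrix (Fin 3) (Fin 6) ℝ) (n : ℕ) : ℝ :=
  ((χ (decode n) : ℤ) : ℝ) * pluckerCoord A (decode n)

theorem units_cast_mul_self (u : ℤˣ) : ((u : ℤ) : ℝ) * ((u : ℤ) : ℝ) = 1 := by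
  rcases Int.units_eq_one_or u with rfl | rfl <;> simp

theorem signedMinor_code3 (χ : SignVector 3 6) (A : Matrix (Fin 3) (Fin 6) ℝ) {i j k : Fin 6}
    (hij : i ≠ j) (hik : i ≠ k) (hjk : j ≠ k) :
    signedMinor χ A (code3 i j k) = ((alt χ i j k : ℤ) : ℝ) * colDet A i j k := by
  rw [colDet_eq_sgn3_mul A hij hik hjk, alt, signedMinor]
  change ((χ (tr i j k) : ℤ) : ℝ) * pluckerCoord A (tr i j k) = _
  push_cast
  linear_combination (-((χ (tr i j k) : ℤ) : ℝ) * pluckerCoord A (tr i j k)) *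
    units_cast_mul_self (sgn3 i j k)

theorem alt_mul_self_mul (χ : SignVector 3 6) (i j k : Fin 6) (a : ℝ) :
    ((alt χ i j k : ℤ) : ℝ) * (((alt χ i j k : ℤ) : ℝ) * a) = a := by
  rw [← mul_assoc, units_cast_mul_self, one_mul]

/-- The three-term relations in terms of signed minors. -/
theorem signedMinor_relation {χ : SignVector 3 6} {neg : ℕ} (hneg : HasCode χ neg)
    (hχ : IsChirotope χ) (A : Matrix (Fin 3) (Fin 6) ℝ) {ρ : CodedRel}
    (hρ : ρ ∈ quints.map (codedRel neg)) :
    signedMinor χ A ρ.1.1 * signedMinor χ A ρ.1.2 =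
      signedMinor χ A ρ.2.1.1 * signedMinor χ A ρ.2.1.2 +
        signedMinor χ A ρ.2.2.1 * signedMinor χ A ρ.2.2.2 := by
  obtain ⟨⟨l, a, b, c, d⟩, hq, rfl⟩ := List.mem_map.1 hρ
  have hs := mem_quints.1 hq
  have hpl := colDet_plucker A l a b c d
  obtain ⟨⟨la, lb, lc, ld⟩, nab, nac, nad, nbc, nbd, ncd⟩ := hs.1
  have cast : ∀ {u v w z : ℤˣ}, u * v = w * z →
      ((u : ℤ) : ℝ) * ((v : ℤ) : ℝ) = ((w : ℤ) : ℝ) * ((z : ℤ) : ℝ) := by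
    intro u v w z h
    have := congrArg (fun u : ℤˣ => ((u : ℤ) : ℝ)) h
    simpa using this
  have cast' : ∀ {u v w z : ℤˣ}, u * v = -(w * z) →
      ((u : ℤ) : ℝ) * ((v : ℤ) : ℝ) = -(((w : ℤ) : ℝ) * ((z : ℤ) : ℝ)) := by
    intro u v w z h
    have := congrArg (fun u : ℤˣ => ((u : ℤ) : ℝ)) h
    simpa using this
  rcases codedRel_cases hneg hχ hs with ⟨h, -, -, e⟩ | ⟨h, -, -, e⟩ | ⟨h, -, -, e⟩ <;> rw [e] <;>
    simp only [signedMinor_code3 χ A la lb nab, signedMinor_code3 χ A lc ld ncd,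
      signedMinor_code3 χ A la lc nac, signedMinor_code3 χ A lb ld nbd,
      signedMinor_code3 χ A la ld nad, signedMinor_code3 χ A lb lc nbc]
  · have h1 := cast h.1
    have h2 := cast' h.2
    linear_combination colDet A l a c * colDet A l b d * h1 -
      colDet A l a d * colDet A l b c * h2 +
      ((alt χ l a b : ℤ) : ℝ) * ((alt χ l c d : ℤ) : ℝ) * hpl
  · have h1 := cast h.1
    have h2 := h.2
    rw [alt_swap_right χ l nbc, mul_neg, neg_neg] at h2
    have h2 := cast h2
    linear_combination colDet A l a b * colDet A l c d * h1 +
      colDet A l a d * colDet A l b c * h2 -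
      ((alt χ l a c : ℤ) : ℝ) * ((alt χ l b d : ℤ) : ℝ) * hpl
  · have h1 := h.1
    have h2 := h.2
    rw [alt_swap_right χ l ncd, mul_neg] at h1
    rw [alt_swap_right χ l nbd, mul_neg, neg_neg] at h2
    have h1 := cast' h1
    have h2 := cast h2
    linear_combination -colDet A l a b * colDet A l c d * h1 +
      colDet A l a c * colDet A l b d * h2 +
      ((alt χ l a d : ℤ) : ℝ) * ((alt χ l b c : ℤ) : ℝ) * hpl

/-- A column can be chosen such that three of its minors have given values. -/
theorem exists_column (A : Matrix (Fin 3) (Fin 6) ℝ) {f i j k l m : Fin 6} (hi : i ≠ f) (hj : j ≠ f)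
    (hk : k ≠ f) (hl : l ≠ f) (hm : m ≠ f) (α β γ : ℝ) :
    ∃ B : Matrix (Fin 3) (Fin 6) ℝ, (∀ a b c, a ≠ f → b ≠ f → c ≠ f →
      colDet B a b c = colDet A a b c) ∧ (colDet A i j k ≠ 0 → colDet A i l m ≠ 0 →
      colDet B i j f = α ∧ colDet B i k f = β ∧ colDet B l m f = γ) := by
  -- The new column is a combination of the columns k, j, i. The minor ijf sees only a, the minor
  -- ikf only b (with a sign), and c is then determined by the minor lmf, in which its coefficient
  -- is the minor ilm.
  let a : ℝ := α / colDet A i j k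
  let b : ℝ := -β / colDet A i j k
  let c : ℝ := (γ - a * colDet A l m k - b * colDet A l m j) / colDet A i l m
  refine ⟨Matrix.of fun r s => if s = f then a * A r k + b * A r j + c * A r i else A r s, ?_, ?_⟩
  · intro a b c ha hb hc
    simp only [colDet_eq, Matrix.of_apply, ha, hb, hc, if_false]
  · intro h1 h2
    have e1 : a * colDet A i j k = α := div_mul_cancel₀ _ h1
    have e2 : b * colDet A i j k = -β := div_mul_cancel₀ _ h1
    have e3 : c * colDet A i l m = γ - a * colDet A l m k - b * colDet A l m j :=
      div_mul_cancel₀ _ h2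
    generalize a = a at *
    generalize b = b at *
    generalize c = c at *
    simp only [colDet_eq, Matrix.of_apply, hi, hj, hk, hl, hm, if_false, if_true] at *
    refine ⟨?_, ?_, ?_⟩
    · linear_combination e1
    · linear_combination -e2
    · linear_combination e3

/-- The signed minors with codes in `K` have the leading exponents `e`. -/
def Lifts (χ : SignVector 3 6) (e : ℕ → ℝ) (K : List ℕ) (A : ℝ → Matrix (Fin 3) (Fin 6) ℝ) : Prop :=
  ∀ n ∈ K, n ∈ allCodes → Lead (fun t => signedMinor χ (A t) n) (e n)

/-- No known minor involves column `f`, so replacing this column preserves them. The new signed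
minors are made equal to t ^ e as soon as the minors ijk and ilm are nonzero, which holds for all
small t > 0. -/
theorem Lifts.place {χ : SignVector 3 6} {e : ℕ → ℝ} {K : List ℕ}
    {A : ℝ → Matrix (Fin 3) (Fin 6) ℝ} (h : Lifts χ e K A) {f i j k l m : Fin 6}
    (hij : i ≠ j) (hik : i ≠ k) (hjk : j ≠ k) (hil : i ≠ l) (him : i ≠ m) (hlm : l ≠ m)
    (hf : ∀ n ∈ K, n.testBit f = false) (h₁ : code3 i j k ∈ K) (h₂ : code3 i l m ∈ K) :
    ∃ B, Lifts χ e ([code3 i j f, code3 i k f, code3 l m f] ++ K) B := by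
  have t1 := hf _ h₁
  have t2 := hf _ h₂
  rw [testBit_code3 i j k f hij hik hjk] at t1
  rw [testBit_code3 i l m f hil him hlm] at t2
  simp only [Bool.or_eq_false_iff, decide_eq_false_iff_not] at t1 t2
  obtain ⟨⟨hi, hj⟩, hk⟩ := t1
  obtain ⟨⟨-, hl⟩, hm⟩ := t2
  choose B hB hB' using fun t : ℝ => exists_column (A t) (Ne.symm hi) (Ne.symm hj) (Ne.symm hk)
    (Ne.symm hl) (Ne.symm hm) (((alt χ i j f : ℤ) : ℝ) * t ^ e (code3 i j f))
    (((alt χ i k f : ℤ) : ℝ) * t ^ e (code3 i k f)) (((alt χ l m f : ℤ) : ℝ) * t ^ e (code3 l m f))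
  have hev : ∀ᶠ t in 𝓝[>] (0 : ℝ), colDet (A t) i j k ≠ 0 ∧ colDet (A t) i l m ≠ 0 := by
    filter_upwards [(h _ h₁ (code3_mem_allCodes _ _ _ hij hik hjk)).eventually_pos,
      (h _ h₂ (code3_mem_allCodes _ _ _ hil him hlm)).eventually_pos] with t p1 p2
    rw [signedMinor_code3 χ _ hij hik hjk] at p1
    rw [signedMinor_code3 χ _ hil him hlm] at p2
    exact ⟨right_ne_zero_of_mul p1.ne', right_ne_zero_of_mul p2.ne'⟩
  refine ⟨B, fun n hn hn' => ?_⟩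
  rcases List.mem_append.1 hn with hn | hn
  · simp only [List.mem_cons, List.not_mem_nil, or_false] at hn
    rcases hn with rfl | rfl | rfl
    · refine (lead_rpow _).congr ?_
      filter_upwards [hev] with t ht
      rw [signedMinor_code3 χ _ hij (Ne.symm hi) (Ne.symm hj), (hB' t ht.1 ht.2).1,
        alt_mul_self_mul]
    · refine (lead_rpow _).congr ?_
      filter_upwards [hev] with t ht
      rw [signedMinor_code3 χ _ hik (Ne.symm hi) (Ne.symm hk), (hB' t ht.1 ht.2).2.1,
        alt_mul_self_mul]
    · refine (lead_rpow _).congr ?_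
      filter_upwards [hev] with t ht
      rw [signedMinor_code3 χ _ hlm (Ne.symm hl) (Ne.symm hm), (hB' t ht.1 ht.2).2.2,
        alt_mul_self_mul]
  · obtain ⟨a, b, c, hab, hac, hbc, rfl⟩ := exists_code3_eq n hn'
    have t1 := hf _ hn
    rw [testBit_code3 a b c f hab hac hbc] at t1
    simp only [Bool.or_eq_false_iff, decide_eq_false_iff_not] at t1
    refine (h _ hn hn').congr (Eventually.of_forall fun t => ?_)
    simp only [signedMinor_code3 χ _ hab hac hbc]
    rw [hB t a b c (Ne.symm t1.1.1) (Ne.symm t1.1.2) (Ne.symm t1.2)]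

theorem Lifts.lead_mul {χ : SignVector 3 6} {e : ℕ → ℝ} {K : List ℕ}
    {A : ℝ → Matrix (Fin 3) (Fin 6) ℝ} (h : Lifts χ e K A) {p : ℕ × ℕ} (hp : bothKnown K p = true)
    (h₁ : p.1 ∈ allCodes) (h₂ : p.2 ∈ allCodes) :
    Lead (fun t => signedMinor χ (A t) p.1 * signedMinor χ (A t) p.2) (pairVal e p) := by
  rw [bothKnown, Bool.and_eq_true, elem_iff, elem_iff] at hp
  exact (h _ hp.1 h₁).mul (h _ hp.2 h₂)

theorem Lifts.lead_of_otherKnown {χ : SignVector 3 6} {e : ℕ → ℝ} {K : List ℕ}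
    {A : ℝ → Matrix (Fin 3) (Fin 6) ℝ} (h : Lifts χ e K A) {n : ℕ} {p : ℕ × ℕ}
    (hp : otherKnown K n p = true) (h₁ : p.1 ∈ allCodes) (h₂ : p.2 ∈ allCodes) {g : ℝ → ℝ}
    (hg : Lead g (pairVal e p))
    (hgp : ∀ t, signedMinor χ (A t) p.1 * signedMinor χ (A t) p.2 = g t) :
    Lead (fun t => signedMinor χ (A t) n) (e n) := by
  rw [otherKnown, Bool.or_eq_true, Bool.and_eq_true, Bool.and_eq_true, elem_iff, elem_iff,
    Nat.beq_eq, Nat.beq_eq] at hp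
  rcases hp with ⟨rfl, hp⟩ | ⟨rfl, hp⟩
  · exact Lead.of_mul (h _ hp h₂) hg (Eventually.of_forall hgp)
  · rw [pairVal, add_comm] at hg
    exact Lead.of_mul (h _ hp h₁) hg (Eventually.of_forall fun t => by rw [mul_comm, hgp])

/-- In signed minors, the odd product is the sum of the two other products. It thus has the minimal
exponent, and dividing by its known factor gives the new minor. A minor in another product comes
from a difference, whose exponent is controlled because the subtracted product has positive slack.
-/
theorem Lifts.derive {i : Fin 4} (hχ : IsChirotope (representative i)) {e : ℕ → ℝ}
    (he : Tropical (relations i) e) {req : ℕ}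
    (hreq : subBits req (support (relations i) e) = true) {K : List ℕ}
    {A : ℝ → Matrix (Fin 3) (Fin 6) ℝ} (h : Lifts (representative i) e K A) {r n : ℕ}
    (hs : (Step.derive r n).isValid (relations i) req K = true) :
    Lifts (representative i) e ([n] ++ K) A := by
  intro n' hn' ha
  rcases List.mem_append.1 hn' with hn' | hn'
  swap
  · exact h n' hn' ha
  obtain rfl := List.mem_singleton.1 hn'
  rw [Step.isValid] at hs
  cases hr : (relations i)[r]? with
  | none => simp [hr] at hs
  | some ρ =>
    have hmem := List.mem_of_getElem? hr
    obtain ⟨a1, a2, a3, a4, a5, a6⟩ := slack_mem_allCodes i ρ hmem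
    have hrel := fun t => signedMinor_relation (hasCode_representative i) hχ (A t)
      (ρ := ρ) (by rwa [map_codedRel_quints i])
    have hT := he ρ hmem
    rw [IsTropical] at hT
    have hz := (tropical_iff.1 he).2 r
    have hpos : ∀ j, digit req j = true → 0 < slackVal (relations i) e j := fun j hj => by
      rw [digit_eq_testBit] at hj
      exact testBit_support.1 (subBits_iff.1 hreq j hj)
    simp only [hr, Bool.or_eq_true, Bool.and_eq_true] at hs
    rcases hs with (⟨⟨h1, h2⟩, h3⟩ | ⟨⟨⟨h1, h2⟩, h3⟩, h4⟩) | ⟨⟨⟨h1, h2⟩, h3⟩, h4⟩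
    · refine h.lead_of_otherKnown h1 a1 a2 ?_ hrel
      rw [hT]
      exact (h.lead_mul h2 a3 a4).add (h.lead_mul h3 a5 a6)
    · have hp := hpos _ h1
      have hz := hz.resolve_right hp.ne'
      rw [slackVal_even hr, sub_eq_zero] at hz
      rw [slackVal_odd hr, sub_pos] at hp
      refine h.lead_of_otherKnown h2 a3 a4 (hz ▸ (h.lead_mul h3 a1 a2).sub_of_lt
        (h.lead_mul h4 a5 a6) hp) fun t => ?_
      rw [hrel]; ring
    · have hp := hpos _ h1
      have hz := hz.resolve_left hp.ne'
      rw [slackVal_odd hr, sub_eq_zero] at hz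
      rw [slackVal_even hr, sub_pos] at hp
      refine h.lead_of_otherKnown h2 a5 a6 (hz ▸ (h.lead_mul h3 a1 a2).sub_of_lt
        (h.lead_mul h4 a3 a4) hp) fun t => ?_
      rw [hrel]; ring

theorem Lifts.exists_of_isProgram {i : Fin 4} (hχ : IsChirotope (representative i)) {e : ℕ → ℝ}
    (he : Tropical (relations i) e) {req : ℕ}
    (hreq : subBits req (support (relations i) e) = true) {l : List Step} {K : List ℕ}
    (hl : isProgram (relations i) req l K = true) {A : ℝ → Matrix (Fin 3) (Fin 6) ℝ}
    (h : Lifts (representative i) e K A) : ∃ B, Lifts (representative i) e allCodes B := by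
  induction l generalizing K A with
  | nil =>
    rw [isProgram, List.all_eq_true] at hl
    exact ⟨A, fun n hn hn' => h n (elem_iff.1 (hl n hn)) hn'⟩
  | cons s l ih =>
    rw [isProgram, Bool.and_eq_true] at hl
    cases s with
    | place f i' j k l' m =>
      have hs := hl.1
      simp only [Step.isValid, Bool.and_eq_true, decide_eq_true_iff, elem_iff, List.all_eq_true,
        Bool.not_eq_true', digit_eq_testBit] at hs
      obtain ⟨⟨⟨⟨⟨⟨⟨⟨hij, hik⟩, hjk⟩, hil⟩, him⟩, hlm⟩, hf⟩, h₁⟩, h₂⟩ := hs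
      obtain ⟨B, hB⟩ := h.place hij hik hjk hil him hlm hf h₁ h₂
      exact ih hl.2 hB
    | derive r n => exact ih hl.2 (h.derive hχ he hreq hl.1)

/-- The points whose support contains the one required by a program can be lifted. -/
theorem liftable_of_mem_programs {i : Fin 4} (hχ : IsChirotope (representative i))
    {Q : ℕ × List Step} (hQ : Q ∈ programs i) {y : KSubset 3 6 → ℝ}
    (hy : Tropical (relations i) (coded y))
    (hs : subBits Q.1 (support (relations i) (coded y)) = true) :
    Liftable (representative i) y := by
  -- The initial family realizes only the minor 012 (code 7), by a diagonal block; the zero columns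
  -- are placeholders for columns not yet placed.
  have h0 : Lifts (representative i) (coded y) [7] fun t =>
      !![((alt (representative i) 0 1 2 : ℤ) : ℝ) * t ^ coded y 7, 0, 0, 0, 0, 0;
        0, 1, 0, 0, 0, 0; 0, 0, 1, 0, 0, 0] := by
    intro n hn _
    obtain rfl := List.mem_singleton.1 hn
    refine (lead_rpow _).congr (Eventually.of_forall fun t => ?_)
    change t ^ coded y 7 = signedMinor (representative i) _ (code3 0 1 2)
    rw [signedMinor_code3 _ _ (by decide) (by decide) (by decide), colDet_eq]
    simp [alt_mul_self_mul]
  obtain ⟨B, hB⟩ := h0.exists_of_isProgram hχ hy hs (isProgram_programs i Q hQ).1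
  refine ⟨B, fun I => ?_⟩
  have := hB _ (encode_mem_allCodes I) (encode_mem_allCodes I)
  simpa only [signedMinor, coded, decode_encode] using this

end Chirotropical

namespace Chirotropical

/-! ### Transport along isomorphisms of chirotopes -/

/-- The permutation of the coordinates induced by a permutation of the ground set. -/
def permCoord (σ : Equiv.Perm (Fin 6)) :
    (KSubset 3 6 → ℝ) ≃ₗ[ℝ] (KSubset 3 6 → ℝ) :=
  LinearEquiv.funCongrLeft ℝ ℝ
    { toFun := fun I => ⟨I.1.map σ.symm.toEmbedding, (Finset.card_map _).trans I.2⟩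
      invFun := fun I => ⟨I.1.map σ.toEmbedding, (Finset.card_map _).trans I.2⟩
      left_inv := fun I => Subtype.ext (by simp [Finset.map_map])
      right_inv := fun I => Subtype.ext (by simp [Finset.map_map]) }

theorem permCoord_tr (σ : Equiv.Perm (Fin 6)) (x : KSubset 3 6 → ℝ) {i j k : Fin 6} (hij : i ≠ j)
    (hik : i ≠ k) (hjk : j ≠ k) : permCoord σ x (tr (σ i) (σ j) (σ k)) = x (tr i j k) := by
  change x _ = x _
  congr 1
  apply Subtype.ext
  rw [tr_val i j k hij hik hjk]
  change (tr (σ i) (σ j) (σ k)).1.map σ.symm.toEmbedding = _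
  rw [tr_val _ _ _ (σ.injective.ne hij) (σ.injective.ne hik) (σ.injective.ne hjk)]
  simp

theorem forall_distinct5_perm (σ : Equiv.Perm (Fin 6))
    {p : Fin 6 → Fin 6 → Fin 6 → Fin 6 → Fin 6 → Prop} :
    (∀ l a b c d, Distinct5 l a b c d → p l a b c d) ↔
      ∀ l a b c d, Distinct5 l a b c d → p (σ l) (σ a) (σ b) (σ c) (σ d) := by
  refine ⟨fun h l a b c d hd => h _ _ _ _ _ (hd.map σ), fun h l a b c d hd => ?_⟩
  have := h _ _ _ _ _ (hd.map σ.symm)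
  simpa only [Equiv.apply_symm_apply] using this

section

variable {σ : Equiv.Perm (Fin 6)} {t : Fin 6 → ℤˣ} {χ χ' : SignVector 3 6}

theorem alt_of_eq (h : χ' = reorient t (relabel σ χ)) {i j k : Fin 6} (hij : i ≠ j) (hik : i ≠ k)
    (hjk : j ≠ k) : alt χ' i j k = t i * t j * t k * alt χ (σ i) (σ j) (σ k) := by
  rw [h, alt_reorient t _ hij hik hjk, alt_relabel σ χ hij hik hjk]

/-- Every term of a relation contains `l` twice and each of a, b, c, d once, so a reorientation
multiplies all three by the same sign and does not change which one is odd. -/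
theorem signs_factor (t : Fin 6 → ℤˣ) (l a b c d : Fin 6) :
    (∀ u v : ℤˣ, t l * t a * t b * u * (t l * t c * t d * v) =
      t l * t l * t a * t b * t c * t d * (u * v)) ∧
    (∀ u v : ℤˣ, t l * t a * t c * u * (t l * t b * t d * v) =
      t l * t l * t a * t b * t c * t d * (u * v)) ∧
    ∀ u v : ℤˣ, t l * t a * t d * u * (t l * t b * t c * v) =
      t l * t l * t a * t b * t c * t d * (u * v) := by
  refine ⟨fun u v => Units.ext ?_, fun u v => Units.ext ?_, fun u v => Units.ext ?_⟩ <;>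
    push_cast <;> ring

theorem odd_iff_of_eq (h : χ' = reorient t (relabel σ χ)) {l a b c d : Fin 6}
    (hd : Distinct5 l a b c d) : Odd χ' l a b c d ↔ Odd χ (σ l) (σ a) (σ b) (σ c) (σ d) := by
  obtain ⟨⟨la, lb, lc, ld⟩, nab, nac, nad, nbc, nbd, ncd⟩ := hd
  rw [Odd, Odd, alt_of_eq h la lb nab, alt_of_eq h lc ld ncd, alt_of_eq h la lc nac,
    alt_of_eq h lb ld nbd, alt_of_eq h la ld nad, alt_of_eq h lb lc nbc]
  obtain ⟨e0, e1, e2⟩ := signs_factor t l a b c d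
  rw [e0, e1, e2, ← mul_neg, mul_right_inj, mul_right_inj]

theorem tropEq_permCoord (x : KSubset 3 6 → ℝ) {l a b c d : Fin 6} (hd : Distinct5 l a b c d) :
    TropEq (permCoord σ x) (σ l) (σ a) (σ b) (σ c) (σ d) ↔ TropEq x l a b c d := by
  obtain ⟨⟨la, lb, lc, ld⟩, nab, nac, nad, nbc, nbd, ncd⟩ := hd
  rw [TropEq, TropEq, permCoord_tr σ x la lb nab, permCoord_tr σ x lc ld ncd,
    permCoord_tr σ x la lc nac, permCoord_tr σ x lb ld nbd, permCoord_tr σ x la ld nad,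
    permCoord_tr σ x lb lc nbc]

theorem dominates_permCoord (x : KSubset 3 6 → ℝ) {l a b c d : Fin 6} (hd : Distinct5 l a b c d) :
    Dominates (permCoord σ x) (σ l) (σ a) (σ b) (σ c) (σ d) ↔ Dominates x l a b c d := by
  obtain ⟨⟨la, lb, lc, ld⟩, nab, nac, nad, nbc, nbd, ncd⟩ := hd
  rw [Dominates, Dominates, permCoord_tr σ x la lb nab, permCoord_tr σ x lc ld ncd,
    permCoord_tr σ x la lc nac, permCoord_tr σ x lb ld nbd, permCoord_tr σ x la ld nad,
    permCoord_tr σ x lb lc nbc]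

theorem mem_chiDressian_permCoord (h : χ' = reorient t (relabel σ χ)) (hχ : IsChirotope χ)
    (hχ' : IsChirotope χ') (x : KSubset 3 6 → ℝ) :
    permCoord σ x ∈ chiDressian χ ↔ x ∈ chiDressian χ' := by
  rw [mem_chiDressian_iff hχ, mem_chiDressian_iff hχ', forall_distinct5_perm σ]
  refine forall₅_congr fun l a b c d => forall_congr' fun hd => ?_
  rw [odd_iff_of_eq h hd, tropEq_permCoord x hd]

theorem mem_dressianCone_permCoord (w x : KSubset 3 6 → ℝ) :
    permCoord σ x ∈ dressianCone (permCoord σ w) ↔ x ∈ dressianCone w := by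
  rw [mem_dressianCone_iff, mem_dressianCone_iff, forall_distinct5_perm σ]
  refine forall₅_congr fun l a b c d => forall_congr' fun hd => ?_
  rw [dominates_permCoord w hd, dominates_permCoord x hd]

theorem alt_mul_colDet (χ : SignVector 3 6) (A : Matrix (Fin 3) (Fin 6) ℝ) {i j k : Fin 6}
    (hij : i ≠ j) (hik : i ≠ k) (hjk : j ≠ k) :
    ((χ (tr i j k) : ℤ) : ℝ) * pluckerCoord A (tr i j k) =
      ((alt χ i j k : ℤ) : ℝ) * colDet A i j k :=
  signedMinor_code3 χ A hij hik hjk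

/-- The matrix obtained from `A` by relabeling and reorientation. -/
def transportMatrix (σ : Equiv.Perm (Fin 6)) (t : Fin 6 → ℤˣ) (A : Matrix (Fin 3) (Fin 6) ℝ) :
    Matrix (Fin 3) (Fin 6) ℝ :=
  Matrix.of fun r s => ((t s : ℤ) : ℝ) * A r (σ s)

theorem colDet_transportMatrix (A : Matrix (Fin 3) (Fin 6) ℝ) (i j k : Fin 6) :
    colDet (transportMatrix σ t A) i j k =
      ((t i * t j * t k : ℤˣ) : ℤ) * colDet A (σ i) (σ j) (σ k) := by
  simp only [colDet_eq, transportMatrix, Matrix.of_apply]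
  push_cast
  ring

theorem Liftable.of_permCoord (h : χ' = reorient t (relabel σ χ)) {x : KSubset 3 6 → ℝ}
    (hx : Liftable χ (permCoord σ x)) : Liftable χ' x := by
  obtain ⟨A, hA⟩ := hx
  refine ⟨fun s => transportMatrix σ t (A s), fun I => ?_⟩
  obtain ⟨i, j, k, h₁, h₂, rfl⟩ := exists_eq_tr I
  have hij := h₁.ne
  have hjk := h₂.ne
  have hik := (h₁.trans h₂).ne
  have := hA (tr (σ i) (σ j) (σ k))
  rw [permCoord_tr σ x hij hik hjk] at this
  refine this.congr (Filter.Eventually.of_forall fun s => ?_)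
  simp only [alt_mul_colDet _ _ hij hik hjk, alt_mul_colDet _ _ (σ.injective.ne hij)
    (σ.injective.ne hik) (σ.injective.ne hjk)]
  rw [alt_of_eq h hij hik hjk, colDet_transportMatrix]
  push_cast
  have e := units_cast_mul_self (t i * t j * t k)
  push_cast at e
  linear_combination (-((alt χ (σ i) (σ j) (σ k) : ℤ) : ℝ) * colDet (A s) (σ i) (σ j) (σ k)) * e

end

theorem forall_slackVal_iff {rs : List CodedRel} {w x : ℕ → ℝ} :
    (∀ j, slackVal rs w j = 0 → slackVal rs x j = 0) ↔ ∀ ρ ∈ rs,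
      (pairVal w ρ.2.1 - pairVal w ρ.1 = 0 → pairVal x ρ.2.1 - pairVal x ρ.1 = 0) ∧
      (pairVal w ρ.2.2 - pairVal w ρ.1 = 0 → pairVal x ρ.2.2 - pairVal x ρ.1 = 0) := by
  constructor
  · intro h ρ hρ
    obtain ⟨r, hr⟩ := List.getElem?_of_mem hρ
    have h0 := h (2 * r)
    have h1 := h (2 * r + 1)
    rw [slackVal_even hr, slackVal_even hr] at h0
    rw [slackVal_odd hr, slackVal_odd hr] at h1
    exact ⟨h0, h1⟩
  · intro h j
    rcases Nat.even_or_odd' j with ⟨r, rfl | rfl⟩ <;> cases hr : rs[r]? with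
    | none =>
      have := List.getElem?_eq_none_iff.1 hr
      rw [slackVal_of_le (by omega), slackVal_of_le (by omega)]
      exact id
    | some ρ =>
      have := h ρ (List.mem_of_getElem? hr)
      first
      | rw [slackVal_even hr, slackVal_even hr]; exact this.1
      | rw [slackVal_odd hr, slackVal_odd hr]; exact this.2

theorem isModel_of_eq {i : Fin 4} {σ : Equiv.Perm (Fin 6)} {t : Fin 6 → ℤˣ} {χ : SignVector 3 6}
    (h : χ = reorient t (relabel σ (representative i))) (hi : IsChirotope (representative i))
    (hχ : IsChirotope χ) : IsModel i χ (permCoord σ) where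
  isChirotope := hχ
  mem_iff x := by
    rw [← mem_chiDressian_permCoord h hi hχ, mem_chiDressian_iff_coded
      (hasCode_representative i) hi,
      map_codedRel_quints]
    rfl
  cone_iff w hw x hx := by
    rw [← mem_chiDressian_permCoord h hi hχ] at hw hx
    rw [← mem_dressianCone_permCoord (σ := σ), mem_dressianCone_iff_coded (hasCode_representative i)
      hi hw hx, map_codedRel_quints, forall_slackVal_iff]
  liftable x := Liftable.of_permCoord h

end Chirotropical

namespace Chirotropical

/-! ### Codes of chirotopes -/

/-- The binary digit of a sign. -/
def signBit (u : ℤˣ) : Bool := decide (u = -1)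

theorem signBit_mul (u v : ℤˣ) : signBit (u * v) = (signBit u ^^ signBit v) := by
  rcases Int.units_eq_one_or u with rfl | rfl <;> rcases Int.units_eq_one_or v with rfl | rfl <;>
    decide

theorem signBit_bitSign (b : Bool) : signBit (bitSign b) = b := by
  cases b <;> decide

theorem signBit_inj {u v : ℤˣ} : signBit u = signBit v ↔ u = v := by
  rcases Int.units_eq_one_or u with rfl | rfl <;> rcases Int.units_eq_one_or v with rfl | rfl <;>
    decide

/-- The set of the members of `K` with digit `1`, as binary digits. -/
def restrict (b : ℕ → Bool) (K : List ℕ) : ℕ :=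
  K.foldr (fun n m => bif b n then Nat.lor m (Nat.pow 2 n) else m) 0

theorem testBit_restrict (b : ℕ → Bool) (K : List ℕ) (n : ℕ) :
    (restrict b K).testBit n = (decide (n ∈ K) && b n) := by
  induction K with
  | nil => simp [restrict]
  | cons a K ih =>
    have e : restrict b (a :: K) = bif b a then restrict b K ||| 2 ^ a else restrict b K := rfl
    rw [e]
    by_cases h : n = a
    · subst h
      cases hb : b n <;> simp [ih, Nat.testBit_or, hb]
    · have h' : ¬a = n := fun h' => h h'.symm
      cases hb : b a <;> simp [ih, Nat.testBit_or, h, h']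

/-- The code of a sign vector: the set of its negative entries. -/
def signCode (χ : SignVector 3 6) : ℕ := restrict (fun n => signBit (χ (decode n))) allCodes

theorem testBit_signCode {χ : SignVector 3 6} {n : ℕ} (hn : n ∈ allCodes) :
    (signCode χ).testBit n = signBit (χ (decode n)) := by
  rw [signCode, testBit_restrict]; simp [hn]

theorem signCode_inj {χ χ' : SignVector 3 6} (h : signCode χ = signCode χ') : χ = χ' := by
  ext1 I
  have hI := encode_mem_allCodes I
  have := congrArg (fun m => m.testBit (encode I.1)) h
  simp only [testBit_signCode hI, decode_encode] at this
  exact signBit_inj.1 this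

theorem signCode_representative : ∀ i, signCode (representative i) = negCode i := by
  decide +kernel

theorem eq_signCode_of_testBit {χ : SignVector 3 6} {m : ℕ}
    (h : ∀ n, m.testBit n = (decide (n ∈ allCodes) && signBit (χ (decode n)))) :
    m = signCode χ :=
  Nat.eq_of_testBit_eq fun n => by rw [h, signCode, testBit_restrict]

/-! ### Reorientation -/

/-- The exclusive disjunction of two binary digits. -/
def pairDigit (m : ℕ) (p : ℕ × ℕ) : Bool := digit m p.1 ^^ digit m p.2

/-- The signs of the reorientation which makes the six entries `012`, `123`, `124`, `125`, `023`,
`013` positive. -/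
def normalBit (m : ℕ) : ℕ → Bool
  | 0 => digit m 7 ^^ digit m 11 ^^ digit m 13
  | 1 => digit m 11 ^^ digit m 7 ^^ digit m 14
  | 2 => digit m 13 ^^ digit m 7 ^^ digit m 14
  | 3 => digit m 14 ^^ digit m 13 ^^ digit m 11
  | 4 => digit m 22 ^^ digit m 13 ^^ digit m 11
  | _ => digit m 38 ^^ digit m 13 ^^ digit m 11

/-- The elements of the ground set with the set of codes of the triples that contain them. -/
def masks : List (ℕ × ℕ) :=
  [(0, 565320811554944), (1, 1130607262845056), (2, 4521604405026944), (3, 72081783662864384), (4,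
  78250043901476864), (5, 78274679457972224)]

/-- The code after reorientation to a normal form. -/
def normalizeCode (m : ℕ) : ℕ :=
  masks.foldr (fun p a => bif normalBit m p.1 then Nat.xor a p.2 else a) m

/-- The signs of the reorientation to a normal form. -/
def normalSigns (χ : SignVector 3 6) (i : Fin 6) : ℤˣ := bitSign (normalBit (signCode χ) i)

/-- The entries which are positive in the normal form. -/
def normalCodes : List ℕ := [7, 14, 22, 38, 13, 11]

theorem testBit_masks : ∀ p ∈ masks, ∀ n < 64, p.2.testBit n =
    (decide (n ∈ allCodes) && n.testBit p.1) := by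
  decide +kernel

theorem masks_lt : ∀ p ∈ masks, p.2 < 2 ^ 64 := by
  decide +kernel

theorem lt_of_mem_allCodes : ∀ n ∈ allCodes, n < 64 := by
  decide +kernel

theorem testBit_mask_eq {p : ℕ × ℕ} (hp : p ∈ masks) (n : ℕ) : p.2.testBit n =
    (decide (n ∈ allCodes) && n.testBit p.1) := by
  by_cases hn : n < 64
  · exact testBit_masks p hp n hn
  · have h1 : n ∉ allCodes := fun h => hn (lt_of_mem_allCodes n h)
    rw [Nat.testBit_lt_two_pow ((masks_lt p hp).trans_le
      (Nat.pow_le_pow_right two_pos (not_lt.1 hn)))]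
    simp [h1]

theorem mem_decode_iff : ∀ n ∈ allCodes, ∀ i : Fin 6, i ∈ (decode n).1 ↔ n.testBit i = true := by
  decide +kernel

theorem testBit_foldr_xor (b : ℕ → Bool) (P : List (ℕ × ℕ)) (hP : ∀ p ∈ P, p ∈ masks) (m n : ℕ) :
    (P.foldr (fun p a => bif b p.1 then Nat.xor a p.2 else a) m).testBit n =
      ((decide (n ∈ allCodes) && P.foldr (fun p a => a ^^ (b p.1 && n.testBit p.1)) false) ^^
        m.testBit n) := by
  induction P with
  | nil => simp
  | cons p P ih =>
    have hp := testBit_mask_eq (hP p List.mem_cons_self) n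
    have ih := ih fun q hq => hP q (List.mem_cons_of_mem _ hq)
    rw [List.foldr_cons, List.foldr_cons]
    generalize P.foldr (fun p a => bif b p.1 then Nat.xor a p.2 else a) m = M at *
    generalize P.foldr (fun p a => a ^^ (b p.1 && n.testBit p.1)) false = c at *
    cases hb : b p.1
    · simp [ih]
    · change (M ^^^ p.2).testBit n = _
      rw [Nat.testBit_xor, ih, hp]
      cases decide (n ∈ allCodes) <;> cases n.testBit p.1 <;> cases c <;> cases m.testBit n <;> rfl

/-- The product over a triple is extended to all six elements, with trivial factors outside, and
then read as an exclusive disjunction. -/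
theorem prod_bitSign {n : ℕ} (hn : n ∈ allCodes) (b : ℕ → Bool) :
    signBit (∏ i ∈ (decode n).1, bitSign (b (i : Fin 6))) =
      masks.foldr (fun p a => a ^^ (b p.1 && n.testBit p.1)) false := by
  have e : ∏ i ∈ (decode n).1, bitSign (b (i : Fin 6)) =
      ∏ i : Fin 6, bitSign (b i && n.testBit i) := by
    rw [← Finset.prod_subset (Finset.subset_univ (decode n).1)]
    · refine Finset.prod_congr rfl fun i hi => ?_
      rw [(mem_decode_iff n hn i).1 hi, Bool.and_true]
    · intro i _ hi
      rw [mem_decode_iff n hn i, Bool.not_eq_true] at hi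
      rw [hi, Bool.and_false]
      rfl
  rw [e, Fin.prod_univ_six]
  simp only [bitSign_mul, signBit_bitSign, masks, List.foldr_cons, List.foldr_nil]
  simp only [Bool.false_bne, Bool.bne_assoc]
  simp only [Fin.isValue, Fin.coe_ofNat_eq_mod, Nat.reduceMod]
  generalize (b 0 && n.testBit 0) = c₀
  generalize (b 1 && n.testBit 1) = c₁
  generalize (b 2 && n.testBit 2) = c₂
  generalize (b 3 && n.testBit 3) = c₃
  generalize (b 4 && n.testBit 4) = c₄
  generalize (b 5 && n.testBit 5) = c₅
  revert c₀ c₁ c₂ c₃ c₄ c₅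
  decide

theorem signCode_reorient_normalSigns (χ : SignVector 3 6) :
    signCode (reorient (normalSigns χ) χ) = normalizeCode (signCode χ) := by
  symm
  apply eq_signCode_of_testBit
  intro n
  rw [normalizeCode, testBit_foldr_xor _ _ fun _ => id]
  by_cases hn : n ∈ allCodes
  · rw [testBit_signCode hn, reorient, signBit_mul]
    simp only [hn, decide_true, Bool.true_and]
    rw [← prod_bitSign hn]
    rfl
  · rw [signCode, testBit_restrict]
    simp [hn]

/-- Over the field with two elements, the entries 012, 013, 023, 123 determine t₀, …, t₃: the sum of
the three that contain a given letter is its t. Then 124 and 125 determine t₄ and t₅. These are the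
formulas in `normalBit`. -/
theorem normal_reorient (χ : SignVector 3 6) : ∀ n ∈ normalCodes,
    signBit (reorient (normalSigns χ) χ (decode n)) = false := by
  intro n hn
  have hn' : n ∈ allCodes := by revert n; decide
  rw [← testBit_signCode hn', signCode_reorient_normalSigns, normalizeCode,
    testBit_foldr_xor _ _ fun _ => id]
  simp only [normalCodes, List.mem_cons, List.not_mem_nil, or_false] at hn
  rw [decide_eq_true hn', Bool.true_and]
  generalize signCode χ = m
  simp only [masks, List.foldr_cons, List.foldr_nil, normalBit, digit_eq_testBit]
  rcases hn with rfl | rfl | rfl | rfl | rfl | rfl <;>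
    generalize m.testBit 7 = c₀ <;> generalize m.testBit 11 = c₁ <;>
    generalize m.testBit 13 = c₂ <;> generalize m.testBit 14 = c₃ <;>
    generalize m.testBit 22 = c₄ <;> generalize m.testBit 38 = c₅ <;>
    revert c₀ c₁ c₂ c₃ c₄ c₅ <;> decide

/-! ### Relabeling -/

/-- All increasing triples, in the order of their codes. -/
def triples : List (Fin 6 × Fin 6 × Fin 6) :=
  [(0, 1, 2), (0, 1, 3), (0, 1, 4), (0, 1, 5), (0, 2, 3), (0, 2, 4), (0, 2, 5), (0, 3, 4), (0, 3,
  5), (0, 4, 5), (1, 2, 3), (1, 2, 4), (1, 2, 5), (1, 3, 4), (1, 3, 5), (1, 4, 5), (2, 3, 4), (2,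
  3, 5), (2, 4, 5), (3, 4, 5)]

/-- The parity of the number of inversions of a triple. -/
def parity (i j k : Fin 6) : Bool := Nat.blt j i ^^ Nat.blt k i ^^ Nat.blt k j

theorem signBit_sgn3 : ∀ i j k : Fin 6, i ≠ j → i ≠ k → j ≠ k →
    signBit (sgn3 i j k) = parity i j k := by
  decide +kernel

/-- The code after relabeling by `f`. -/
def relabelCode (f : Fin 6 → Fin 6) (m : ℕ) : ℕ :=
  triples.foldr (fun τ a => bif parity (f τ.1) (f τ.2.1) (f τ.2.2) ^^
    digit m (code3 (f τ.1) (f τ.2.1) (f τ.2.2)) then Nat.lor a (Nat.pow 2 (code3 τ.1 τ.2.1 τ.2.2))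
    else a) 0

theorem map_triples : triples.map (fun τ => code3 τ.1 τ.2.1 τ.2.2) = allCodes := by
  decide +kernel

theorem lt_of_mem_triples : ∀ τ ∈ triples, τ.1 < τ.2.1 ∧ τ.2.1 < τ.2.2 := by
  decide +kernel

theorem signCode_relabel (σ : Equiv.Perm (Fin 6)) (χ : SignVector 3 6) :
    signCode (relabel σ χ) = relabelCode σ (signCode χ) := by
  rw [signCode, restrict, ← map_triples, List.foldr_map, relabelCode]
  refine List.foldr_ext _ _ _ fun τ hτ a => ?_
  obtain ⟨h₁, h₂⟩ := lt_of_mem_triples τ hτ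
  have hij := σ.injective.ne h₁.ne
  have hjk := σ.injective.ne h₂.ne
  have hik := σ.injective.ne (h₁.trans h₂).ne
  have e : signBit (relabel σ χ (decode (code3 τ.1 τ.2.1 τ.2.2))) =
      (parity (σ τ.1) (σ τ.2.1) (σ τ.2.2) ^^
        digit (signCode χ) (code3 (σ τ.1) (σ τ.2.1) (σ τ.2.2))) := by
    rw [digit_eq_testBit, testBit_signCode (code3_mem_allCodes _ _ _ hij hik hjk),
      ← signBit_sgn3 _ _ _ hij hik hjk, ← signBit_mul]
    change signBit (relabel σ χ (tr τ.1 τ.2.1 τ.2.2)) = signBit (alt χ _ _ _)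
    rw [← alt_of_lt (relabel σ χ) h₁ h₂, alt_relabel σ χ h₁.ne (h₁.trans h₂).ne h₂.ne]
  rw [e]

/-- The code of the normal form after relabeling by `f`. -/
noncomputable def normalForm (f : Fin 6 → Fin 6) (m : ℕ) : ℕ :=
  forceNat (relabelCode f m) normalizeCode

/-! ### Enumeration of the chirotopes in normal form -/

/-- The signs in `m` are compatible with the three-term relations `rs`. -/
def signsOk (rs : List CodedRel) (m : ℕ) : Bool :=
  rs.all fun ρ => bif pairDigit m ρ.2.1 ^^ pairDigit m ρ.2.2 then true else
    !(pairDigit m ρ.1 ^^ pairDigit m ρ.2.1)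

/-- Prepends `m` to a list if its signs are compatible with `rs`. -/
def consSigns (rs : List CodedRel) (m : ℕ) (L : List ℕ) : List ℕ :=
  bif signsOk rs m then m :: L else L

/-- Extends all members of a list by a further sign. -/
noncomputable def extendSigns (n : ℕ) (rs : List CodedRel) (L : List ℕ) : List ℕ :=
  List.rec [] (fun m _ acc => consSigns rs m (consSigns rs (Nat.lor m (Nat.pow 2 n)) acc)) L

/-- Extends all members of a list by further signs. -/
noncomputable def enumerateSigns : List (ℕ × List CodedRel) → List ℕ → List ℕ
  | [], L => L
  | c :: T, L => enumerateSigns T (extendSigns c.1 c.2 L)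

/-- The order in which the signs are chosen, with the relations that can be checked each time. -/
def signTable : List (ℕ × List CodedRel) :=
  [(21, []), (26, []), (28, [((13, 22), (7, 28), (21, 14))]), (52, []), (37, [((21, 38), (7, 52),
  (37, 22))]), (25, [((13, 26), (11, 28), (25, 14))]), (19, [((11, 21), (7, 25), (19, 13)), ((11,
  22), (7, 26), (19, 14)), ((21, 26), (19, 28), (25, 22))]), (44, [((13, 38), (7, 44), (37, 14)),
  ((21, 44), (13, 52), (37, 28)), ((22, 44), (14, 52), (38, 28))]), (50, []), (42, [((22, 42),
  (14, 50), (38, 26))]), (56, [((26, 44), (14, 56), (42, 28)), ((26, 52), (22, 56), (50, 28)),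
  ((42, 52), (38, 56), (50, 44))]), (49, [((21, 50), (19, 52), (49, 22)), ((25, 50), (19, 56),
  (49, 26)), ((25, 52), (21, 56), (49, 28))]), (35, [((19, 37), (7, 49), (35, 21)), ((11, 38), (7,
  42), (35, 14)), ((19, 38), (7, 50), (35, 22)), ((19, 42), (11, 50), (35, 26)), ((37, 50), (35,
  52), (49, 38))]), (41, [((11, 37), (7, 41), (35, 13)), ((19, 41), (11, 49), (35, 25)), ((21,
  41), (13, 49), (37, 25)), ((13, 42), (11, 44), (41, 14)), ((25, 42), (11, 56), (41, 26)), ((25,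
  44), (13, 56), (41, 28)), ((37, 42), (35, 44), (41, 38)), ((41, 50), (35, 56), (49, 42)), ((41,
  52), (37, 56), (49, 44))])]

/-- The relations in the table hold and involve known entries only. -/
def validSigns : List (ℕ × List CodedRel) → List ℕ → Bool
  | [], _ => true
  | c :: T, K => (c.2.all fun ρ => decide (ρ ∈ relations 3) && bothKnown (c.1 :: K) ρ.1 &&
      bothKnown (c.1 :: K) ρ.2.1 && bothKnown (c.1 :: K) ρ.2.2) && validSigns T (c.1 :: K)

theorem validSigns_signTable : validSigns signTable normalCodes = true := by
  decide +kernel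

/-- For the all-positive representative the odd monomial is always that of ac|bd, so `relations 3`
serves as a plain list of the Plücker relations for an arbitrary χ. The other two monomials enter
with a plus sign; if their signs agree, the middle one must agree as well, or all three terms would
have one sign. -/
theorem signBit_relation {χ : SignVector 3 6} (hχ : IsChirotope χ) {ρ : CodedRel}
    (hρ : ρ ∈ relations 3)
    (h : signBit (χ (decode ρ.2.1.1) * χ (decode ρ.2.1.2)) =
      signBit (χ (decode ρ.2.2.1) * χ (decode ρ.2.2.2))) :
    signBit (χ (decode ρ.1.1) * χ (decode ρ.1.2)) =
      signBit (χ (decode ρ.2.1.1) * χ (decode ρ.2.1.2)) := by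
  rw [← map_codedRel_quints] at hρ
  obtain ⟨⟨l, a, b, c, d⟩, hq, rfl⟩ := List.mem_map.1 hρ
  obtain ⟨hd, h₁, h₂, h₃⟩ := mem_quints.1 hq
  have e : codedRel (negCode 3) (l, a, b, c, d) = ((code3 l a c, code3 l b d),
      (code3 l a b, code3 l c d), (code3 l a d, code3 l b c)) := by
    change codedRel 0 (l, a, b, c, d) = _
    simp [codedRel]
  rw [e, signBit_inj] at h ⊢
  have hn := hχ.not_of_sorted hd h₁ h₂ h₃
  change χ (tr l a b) * χ (tr l c d) = χ (tr l a d) * χ (tr l b c) at h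
  change χ (tr l a c) * χ (tr l b d) = χ (tr l a b) * χ (tr l c d)
  have hu : ∀ u v : ℤˣ, u = v ∨ u = -v := by decide
  rcases hu (χ (tr l a c) * χ (tr l b d)) (χ (tr l a b) * χ (tr l c d)) with h' | h'
  · exact h'
  · exact absurd ⟨by rw [h', neg_neg], h⟩ hn

theorem mem_consSigns {rs : List CodedRel} {m n : ℕ} {L : List ℕ} :
    n ∈ consSigns rs m L ↔ (n = m ∧ signsOk rs m = true) ∨ n ∈ L := by
  unfold consSigns
  cases h : signsOk rs m <;> simp

theorem mem_extendSigns {rs : List CodedRel} {m n k : ℕ} {L : List ℕ} (hm : m ∈ L)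
    (hk : k = m ∨ k = m ||| 2 ^ n) (ha : signsOk rs k = true) : k ∈ extendSigns n rs L := by
  induction L with
  | nil => simp at hm
  | cons a L ih =>
    change k ∈ consSigns rs a (consSigns rs (a ||| 2 ^ n) (extendSigns n rs L))
    simp only [mem_consSigns]
    rcases List.mem_cons.1 hm with rfl | hm
    · rcases hk with rfl | rfl
      · exact Or.inl ⟨rfl, ha⟩
      · exact Or.inr (Or.inl ⟨rfl, ha⟩)
    · exact Or.inr (Or.inr (ih hm))

/-- The restriction of χ to the signs chosen so far is never discarded: by `validSigns` the
relations tested at a stage involve only entries already chosen, and χ satisfies them. -/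
theorem restrict_mem_enumerateSigns {χ : SignVector 3 6} (hχ : IsChirotope χ)
    (T : List (ℕ × List CodedRel)) (K : List ℕ) (L : List ℕ) (hT : validSigns T K = true)
    (hL : restrict (fun n => signBit (χ (decode n))) K ∈ L) :
    restrict (fun n => signBit (χ (decode n))) ((T.map Prod.fst).reverse ++ K) ∈
      enumerateSigns T L := by
  induction T generalizing K L with
  | nil => exact hL
  | cons c T ih =>
    rw [validSigns, Bool.and_eq_true, List.all_eq_true] at hT
    rw [enumerateSigns, List.map_cons, List.reverse_cons, List.append_assoc, List.singleton_append]
    refine ih (c.1 :: K) _ hT.2 (mem_extendSigns hL ?_ ?_)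
    · have e : restrict (fun n => signBit (χ (decode n))) (c.1 :: K) = bif signBit (χ (decode c.1))
          then restrict (fun n => signBit (χ (decode n))) K ||| 2 ^ c.1
          else restrict (fun n => signBit (χ (decode n))) K := rfl
      rw [e]
      cases signBit (χ (decode c.1))
      · exact Or.inl rfl
      · exact Or.inr rfl
    · rw [signsOk, List.all_eq_true]
      intro ρ hρ
      have hv := hT.1 ρ hρ
      simp only [Bool.and_eq_true, decide_eq_true_iff] at hv
      obtain ⟨⟨⟨h0, h1⟩, h2⟩, h3⟩ := hv
      have key : ∀ p, bothKnown (c.1 :: K) p = true →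
          pairDigit (restrict (fun n => signBit (χ (decode n))) (c.1 :: K)) p =
            signBit (χ (decode p.1) * χ (decode p.2)) := by
        intro p hp
        rw [bothKnown, Bool.and_eq_true, elem_iff, elem_iff] at hp
        rw [pairDigit, digit_eq_testBit, digit_eq_testBit, testBit_restrict, testBit_restrict,
          signBit_mul]
        simp only [hp.1, hp.2, decide_true, Bool.true_and]
      rw [key _ h1, key _ h2, key _ h3]
      have := signBit_relation hχ h0
      revert this
      cases signBit (χ (decode ρ.2.1.1) * χ (decode ρ.2.1.2)) <;>
        cases signBit (χ (decode ρ.2.2.1) * χ (decode ρ.2.2.2)) <;>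
        cases signBit (χ (decode ρ.1.1) * χ (decode ρ.1.2)) <;> simp

theorem mem_order_iff : ∀ n < 64, n ∈ (signTable.map Prod.fst).reverse ++ normalCodes ↔
    n ∈ allCodes := by
  decide +kernel

theorem order_lt : ∀ n ∈ (signTable.map Prod.fst).reverse ++ normalCodes, n < 64 := by
  decide +kernel

/-- The code of a chirotope in normal form is enumerated. -/
theorem signCode_mem_enumerateSigns {χ : SignVector 3 6} (hχ : IsChirotope χ)
    (hn : ∀ n ∈ normalCodes, signBit (χ (decode n)) = false) :
    signCode χ ∈ enumerateSigns signTable [0] := by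
  have h0 : restrict (fun n => signBit (χ (decode n))) normalCodes = 0 := by
    refine Nat.eq_of_testBit_eq fun n => ?_
    rw [testBit_restrict, Nat.zero_testBit]
    by_cases h : n ∈ normalCodes
    · rw [hn n h, Bool.and_false]
    · simp [h]
  have h1 := restrict_mem_enumerateSigns hχ signTable normalCodes [0] validSigns_signTable
    (by rw [h0]; exact List.mem_singleton_self 0)
  have h2 : signCode χ = restrict (fun n => signBit (χ (decode n)))
      ((signTable.map Prod.fst).reverse ++ normalCodes) := by
    refine Nat.eq_of_testBit_eq fun n => ?_
    rw [signCode, testBit_restrict, testBit_restrict]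
    congr 1
    rw [decide_eq_decide]
    by_cases h : n < 64
    · exact (mem_order_iff n h).symm
    · exact ⟨fun h' => absurd (lt_of_mem_allCodes n h') h, fun h' => absurd (order_lt n h') h⟩
  rwa [h2]

/-! ### The classification -/

/-- Relabelings one of which decreases the code of a given chirotope in normal form, except for
four chirotopes. -/
def reducingPerms : List (Fin 6 → Fin 6) :=
  [![3, 1, 0, 5, 4, 2], ![3, 0, 1, 5, 4, 2], ![4, 1, 2, 0, 5, 3], ![1, 2, 3, 0, 4, 5], ![2, 5, 4,
  1, 0, 3], ![4, 3, 2, 5, 0, 1], ![0, 3, 2, 1, 5, 4], ![0, 1, 2, 5, 3, 4], ![1, 2, 4, 3, 5, 0],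
  ![0, 1, 4, 3, 2, 5], ![0, 3, 1, 5, 2, 4]]

/-- Relabelings that lead from the remaining chirotopes to the representatives. -/
def finalPerms : List ((Fin 6 → Fin 6) × Fin 4) :=
  [(![0, 1, 3, 2, 4, 5], 0), (![2, 1, 0, 5, 3, 4], 1), (![1, 0, 5, 4, 3, 2], 2), (![0, 1, 2, 3, 4,
  5], 3)]

theorem distinct_perms :
    (reducingPerms ++ finalPerms.map Prod.fst).all (fun f =>
      distinct ((List.finRange 6).map fun i => (f i : ℕ))) = true := by
  decide +kernel

theorem bijective_of_mem {f : Fin 6 → Fin 6} (hf : f ∈ reducingPerms ++ finalPerms.map Prod.fst) :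
    Function.Bijective f := by
  have h := nodup_of_distinct (List.all_eq_true.1 distinct_perms f hf)
  refine Finite.injective_iff_bijective.1 fun i j hij => ?_
  exact List.inj_on_of_nodup_map h (List.mem_finRange i) (List.mem_finRange j)
    (congrArg Fin.val hij)

/-- The relabelings need not produce a minimal code at once. It is enough that each code is lowered
strictly or sent to a representative. -/
theorem classificationCheck : (forceList (enumerateSigns signTable [0]) fun L => L.all fun m =>
    (reducingPerms.any fun f => Nat.blt (normalForm f m) m) ||
      finalPerms.any fun f => Nat.beq (normalForm f.1 m) (negCode f.2)) = true := by
  decide +kernel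

/-! ### Isomorphism as an equivalence relation, and descent to the representatives -/

theorem isomorphic_iff {χ χ' : SignVector 3 6} : Isomorphic χ χ' ↔
    ∃ (σ : Equiv.Perm (Fin 6)) (t : Fin 6 → ℤˣ), ∀ i j k, i ≠ j → i ≠ k → j ≠ k →
      alt χ' i j k = t i * t j * t k * alt χ (σ i) (σ j) (σ k) := by
  refine exists₂_congr fun σ t => ⟨fun h i j k hij hik hjk => alt_of_eq h hij hik hjk, fun h => ?_⟩
  refine alt_injective fun i j k h₁ h₂ => ?_
  rw [h i j k h₁.ne (h₁.trans h₂).ne h₂.ne, alt_of_eq rfl h₁.ne (h₁.trans h₂).ne h₂.ne]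

theorem Isomorphic.symm {χ χ' : SignVector 3 6} (h : Isomorphic χ χ') : Isomorphic χ' χ := by
  obtain ⟨σ, t, h⟩ := isomorphic_iff.1 h
  refine isomorphic_iff.2 ⟨σ.symm, fun i => t (σ.symm i), fun i j k hij hik hjk => ?_⟩
  rw [h _ _ _ (σ.symm.injective.ne hij) (σ.symm.injective.ne hik) (σ.symm.injective.ne hjk)]
  simp only [Equiv.apply_symm_apply]
  rw [← mul_assoc, Int.units_mul_self, one_mul]

theorem Isomorphic.trans {χ χ' χ'' : SignVector 3 6} (h : Isomorphic χ χ')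
    (h' : Isomorphic χ' χ'') : Isomorphic χ χ'' := by
  obtain ⟨σ, t, h⟩ := isomorphic_iff.1 h
  obtain ⟨σ', t', h'⟩ := isomorphic_iff.1 h'
  refine isomorphic_iff.2 ⟨σ'.trans σ, fun i => t' i * t (σ' i), fun i j k hij hik hjk => ?_⟩
  rw [h' i j k hij hik hjk, h _ _ _ (σ'.injective.ne hij) (σ'.injective.ne hik)
    (σ'.injective.ne hjk)]
  simp only [Equiv.trans_apply, mul_assoc, mul_left_comm, mul_comm]

theorem IsChirotope.of_eq {σ : Equiv.Perm (Fin 6)} {t : Fin 6 → ℤˣ} {χ χ' : SignVector 3 6}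
    (hχ : IsChirotope χ) (h : χ' = reorient t (relabel σ χ)) : IsChirotope χ' := by
  intro l a b c d hd hn
  refine hχ _ _ _ _ _ (hd.map σ) ?_
  obtain ⟨⟨la, lb, lc, ld⟩, nab, nac, nad, nbc, nbd, ncd⟩ := hd
  rw [alt_of_eq h la lb nab, alt_of_eq h lc ld ncd, alt_of_eq h la lc nac, alt_of_eq h lb ld nbd,
    alt_of_eq h la ld nad, alt_of_eq h lb lc nbc] at hn
  obtain ⟨e0, e1, e2⟩ := signs_factor t l a b c d
  rwa [e0, e1, e2, ← mul_neg, mul_right_inj, mul_right_inj] at hn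

theorem relabel_refl (χ : SignVector 3 6) : relabel (Equiv.refl _) χ = χ := by
  refine alt_injective fun i j k h₁ h₂ => ?_
  rw [alt_relabel _ _ h₁.ne (h₁.trans h₂).ne h₂.ne]
  rfl

/-- Strong induction on the code: a reducing relabeling, followed by a return to normal form, yields
an isomorphic chirotope in normal form with smaller code. -/
theorem exists_isomorphic_of_normal (m : ℕ) {χ : SignVector 3 6} (hχ : IsChirotope χ)
    (hn : ∀ n ∈ normalCodes, signBit (χ (decode n)) = false) (hm : signCode χ = m) :
    ∃ i, Isomorphic (representative i) χ := by
  induction m using Nat.strong_induction_on generalizing χ with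
  | _ m ih =>
    have h := classificationCheck
    rw [forceList_eq, List.all_eq_true] at h
    have h := h _ (signCode_mem_enumerateSigns hχ hn)
    simp only [Bool.or_eq_true, List.any_eq_true, Nat.blt_eq, Nat.beq_eq] at h
    have key : ∀ σ : Equiv.Perm (Fin 6), ∃ t, signCode (reorient t (relabel σ χ)) =
        normalForm σ (signCode χ) ∧ ∀ n ∈ normalCodes,
          signBit (reorient t (relabel σ χ) (decode n)) = false := by
      intro σ
      refine ⟨normalSigns (relabel σ χ), ?_, normal_reorient _⟩
      rw [signCode_reorient_normalSigns, normalForm, forceNat_eq, signCode_relabel]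
    rcases h with ⟨f, hf, hlt⟩ | ⟨f, hf, he⟩
    · have hb := bijective_of_mem (List.mem_append_left _ hf)
      obtain ⟨t, ht, ht'⟩ := key (Equiv.ofBijective f hb)
      change _ = normalForm f (signCode χ) at ht
      obtain ⟨i, hi⟩ := ih (normalForm f (signCode χ)) (hm ▸ hlt) (hχ.of_eq rfl) ht' ht
      exact ⟨i, hi.trans (Isomorphic.symm ⟨_, t, rfl⟩)⟩
    · have hb := bijective_of_mem (List.mem_append_right _ (List.mem_map_of_mem hf))
      obtain ⟨t, ht, -⟩ := key (Equiv.ofBijective f.1 hb)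
      change _ = normalForm f.1 (signCode χ) at ht
      rw [he, ← signCode_representative] at ht
      exact ⟨f.2, Isomorphic.symm ⟨_, t, (signCode_inj ht).symm⟩⟩

/-- Every chirotope is isomorphic to one of the representatives. -/
theorem exists_isomorphic {χ : SignVector 3 6} (hχ : IsChirotope χ) :
    ∃ i, Isomorphic (representative i) χ := by
  have e : reorient (normalSigns χ) χ = reorient (normalSigns χ) (relabel (Equiv.refl _) χ) := by
    rw [relabel_refl]
  obtain ⟨i, hi⟩ := exists_isomorphic_of_normal _ (hχ.of_eq e) (normal_reorient χ) rfl
  exact ⟨i, hi.trans (Isomorphic.symm ⟨_, _, e⟩)⟩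

end Chirotropical

namespace Chirotropical

/-! ### Realizations of the representatives -/

/-- Integer matrices that realize the representatives. -/
def realization : Fin 4 → Matrix (Fin 3) (Fin 6) ℤ :=
  ![!![1, 0, 0, 1, 2, 2; 0, 1, 0, -2, -2, -1; 0, 0, 1, 2, 1, 2],
    !![1, 0, 0, 1, 3, 3; 0, 1, 0, -2, -2, -3; 0, 0, 1, 3, 2, 1],
    !![1, 0, 0, 1, 3, 4; 0, 1, 0, -2, -3, -3; 0, 0, 1, 4, 4, 1],
    !![1, 0, 0, 1, 2, 2; 0, 1, 0, -2, -3, -2; 0, 0, 1, 2, 2, 1]]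

theorem sign_realization : ∀ r, ∀ i j k : Fin 6, i < j → j < k →
    SignType.sign (realization r 0 i * realization r 1 j * realization r 2 k
      - realization r 0 i * realization r 1 k * realization r 2 j
      - realization r 0 j * realization r 1 i * realization r 2 k
      + realization r 0 j * realization r 1 k * realization r 2 i
      + realization r 0 k * realization r 1 i * realization r 2 j
      - realization r 0 k * realization r 1 j * realization r 2 i) =
    if representative r (tr i j k) = 1 then 1 else -1 := by
  decide +kernel

theorem isRealizable_representative (r : Fin 4) : IsRealizable (representative r) := by
  refine ⟨(realization r).map (Int.castRingHom ℝ), fun I => ?_⟩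
  obtain ⟨i, j, k, h₁, h₂, rfl⟩ := exists_eq_tr I
  rw [← map_pluckerCoord, pluckerCoord_tr_of_lt _ h₁ h₂, eq_intCast, colDet_eq, sign_intCast,
    sign_realization r i j k h₁ h₂]
  rcases Int.units_eq_one_or (representative r (tr i j k)) with h | h <;> rw [h] <;> simp

end Chirotropical

/-! ### Assembly of the theorem -/

theorem theorem5p1 :
    (∀ i : Fin 4, IsRealizable (representative i)) ∧
    ∀ χ : SignVector 3 6, IsRealizable χ →
      (∃! i : Fin 4, Isomorphic (representative i) χ) ∧
      chiDressian χ = chiGrassmannian χ ∧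
      IsPolyhedralFan (chiFan χ) ∧
      (⋃ C ∈ chiFan χ, (C : Set (KSubset 3 6 → ℝ))) = chiDressian χ ∧
      (∀ C ∈ chiFan χ, C.lineal = lineality 3 6) ∧
      IsPureOfDim (lineality 3 6) (chiFan χ) 4 ∧
      ∀ i : Fin 4, Isomorphic (representative i) χ →
        ∀ d : Fin 4, numCones (lineality 3 6) (chiFan χ) (d + 1) = fVectors i d := by
  refine ⟨isRealizable_representative, fun χ hχ => ?_⟩
  replace hχ := hχ.isChirotope
  have hi := fun i => (isRealizable_representative i).isChirotope
  have model : ∀ i, Isomorphic (representative i) χ → ∃ P, IsModel i χ P := by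
    rintro i ⟨σ, t, h⟩
    exact ⟨_, isModel_of_eq h (hi i) hχ⟩
  have count : ∀ i, Isomorphic (representative i) χ → ∀ d : Fin 4,
      numCones (lineality 3 6) (chiFan χ) (d + 1) = fVectors i d := by
    intro i h
    obtain ⟨P, hP⟩ := model i h
    exact hP.numCones_eq
  obtain ⟨i, hiso⟩ := exists_isomorphic hχ
  obtain ⟨P, hP⟩ := model i hiso
  refine ⟨⟨i, hiso, fun j hj => ?_⟩, ?_, isPolyhedralFan_chiFan hχ, iUnion_chiFan hχ, ?_,
    hP.isPureOfDim, count⟩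
  -- Uniqueness comes from the f-vector: it is computed from `χ` itself, and the four rows of the
  -- table are pairwise distinct.
  · have h : ∀ d, fVectors j d = fVectors i d := fun d => (count j hj d).symm.trans (count i hiso d)
    have inj : ∀ i j, (∀ d, fVectors j d = fVectors i d) → j = i := by decide
    exact inj i j h
  · exact hP.chiDressian_eq_chiGrassmannian fun Q hQ y hy hs =>
      liftable_of_mem_programs (hi i) hQ hy hs
  · rintro _ ⟨w, -, rfl⟩
    exact lineal_dressianCone w
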